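/- Let $L,N_{st},N_p\ge 1$ be integers, $N=N_{st}N_p$, and let $y_1,\dots,y_L\in\mathbb C^{N}$. Let $Y_l\in\mathbb C^{N_p\times N_{st}}$ be the matrix with $\mathrm{vec}(Y_l)=y_l$ (columns stacked), with rows $r_{j,l}\in\mathbb C^{N_{st}}$ and columns $c_{i,l}\in\mathbb C^{N_p}$. Let $\rho_{st},\rho_p\in[0,1)$, $\alpha_{st}=\frac{N_p\rho_{st}}{1-\rho_{st}}$, $\alpha_p=\frac{N_{st}\rho_p}{1-\rho_p}$. Assume: (1) no $r_{j,l}$ and no $c_{i,l}$ is the zero vector; (2) there are $\beta_1,\beta_2\in[0,1]$ with $\beta_1+\beta_2=1$ such that for all subspaces $0\ne S_{st}\subsetneq\mathbb C^{N_{st}}$ and $0\ne S_p\subsetneq\mathbb C^{N_p}$ $$\beta_1LN\,P(S_{st})<(LN_p+\alpha_{st}L)\dim S_{st}-\beta_2LN,\qquad \beta_2LN\,P(S_p)<(LN_{st}+\alpha_pL)\dim S_p-\beta_1LN,$$ where $P(S_{st})$ is the proportion of the $LN_p$ rows $r_{j,l}$ that lie in $S_{st}$ and $P(S_p)$ the proportion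 of the $LN_{st}$ columns $c_{i,l}$ that lie in $S_p$. For positive definite Hermitian $R_{st}\in\mathbb C^{N_{st}\times N_{st}}$, $R_p\in\mathbb C^{N_p\times N_p}$ put $q_l(R_{st},R_p)=y_l^{H}(R_{st}\otimes R_p)^{-1}y_l$, $$\Phi_{st}(R_{st},R_p)=(1-\rho_{st})\frac{N_{st}}{L}\sum_{l=1}^L\frac{(Y_l^{H}R_p^{-1}Y_l)^{T}}{q_l(R_{st},R_p)}+\rho_{st}I,\qquad \Phi_{p}(R_{st},R_p)=(1-\rho_p)\frac{N_p}{L}\sum_{l=1}^L\frac{Y_l(R_{st}^{-1})^{T}Y_l^{H}}{q_l(R_{st},R_p)}+\rho_pI,$$ $$\mathcal L(R_{st},R_p)=\tfrac{N_p}{1-\rho_{st}}\log\det R_{st}+\tfrac{N_{st}}{1-\rho_p}\log\det R_p+\tfrac NL\sum_{l=1}^L\log q_l(R_{st},R_p)+\alpha_{st}\,\mathrm{Tr}(R_{st}^{-1})+\alpha_p\,\mathrm{Tr}(R_p^{-1}).$$ Let $R_{st}^{(0)}$, $R_p^{(0)}$ be arbitrary positive definite matrices and, for $k\ge 0$, let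 $R_{st}^{(k+1)}=\Phi_{st}(R_{st}^{(k)},R_p^{(k)})$ and either $R_p^{(k+1)}=\Phi_p(R_{st}^{(k)},R_p^{(k)})$ for all $k$ (simultaneous updates) or $R_p^{(k+1)}=\Phi_p(R_{st}^{(k+1)},R_p^{(k)})$ for all $k$ (alternating updates). Then, in either case, all iterates are positive definite, $\mathcal L(R_{st}^{(k)},R_p^{(k)})$ is non-increasing in $k$, and $(R_{st}^{(k)},R_p^{(k)})$ converges to a pair $(R_{st},R_p)$ of positive definite matrices that solves the fixed-point equations $R_{st}=\Phi_{st}(R_{st},R_p)$, $R_p=\Phi_p(R_{st},R_p)$. -/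

import Mathlib

open scoped ComplexOrder Kronecker Matrix Topology

noncomputable section

namespace RSKE

/-- The `Np × Nst` matrix `Y` obtained by reshaping a vector `y` of length `Nst * Np`. The entries
of `y` are indexed by pairs `(i, j)`, the index set of the Kronecker product of an `Nst × Nst` and
an `Np × Np` matrix; the pair `(i, j)` (counted from 0) stands for the position `Np * i + j`. -/
def unvec {Nst Np : ℕ} (y : Fin Nst × Fin Np → ℂ) : Matrix (Fin Np) (Fin Nst) ℂ :=
  Matrix.of fun j i => y (i, j)

/-- `yᴴ (Rst ⊗ Rp)⁻¹ y`, which is a real number for positive definite `Rst`, `Rp`. -/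
def quadForm {Nst Np : ℕ} (y : Fin Nst × Fin Np → ℂ) (Rst : Matrix (Fin Nst) (Fin Nst) ℂ)
    (Rp : Matrix (Fin Np) (Fin Np) ℂ) : ℝ :=
  (star y ⬝ᵥ ((Rst ⊗ₖ Rp)⁻¹ *ᵥ y)).re

/-- The penalized negative log-likelihood. -/
def cost {L Nst Np : ℕ} (y : Fin L → Fin Nst × Fin Np → ℂ) (ρst ρp : ℝ)
    (Rst : Matrix (Fin Nst) (Fin Nst) ℂ) (Rp : Matrix (Fin Np) (Fin Np) ℂ) : ℝ :=
  (Np : ℝ) / (1 - ρst) * Real.log Rst.det.re + (Nst : ℝ) / (1 - ρp) * Real.log Rp.det.re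
    + ((Nst * Np : ℕ) : ℝ) / (L : ℝ) * ∑ l, Real.log (quadForm (y l) Rst Rp)
    + (Np : ℝ) * ρst / (1 - ρst) * (Rst⁻¹).trace.re
    + (Nst : ℝ) * ρp / (1 - ρp) * (Rp⁻¹).trace.re

/-- `(Nst / L) ∑ₗ (Yₗᴴ Rp⁻¹ Yₗ)ᵀ / (yₗᴴ (Rst ⊗ Rp)⁻¹ yₗ)`. The transpose belongs to the convention
for `⊗` and `unvec`: `yᴴ (A ⊗ B) y = tr (A (Yᴴ B Y)ᵀ)`. -/
def Cst {L Nst Np : ℕ} (y : Fin L → Fin Nst × Fin Np → ℂ)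
    (Rst : Matrix (Fin Nst) (Fin Nst) ℂ) (Rp : Matrix (Fin Np) (Fin Np) ℂ) :
    Matrix (Fin Nst) (Fin Nst) ℂ :=
  ((Nst : ℝ) / (L : ℝ)) •
    ∑ l, (quadForm (y l) Rst Rp)⁻¹ • ((unvec (y l))ᴴ * Rp⁻¹ * unvec (y l))ᵀ

/-- `(Np / L) ∑ₗ Yₗ (Rst⁻¹)ᵀ Yₗᴴ / (yₗᴴ (Rst ⊗ Rp)⁻¹ yₗ)`; here
`yᴴ (A ⊗ B) y = tr (B Y Aᵀ Yᴴ)`. -/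
def Cp {L Nst Np : ℕ} (y : Fin L → Fin Nst × Fin Np → ℂ)
    (Rst : Matrix (Fin Nst) (Fin Nst) ℂ) (Rp : Matrix (Fin Np) (Fin Np) ℂ) :
    Matrix (Fin Np) (Fin Np) ℂ :=
  ((Np : ℝ) / (L : ℝ)) •
    ∑ l, (quadForm (y l) Rst Rp)⁻¹ • (unvec (y l) * (Rst⁻¹)ᵀ * (unvec (y l))ᴴ)

/-- The shrinkage update of the first factor. -/
def updateSt {L Nst Np : ℕ} (y : Fin L → Fin Nst × Fin Np → ℂ) (ρst : ℝ)
    (Rst : Matrix (Fin Nst) (Fin Nst) ℂ) (Rp : Matrix (Fin Np) (Fin Np) ℂ) :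
    Matrix (Fin Nst) (Fin Nst) ℂ :=
  (1 - ρst) • Cst y Rst Rp + ρst • (1 : Matrix (Fin Nst) (Fin Nst) ℂ)

/-- The shrinkage update of the second factor. -/
def updateP {L Nst Np : ℕ} (y : Fin L → Fin Nst × Fin Np → ℂ) (ρp : ℝ)
    (Rst : Matrix (Fin Nst) (Fin Nst) ℂ) (Rp : Matrix (Fin Np) (Fin Np) ℂ) :
    Matrix (Fin Np) (Fin Np) ℂ :=
  (1 - ρp) • Cp y Rst Rp + ρp • (1 : Matrix (Fin Np) (Fin Np) ℂ)

/-- `(Rst, Rp)` is a positive definite solution of the pair of fixed-point equations. -/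
def IsSolution {L Nst Np : ℕ} (y : Fin L → Fin Nst × Fin Np → ℂ) (ρst ρp : ℝ)
    (Rst : Matrix (Fin Nst) (Fin Nst) ℂ) (Rp : Matrix (Fin Np) (Fin Np) ℂ) : Prop :=
  Rst.PosDef ∧ Rp.PosDef ∧ Rst = updateSt y ρst Rst Rp ∧ Rp = updateP y ρp Rst Rp

/-- Both factors are updated from the pair of the previous iteration. -/
def IsSimultaneousIteration {L Nst Np : ℕ} (y : Fin L → Fin Nst × Fin Np → ℂ) (ρst ρp : ℝ)
    (Rst : ℕ → Matrix (Fin Nst) (Fin Nst) ℂ) (Rp : ℕ → Matrix (Fin Np) (Fin Np) ℂ) : Prop :=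
  ∀ k, Rst (k + 1) = updateSt y ρst (Rst k) (Rp k) ∧ Rp (k + 1) = updateP y ρp (Rst k) (Rp k)

/-- The factors are updated in turn, the second one with the new value of the first one. -/
def IsAlternatingIteration {L Nst Np : ℕ} (y : Fin L → Fin Nst × Fin Np → ℂ) (ρst ρp : ℝ)
    (Rst : ℕ → Matrix (Fin Nst) (Fin Nst) ℂ) (Rp : ℕ → Matrix (Fin Np) (Fin Np) ℂ) : Prop :=
  ∀ k, Rst (k + 1) = updateSt y ρst (Rst k) (Rp k) ∧
    Rp (k + 1) = updateP y ρp (Rst (k + 1)) (Rp k)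

/-- The proportion of the rows `r_{j,l}` of the matrices `Yₗ` that lie in `S`. -/
def rowFraction {L Nst Np : ℕ} (y : Fin L → Fin Nst × Fin Np → ℂ)
    (S : Submodule ℂ (Fin Nst → ℂ)) : ℝ :=
  (Nat.card {p : Fin Np × Fin L // (unvec (y p.2)).row p.1 ∈ S} : ℝ) / ((L : ℝ) * (Np : ℝ))

/-- The proportion of the columns `c_{i,l}` of the matrices `Yₗ` that lie in `S`. -/
def colFraction {L Nst Np : ℕ} (y : Fin L → Fin Nst × Fin Np → ℂ)
    (S : Submodule ℂ (Fin Np → ℂ)) : ℝ :=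
  (Nat.card {p : Fin Nst × Fin L // (unvec (y p.2)).col p.1 ∈ S} : ℝ) / ((L : ℝ) * (Nst : ℝ))

/-- The sufficient condition for existence: no row and no column of any `Yₗ` vanishes, and there
are weights `β₁ + β₂ = 1` such that the samples are spread out over the proper nonzero subspaces.
The two inequalities are multiplied by `β₁ L N` and `β₂ L N`, with `N = Nst * Np`, which is what
they mean when one of the weights is zero. -/
def ExistenceCondition {L Nst Np : ℕ} (y : Fin L → Fin Nst × Fin Np → ℂ) (ρst ρp : ℝ) : Prop :=
  (∀ l, (∀ j, (unvec (y l)).row j ≠ 0) ∧ ∀ i, (unvec (y l)).col i ≠ 0) ∧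
  ∃ β₁ β₂ : ℝ, 0 ≤ β₁ ∧ 0 ≤ β₂ ∧ β₁ + β₂ = 1 ∧
    (∀ S : Submodule ℂ (Fin Nst → ℂ), S ≠ ⊥ → S ≠ ⊤ →
      β₁ * ((L : ℝ) * (Nst * Np : ℕ)) * rowFraction y S <
        ((L : ℝ) * Np + (Np : ℝ) * ρst / (1 - ρst) * L) * Module.finrank ℂ S
          - β₂ * ((L : ℝ) * (Nst * Np : ℕ))) ∧
    (∀ S : Submodule ℂ (Fin Np → ℂ), S ≠ ⊥ → S ≠ ⊤ →
      β₂ * ((L : ℝ) * (Nst * Np : ℕ)) * colFraction y S <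
        ((L : ℝ) * Nst + (Nst : ℝ) * ρp / (1 - ρp) * L) * Module.finrank ℂ S
          - β₁ * ((L : ℝ) * (Nst * Np : ℕ)))

end RSKE

end

open scoped ComplexOrder Kronecker Matrix Topology

namespace RSKE

/-! For a pair of positive definite matrices R, S choose factorizations R = P Pᴴ, S = Q Qᴴ in which
the updates are P diag(d) Pᴴ and Q diag(e) Qᴴ. The normalized squared moduli of the data in these
coordinates, averaged over the samples, form a probability matrix π. Put x = 1/d, z = 1/e, φ =
`logGap`, α = 1/(Nst(1-ρst)), β = 1/(Np(1-ρp)), and let E be the mean under π. The update equations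
make the determinant and trace terms explicit, and Jensen's inequality over the samples
(`cost_step_le`) bounds the decrease of the cost below by Nst·Np times the surrogate gap α Σ φ(xᵢ) +
β Σ φ(zⱼ) + (E x - 1) + (E z - 1) - log E[x z].

In an alternating step one family equals 1 and the gap is clearly nonnegative (`cost_updateSt_le`).
For simultaneous steps the crux is `surrogate_gap`: if the marginals of π satisfy the caps μᵢ xᵢ ≤
α, νⱼ zⱼ ≤ β, which the update equations provide, the gap is at least (α + β - 1) min(Σ φ(x), Σ
φ(z)). With both weights 1/2 this is Cauchy-Schwarz together with `log_sum_sq_le` and needs no caps.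
With β ≤ 1/2, only the extreme values of x matter and z is eliminated by duality
(`log_sum_mul_le_of_cap`, `reducedGap_exists_nonneg`); there remains the scalar inequality
`twoGroup_nonneg`. The existence condition implies α + β > 1, so a small gap controls both distances
(`sum_logGap_le_surrogateGap`), that is, the Stein losses between consecutive iterates.

The existence condition also yields `recession_inequality`: along rays of exponents the
log-determinants beat the decay of the quadratic forms. Hence the cost is coercive up to the scale
of unpenalized factors, and bounded below. A solution minimizes the cost, uniquely up to these
scales (`solution_minimizes`). So the cost converges, the Stein losses tend to 0, and positive
definite cluster points are solutions. Without shrinkage, Tr(R⁻¹R') is the dimension for the updated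
factor R', so the Stein loss is the decrease of the log-determinant; being controlled by the
decrease of the cost, the log-determinant converges and fixes the scale. The iterates stay in a
compact set and have a single cluster point. -/

/-! ### Elementary logarithmic bounds and the dual estimates for two groups -/

/-- `log x + 1 / x - 1`, which is nonnegative for `x > 0` and vanishes only at `x = 1`. -/
noncomputable def logGap (x : ℝ) : ℝ := Real.log x + x⁻¹ - 1

theorem logGap_nonneg {x : ℝ} (hx : 0 < x) : 0 ≤ logGap x := by
  have := Real.one_sub_inv_le_log_of_pos hx
  unfold logGap; linarith

theorem logGap_one : logGap 1 = 0 := by simp [logGap]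

theorem two_mul_le_log_div {k : ℝ} (h0 : 0 ≤ k) (h1 : k < 1) :
    2 * k ≤ Real.log ((1 + k) / (1 - k)) := by
  have := Real.sum_range_le_log_div h0 h1 1
  simp at this
  linarith

theorem log_weight_ratio {β : ℝ} (h0 : 0 < β) (h1 : β ≤ 1 / 2) :
    2 * (1 - 2 * β) ≤ Real.log (1 - β) - Real.log β := by
  have := two_mul_le_log_div (k := 1 - 2 * β) (by linarith) (by linarith)
  rw [← Real.log_div (by linarith) (by linarith)]
  have e : (1 + (1 - 2 * β)) / (1 - (1 - 2 * β)) = (1 - β) / β := by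
    have : (1 - (1 - 2 * β)) ≠ 0 := by linarith
    field_simp; ring
  rwa [e] at this

/-- The difference of the two sides is log(1-β) - log β - 2(1-2β), which `log_weight_ratio`
controls. -/
theorem base_bound {β d : ℝ} (h0 : 0 < β) (h1 : β ≤ 1 / 2) (hd : 0 < d) :
    (1 - β) / d - 1 - Real.log ((1 - β) / d) ≤
      Real.log d - Real.log β + (1 - β) / d + 4 * β - 3 := by
  rw [Real.log_div (by linarith) hd.ne']
  have := log_weight_ratio h0 h1
  linarith

/-- Written ψ(s) = s - 1 - log s in the comments below, so that `logGap x` = ψ(1/x). Many of the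
duality arguments are this tangent inequality at a suitable s. -/
theorem psi_nonneg {s : ℝ} (hs : 0 < s) : 0 ≤ s - 1 - Real.log s := by
  have := Real.log_le_sub_one_of_pos hs
  linarith

/-- Concavity of the logarithm at `1`. -/
theorem mul_log_le_log_one_add {w M y : ℝ} (hw : 0 ≤ w) (hM : 0 < M) (hwM : w ≤ M)
    (hy : 0 < 1 + M * y) : w / M * Real.log (1 + M * y) ≤ Real.log (1 + w * y) := by
  have hc := strictConcaveOn_log_Ioi.concaveOn
  have h1 : 0 ≤ 1 - w / M := by
    rw [sub_nonneg, div_le_one hM]; exact hwM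
  have := hc.2 (Set.mem_Ioi.2 one_pos) (Set.mem_Ioi.2 hy)
    h1 (div_nonneg hw hM.le) (by ring)
  simp only [Real.log_one, smul_eq_mul, mul_zero, zero_add] at this
  have e : (1 - w / M) * 1 + w / M * (1 + M * y) = 1 + w * y := by field_simp; ring
  rwa [e] at this

theorem sq_sub_half_le_psi {y : ℝ} (h0 : 0 < y) (h1 : y ≤ 1) :
    (1 - y) ^ 2 / 2 ≤ y - 1 - Real.log y := by
  have h := Real.le_log_one_add_of_nonneg (x := y⁻¹ - 1) (by
    have := (one_le_inv₀ h0).2 h1; linarith)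
  have e : 1 + (y⁻¹ - 1) = y⁻¹ := by ring
  rw [e, Real.log_inv] at h
  have e2 : 2 * (y⁻¹ - 1) / (y⁻¹ - 1 + 2) = 2 * (1 - y) / (1 + y) := by
    have h3 : y⁻¹ - 1 + 2 = (1 + y) / y := by field_simp; ring
    have h4 : 1 + y ≠ 0 := by linarith
    rw [h3]; field_simp
  rw [e2] at h
  have h3 : (1 - y) + (1 - y) ^ 2 / 2 ≤ 2 * (1 - y) / (1 + y) := by
    rw [le_div_iff₀ (by linarith)]
    nlinarith [mul_nonneg (sub_nonneg.2 h1) (mul_nonneg (sub_nonneg.2 h1) (sub_nonneg.2 h1)),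
      mul_nonneg h0.le (sq_nonneg (1 - y))]
  linarith

/-- This is what remains of `twoGroup_dual` with multiplier ν = 0 after `base_bound`. Replacing d by
1/2 only lowers the first logarithm. -/
theorem dual_case_low_low {β d e θ : ℝ} (h0 : 0 < β) (h1 : β ≤ 1 / 2) (hd : 0 < d)
    (hd2 : d ≤ 1 / 2) (he : 0 < e) (he2 : e ≤ 1 / 2) (hθ : 0 ≤ θ) (hθ1 : θ < 1) :
    0 ≤ -β * θ + β * Real.log (1 - θ + e * θ / d) - Real.log (1 - (1 - e) * θ) := by
  have hx : 0 ≤ e * θ := by positivity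
  have hlog : Real.log (1 - θ + 2 * (e * θ)) ≤ Real.log (1 - θ + e * θ / d) := by
    apply Real.log_le_log (by linarith)
    have : 2 * (e * θ) ≤ e * θ / d := by
      rw [le_div_iff₀ hd]; nlinarith
    linarith
  have hneg : Real.log (1 - θ + 2 * (e * θ)) ≤ 0 := by
    apply Real.log_nonpos <;> nlinarith
  -- Exponentiated, this is (1-(1-e)θ)² exp θ ≤ 1 - θ + 2eθ. The base is the convex combination,
  -- with weights 1-2e and 2e, of its values at e = 0 and e = 1/2, where the bound reduces to exp θ
  -- · (1-θ) ≤ 1 and exp θ · (1-θ/2)² ≤ 1.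
  have key : 2 * Real.log (1 - (1 - e) * θ) + θ ≤ Real.log (1 - θ + 2 * (e * θ)) := by
    rw [Real.le_log_iff_exp_le (by linarith), Real.exp_add, two_mul, Real.exp_add,
      Real.exp_log (by nlinarith)]
    have hE : Real.exp θ * (1 - θ) ≤ 1 := by
      have := Real.add_one_le_exp (-θ)
      rw [Real.exp_neg] at this
      have hp := Real.exp_pos θ
      rw [← sub_nonneg] at this
      have : 0 ≤ Real.exp θ * ((Real.exp θ)⁻¹ - (-θ + 1)) := mul_nonneg hp.le this
      rw [mul_sub, mul_inv_cancel₀ hp.ne'] at this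
      linarith
    have hE2 : Real.exp θ * (1 - θ / 2) ^ 2 ≤ 1 := by
      have := Real.add_one_le_exp (-(θ / 2))
      have h2 : (1 - θ / 2) ^ 2 ≤ Real.exp (-(θ / 2)) ^ 2 := by
        apply pow_le_pow_left₀ <;> linarith
      rw [← Real.exp_nat_mul] at h2
      have e3 : ((2 : ℕ) : ℝ) * -(θ / 2) = -θ := by push_cast; ring
      rw [e3] at h2
      calc Real.exp θ * (1 - θ / 2) ^ 2 ≤ Real.exp θ * Real.exp (-θ) := by gcongr
        _ = 1 := by rw [← Real.exp_add]; simp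
    have hp := Real.exp_pos θ
    have hconv : (1 - (1 - e) * θ) * (1 - (1 - e) * θ) ≤
        (1 - 2 * e) * (1 - θ) ^ 2 + 2 * e * (1 - θ / 2) ^ 2 := by
      have : (1 - 2 * e) * (1 - θ) ^ 2 + 2 * e * (1 - θ / 2) ^ 2 -
          (1 - (1 - e) * θ) * (1 - (1 - e) * θ) = (1 - 2 * e) * (2 * e) * (θ / 2) ^ 2 := by ring
      have h3 : 0 ≤ (1 - 2 * e) * (2 * e) * (θ / 2) ^ 2 := by
        have : 0 ≤ 1 - 2 * e := by linarith
        positivity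
      linarith
    calc (1 - (1 - e) * θ) * (1 - (1 - e) * θ) * Real.exp θ
        ≤ ((1 - 2 * e) * (1 - θ) ^ 2 + 2 * e * (1 - θ / 2) ^ 2) * Real.exp θ := by gcongr
      _ = (1 - 2 * e) * (1 - θ) * (Real.exp θ * (1 - θ)) +
          2 * e * (Real.exp θ * (1 - θ / 2) ^ 2) := by ring
      _ ≤ (1 - 2 * e) * (1 - θ) * 1 + 2 * e * 1 := by
          have : 0 ≤ (1 - 2 * e) * (1 - θ) := mul_nonneg (by linarith) (by linarith)
          gcongr
      _ = 1 - θ + 2 * (e * θ) := by ring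
  nlinarith

/-- The remainder of `twoGroup_dual` with multiplier ν = θ. The terms regroup into nonnegative
multiples of 1 - 2β. -/
theorem dual_case_low_high {β d e θ : ℝ} (h0 : 0 < β) (h1 : β ≤ 1 / 2) (hd : 0 < d)
    (hd2 : d ≤ 1 / 2) (he : 1 / 2 ≤ e) (he2 : e < 1) (hθ : 0 ≤ θ) (hθ1 : θ < 1) :
    0 ≤ θ * (d - β) + β * Real.log (1 - (1 - e) * θ)
      + β * Real.log ((1 - θ) * (1 - e * θ) + e * θ / d) - Real.log (1 - (1 - e) * θ) := by
  have hk : 0 < 1 - (1 - e) * θ := by nlinarith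
  have hlk : Real.log (1 - (1 - e) * θ) ≤ 0 := by
    apply Real.log_nonpos hk.le; nlinarith
  have hy : 0 ≤ 1 / (2 * d) - 1 := by
    rw [sub_nonneg, le_div_iff₀ (by linarith)]; linarith
  -- With y = 1/(2d) - 1 ≥ 0 the argument of the second logarithm contains the first one as a factor
  -- up to 1 + θy; concavity then gives log(1 + θy) ≥ -θ log(2d) ≥ θ(1 - 2d).
  have hR : (1 - (1 - e) * θ) * (1 + θ * (1 / (2 * d) - 1)) ≤
      (1 - θ) * (1 - e * θ) + e * θ / d := by
    have e1 : e * θ / d = e * θ * (2 * (1 / (2 * d) - 1) + 2) := by field_simp; ring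
    rw [e1]
    generalize 1 / (2 * d) - 1 = y at *
    have : (1 - θ) * (1 - e * θ) + e * θ * (2 * y + 2) -
      (1 - (1 - e) * θ) * (1 + θ * y) = e * θ ^ 2 + θ * y * (2 * e - 1 + (1 - e) * θ) := by ring
    have h2 : 0 ≤ e * θ ^ 2 + θ * y * (2 * e - 1 + (1 - e) * θ) := by
      have : 0 ≤ 2 * e - 1 + (1 - e) * θ := by nlinarith
      have : 0 < e := by linarith
      positivity
    linarith
  have h1y : 0 < 1 + θ * (1 / (2 * d) - 1) := by
    have := mul_nonneg hθ hy; linarith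
  have hlog := Real.log_le_log (by positivity) hR
  rw [Real.log_mul hk.ne' h1y.ne'] at hlog
  have hcon := mul_log_le_log_one_add (w := θ) (M := 1) (y := 1 / (2 * d) - 1) hθ one_pos hθ1.le
    (by linarith)
  have e2 : 1 + 1 * (1 / (2 * d) - 1) = (2 * d)⁻¹ := by rw [one_div]; ring
  rw [e2, Real.log_inv, div_one] at hcon
  have h2d := Real.log_le_sub_one_of_pos (show 0 < 2 * d by linarith)
  have h3 : θ * (1 - 2 * d) ≤ θ * -Real.log (2 * d) := by
    apply mul_le_mul_of_nonneg_left _ hθ; linarith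
  have h4 := mul_le_mul_of_nonneg_left (hlog.trans' (add_le_add_right (h3.trans hcon) _)) h0.le
  nlinarith [mul_nonneg hθ hd.le]

/-- If 2θ ≥ n(2-n), the term 4θ² absorbs the only negative one; otherwise the expression is treated
as a quadratic in f. -/
theorem shrink_poly {n θ f : ℝ} (hn0 : 0 < n) (hn2 : n < 2) (hθ : 0 ≤ θ) (hf0 : 0 ≤ f) :
    0 ≤ -θ * n * (2 - n) + 2 * θ * f * (2 + n) + 4 * θ ^ 2 + (4 - n ^ 2) * (n / 2 - f) ^ 2 := by
  rcases le_total (2 * θ) (n * (2 - n)) with hcc | hcc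
  · -- complete the square in `f`
    have h2n : 0 < 2 - n := by linarith
    have key : 0 ≤ (2 - n) * (-θ * n * (2 - n) + 2 * θ * f * (2 + n) + 4 * θ ^ 2
      + (4 - n ^ 2) * (n / 2 - f) ^ 2) := by
      have e7 : (2 - n) * (-θ * n * (2 - n) + 2 * θ * f * (2 + n) + 4 * θ ^ 2
        + (4 - n ^ 2) * (n / 2 - f) ^ 2) = (2 + n) * ((2 - n) * (n / 2 - f) - θ) ^ 2
        + θ * (2 * n ^ 2 * (2 - n) + θ * (6 - 5 * n)) := by ring
      rw [e7]
      have : 0 ≤ 2 * n ^ 2 * (2 - n) + θ * (6 - 5 * n) := by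
        rcases le_total (5 * n) 6 with h | h
        · have := mul_nonneg hθ (sub_nonneg.2 h)
          have := mul_nonneg (sq_nonneg n) h2n.le
          linarith
        · have h8 : θ * (5 * n - 6) ≤ n * (2 - n) / 2 * (5 * n - 6) := by
            apply mul_le_mul_of_nonneg_right <;> linarith
          have h9 : n * (2 - n) / 2 * (5 * n - 6) ≤ n * (2 - n) / 2 * (4 * n) := by
            apply mul_le_mul_of_nonneg_left _ (by positivity); linarith
          linarith [show n * (2 - n) / 2 * (4 * n) = 2 * n ^ 2 * (2 - n) by ring]
      have := mul_nonneg hθ this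
      have : 0 ≤ (2 + n) * ((2 - n) * (n / 2 - f) - θ) ^ 2 := by positivity
      linarith
    exact nonneg_of_mul_nonneg_right key h2n
  · have h3 : 0 ≤ -θ * n * (2 - n) + 4 * θ ^ 2 := by
      nlinarith
    have : 0 ≤ 2 * θ * f * (2 + n) := by positivity
    have : 0 ≤ (4 - n ^ 2) * (n / 2 - f) ^ 2 := by
      apply mul_nonneg _ (sq_nonneg _); nlinarith
    linarith

/-- Since θ(n-θ) ≤ n²/4, the logarithm is bounded below by a rational function with denominator
(2-n)(2+n). The linear term θ(d-β) pays for it when (1-β)/d ≥ 1; otherwise ψ((1-β)/d) is needed too,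
through its quadratic lower bound. -/
theorem shrink_bound {β d n θ : ℝ} (h0 : 0 < β) (h1 : β ≤ 1 / 2) (hd2 : 1 / 2 < d)
    (hn : n = 2 - 1 / d) (hθ : 0 ≤ θ) (h2 : 0 ≤ θ * (n - θ)) :
    0 ≤ ((1 - β) / d - 1 - Real.log ((1 - β) / d)) + θ * (d - β)
      + 1 / 2 * Real.log (1 - θ * (n - θ)) := by
  have hd : 0 < d := by linarith
  have hα : 0 < 1 - β := by linarith
  have hψ := psi_nonneg (div_pos hα hd)
  have hn0 : 0 < n := by
    rw [hn, sub_pos, div_lt_iff₀ hd]; linarith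
  have hn2 : n < 2 := by
    rw [hn]; have : 0 < 1 / d := by positivity
    linarith
  have hdn : 1 / d = 2 - n := by rw [hn]; ring
  have hdn' : d = 1 / (2 - n) := by rw [← hdn, one_div_one_div]
  have hsq : θ * (n - θ) ≤ n ^ 2 / 4 := by nlinarith [sq_nonneg (n - 2 * θ)]
  have hx1 : 0 < 1 - θ * (n - θ) := by nlinarith
  have hl := Real.one_sub_inv_le_log_of_pos hx1
  have hm : (0:ℝ) < (2 - n) * (2 + n) := mul_pos (by linarith) (by linarith)
  have hl2 : -(4 * (θ * (n - θ)) / ((2 - n) * (2 + n))) ≤ Real.log (1 - θ * (n - θ)) := by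
    refine le_trans ?_ hl
    have : 1 - (1 - θ * (n - θ))⁻¹ = - (θ * (n - θ) / (1 - θ * (n - θ))) := by
      field_simp; ring
    rw [this, neg_le_neg_iff, div_le_div_iff₀ hx1 hm]
    nlinarith
  have hmul : θ * (d - β) * (2 - n) = θ * (1 - β * (2 - n)) := by
    rw [hdn']; have : 2 - n ≠ 0 := by linarith
    field_simp
  have hy : (1 - β) / d = (1 - β) * (2 - n) := by rw [← hdn]; ring
  rw [hy] at hψ ⊢
  have goal' : 0 ≤ (2 - n) * (((1 - β) * (2 - n) - 1 - Real.log ((1 - β) * (2 - n)))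
      + θ * (d - β)) - 2 * (θ * (n - θ)) / (2 + n) → 0 ≤ ((1 - β) * (2 - n) - 1 -
      Real.log ((1 - β) * (2 - n))) + θ * (d - β) + 1 / 2 * Real.log (1 - θ * (n - θ)) := by
    intro h
    have e3 : 4 * (θ * (n - θ)) / ((2 - n) * (2 + n)) =
        2 * (2 * (θ * (n - θ)) / (2 + n)) / (2 - n) := by
      have h1 : 2 - n ≠ 0 := by linarith
      have h2 : 2 + n ≠ 0 := by linarith
      field_simp; ring
    rw [e3] at hl2
    have h5 : (2 * (θ * (n - θ)) / (2 + n)) / (2 - n) ≤ ((1 - β) * (2 - n) - 1 -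
      Real.log ((1 - β) * (2 - n))) + θ * (d - β) := by
      rw [div_le_iff₀ (by linarith)]; linarith
    have e4 : 2 * (2 * (θ * (n - θ)) / (2 + n)) / (2 - n) =
      2 * ((2 * (θ * (n - θ)) / (2 + n)) / (2 - n)) := by ring
    linarith
  apply goal'
  rw [mul_add, mul_comm (2 - n) (θ * (d - β)), hmul]
  have hq : 2 * (θ * (n - θ)) / (2 + n) * (2 + n) = 2 * (θ * (n - θ)) := by
    field_simp
  obtain ⟨Q, hQ⟩ : ∃ Q, Q = 2 * (θ * (n - θ)) / (2 + n) := ⟨_, rfl⟩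
  rw [← hQ] at hq ⊢
  rcases le_total 1 ((1 - β) * (2 - n)) with hc | hc
  · have : Q * (2 + n) ≤ θ * (1 - β * (2 - n)) * (2 + n) := by
      rw [hq]
      have h6 : n ≤ 1 - β * (2 - n) := by
          have : (1 - β) * (2 - n) = (2 - n) - β * (2 - n) := by ring
          linarith
      have h7 : θ * n * (2 + n) ≤ θ * (1 - β * (2 - n)) * (2 + n) := by
        apply mul_le_mul_of_nonneg_right _ (by linarith)
        exact mul_le_mul_of_nonneg_left h6 hθ
      nlinarith [mul_nonneg hθ hn0.le, mul_nonneg hθ hθ]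
    have := le_of_mul_le_mul_right this (by linarith)
    have := mul_nonneg (show 0 ≤ 2 - n by linarith) hψ
    linarith
  · have hs := sq_sub_half_le_psi (mul_pos hα (by linarith)) hc
    have hs2 := mul_le_mul_of_nonneg_left hs (show 0 ≤ 2 - n by linarith)
    -- The shift f makes both quantities symmetric around n/2: (1-β)/d = 1 - (n/2 - f) and 1 - β/d =
    -- n/2 + f.
    obtain ⟨f, hf⟩ : ∃ f, f = (2 - n) * (1 / 2 - β) := ⟨_, rfl⟩
    have hf0 : 0 ≤ f := by rw [hf]; apply mul_nonneg <;> linarith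
    have e5 : (1 - β) * (2 - n) = 1 - (n / 2 - f) := by rw [hf]; ring
    have e6 : 1 - β * (2 - n) = n / 2 + f := by rw [hf]; ring
    rw [e5] at hs2 hc ⊢
    rw [e6]
    have hfn : f ≤ n / 2 := by linarith
    suffices hpoly : 0 ≤ -θ * n * (2 - n) + 2 * θ * f * (2 + n) + 4 * θ ^ 2
        + (4 - n ^ 2) * (n / 2 - f) ^ 2 by
      have : 0 ≤ ((2 - n) * ((1 - (1 - (n / 2 - f))) ^ 2 / 2) + θ * (n / 2 + f) - Q) *
          (2 * (2 + n)) := by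
        have : ((2 - n) * ((1 - (1 - (n / 2 - f))) ^ 2 / 2) + θ * (n / 2 + f) - Q) *
          (2 * (2 + n)) = (4 - n ^ 2) * (n / 2 - f) ^ 2 + θ * (n / 2 + f) * (2 * (2 + n))
            - 2 * (Q * (2 + n)) := by ring
        rw [this, hq]
        refine hpoly.trans_eq ?_
        ring
      have := nonneg_of_mul_nonneg_left this (by linarith)
      linarith
    exact shrink_poly hn0 hn2 hθ hf0

/-- Let k = 1-(1-e)θ and let A be the argument of the second logarithm. If A ≥ k, the logarithms add
up to at least (2β-1) log k ≥ 0. Otherwise A/k ≥ 1 - θ(n-θ) with n = 2 - 1/d, and because β ≤ 1/2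
the loss β log(A/k) is covered by the half logarithm in `shrink_bound`. -/
theorem dual_case_high {β d e θ : ℝ} (h0 : 0 < β) (h1 : β ≤ 1 / 2)
    (hd2 : 1 / 2 < d) (he : 0 < e) (he2 : e < 1) (hθ : 0 ≤ θ) (hθ1 : θ < 1) :
    0 ≤ ((1 - β) / d - 1 - Real.log ((1 - β) / d)) + θ * (d - β)
      + β * Real.log (1 - (1 - e) * θ)
      + β * Real.log ((1 - θ) * (1 - e * θ) + e * θ / d) - Real.log (1 - (1 - e) * θ) := by
  have hd : 0 < d := by linarith
  have hα : 0 < 1 - β := by linarith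
  have hk : 0 < 1 - (1 - e) * θ := by nlinarith
  have hlk : Real.log (1 - (1 - e) * θ) ≤ 0 := by
    apply Real.log_nonpos hk.le; nlinarith
  have hψ := psi_nonneg (div_pos hα hd)
  have hRpos : 0 < (1 - θ) * (1 - e * θ) + e * θ / d := by
    have : 0 < (1 - θ) * (1 - e * θ) := mul_pos (by linarith) (by nlinarith)
    positivity
  have hdβ : 0 ≤ θ * (d - β) := mul_nonneg hθ (by linarith)
  rcases le_total (1 - (1 - e) * θ) ((1 - θ) * (1 - e * θ) + e * θ / d) with hRk | hRk
  · have := Real.log_le_log hk hRk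
    nlinarith
  obtain ⟨n, hn⟩ : ∃ n, n = 2 - 1 / d := ⟨_, rfl⟩
  have hn0 : 0 < n := by
    rw [hn, sub_pos, div_lt_iff₀ hd]; linarith
  have hn2 : n < 2 := by
    rw [hn]; have : 0 < 1 / d := by positivity
    linarith
  have hdn : 1 / d = 2 - n := by rw [hn]; ring
  have hdn' : d = 1 / (2 - n) := by rw [← hdn, one_div_one_div]
  have hRe : (1 - θ) * (1 - e * θ) + e * θ / d = (1 - (1 - e) * θ) - e * θ * (n - θ) := by
    have : e * θ / d = e * θ * (1 / d) := by ring
    rw [this, hdn]; ring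
  have hsq : θ * (n - θ) ≤ n ^ 2 / 4 := by nlinarith [sq_nonneg (n - 2 * θ)]
  have hx1 : 0 < 1 - θ * (n - θ) := by nlinarith
  -- the ratio of the two arguments
  have hratio : (1 - (1 - e) * θ) * (1 - θ * (n - θ)) ≤ (1 - θ) * (1 - e * θ) + e * θ / d := by
    rw [hRe]
    have : 0 ≤ e * θ * (n - θ) := by linarith
    have h2 : 0 ≤ θ * (n - θ) := by
      have : 0 ≤ e * (θ * (n - θ)) := by linarith
      exact (mul_nonneg_iff_of_pos_left he).1 this
    nlinarith [mul_nonneg h2 (mul_nonneg (sub_nonneg.2 he2.le) (sub_nonneg.2 hθ1.le))]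
  have hlog := Real.log_le_log (mul_pos hk hx1) hratio
  have hlog' := Real.log_le_log hRpos hRk
  rw [Real.log_mul hk.ne' hx1.ne'] at hlog
  have hmain : 0 ≤ ((1 - β) / d - 1 - Real.log ((1 - β) / d)) + θ * (d - β)
      + 1 / 2 * Real.log (1 - θ * (n - θ)) := by
    have h2 : 0 ≤ θ * (n - θ) := by
      have : 0 ≤ e * (θ * (n - θ)) := by rw [hRe] at hRk; linarith
      exact (mul_nonneg_iff_of_pos_left he).1 this
    exact shrink_bound h0 h1 hd2 hn hθ h2
  have hhalf : 1 / 2 * Real.log (1 - θ * (n - θ)) ≤ β * Real.log ((1 - θ) * (1 - e * θ) + e * θ / d)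
      - β * Real.log (1 - (1 - e) * θ) := by
    have h2 : Real.log (1 - θ * (n - θ)) ≤ Real.log ((1 - θ) * (1 - e * θ) + e * θ / d)
      - Real.log (1 - (1 - e) * θ) := by linarith
    nlinarith
  nlinarith

/-! ### The two-group inequality at the knots `β = b₁` and `β = b₂` -/

/-- The gap of the surrogate for two groups of atoms of masses `p`, `q` at the points `X`, `Y`. -/
noncomputable def twoGroup (β p q b₁ b₂ X Y : ℝ) : ℝ :=
  (1 - β) * (logGap X + logGap Y) + max β b₁ * logGap (b₁ / p) + max β b₂ * logGap (b₂ / q)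
    + p * X + q * Y + b₁ + b₂ - 2 - Real.log (b₁ * X + b₂ * Y)

theorem twoGroup_swap (β p q b₁ b₂ X Y : ℝ) :
    twoGroup β p q b₁ b₂ X Y = twoGroup β q p b₂ b₁ Y X := by
  unfold twoGroup
  rw [add_comm (b₁ * X)]
  ring

/-- As a function of t the left side is maximal at t = m/p, with the value on the right. So a term
m·`logGap (m / p)` can be traded for one in which p enters linearly. -/
theorem mul_log_add_ge {p m t : ℝ} (hp : 0 < p) (hm : 0 < m) (ht : 0 < t) :
    m * Real.log t - p * t + p ≤ m * logGap (m / p) := by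
  have h := psi_nonneg (s := t * p / m) (by positivity)
  unfold logGap
  rw [Real.log_div (by positivity) hm.ne', Real.log_mul ht.ne' hp.ne'] at h
  rw [Real.log_div hm.ne' hp.ne', inv_div]
  have := mul_le_mul_of_nonneg_left h hm.le
  have e1 : m * (t * p / m - 1 - (Real.log t + Real.log p - Real.log m)) =
    t * p - m - m * (Real.log t + Real.log p - Real.log m) := by field_simp
  have e2 : m * (Real.log m - Real.log p + p / m - 1) =
    m * (Real.log m - Real.log p) + p - m := by field_simp
  rw [e1] at this
  rw [e2]
  linarith

/-- In the parameters, 1/X + 1/Y = 1/d. Tangent inequalities with slopes X - νd and Y - νd + θ/(1-θ)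
make the masses p, q enter linearly, and p + q = 1 then removes them from the bound; ν is the
multiplier of this constraint. -/
theorem twoGroup_dual {β p q d e θ ν : ℝ} (h0 : 0 < β) (hp : 0 < p) (hq : 0 < q)
    (hpq : p + q = 1) (hd : 0 < d) (he : 0 < e) (he2 : e < 1) (hθ : 0 ≤ θ) (hθ1 : θ < 1)
    (hν1 : ν ≤ 1) :
    Real.log d - Real.log β + (1 - β) / d + 4 * β - 3 - β * θ + ν * d
      + β * Real.log (1 - (1 - e) * ν)
      + β * Real.log ((1 - θ) * (1 - e * ν) + e * θ / d) - Real.log (1 - (1 - e) * θ)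
      ≤ twoGroup β p q β (β * (1 - θ)) (d / (1 - e)) (d / e) := by
  have h1e : 0 < 1 - e := by linarith
  have hg : 0 < 1 - θ := by linarith
  have hA1 : 0 < 1 - (1 - e) * ν := by nlinarith
  have hA2 : 0 < (1 - θ) * (1 - e * ν) + e * θ / d := by
    have : 0 < (1 - θ) * (1 - e * ν) := mul_pos hg (by nlinarith)
    positivity
  have hk : 0 < 1 - (1 - e) * θ := by nlinarith
  have j1 := psi_nonneg (s := p * (d / (1 - e) * (1 - (1 - e) * ν)) / β) (by positivity)
  have j2 := psi_nonneg (s := q * (d / e * ((1 - θ) * (1 - e * ν) + e * θ / d)) / (β * (1 - θ)))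
    (by positivity)
  rw [Real.log_div (by positivity) h0.ne', Real.log_mul hp.ne' (by positivity),
    Real.log_mul (by positivity) hA1.ne', Real.log_div hd.ne' h1e.ne'] at j1
  rw [Real.log_div (by positivity) (by positivity), Real.log_mul hq.ne' (by positivity),
    Real.log_mul (by positivity) hA2.ne', Real.log_div hd.ne' he.ne',
    Real.log_mul h0.ne' hg.ne'] at j2
  have hT : Real.log (β * (d / (1 - e)) + β * (1 - θ) * (d / e)) =
      Real.log β + Real.log d + Real.log (1 - (1 - e) * θ) - Real.log (1 - e) - Real.log e := by
    have : β * (d / (1 - e)) + β * (1 - θ) * (d / e) =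
        β * d * (1 - (1 - e) * θ) / ((1 - e) * e) := by
      field_simp; ring
    rw [this, Real.log_div (by positivity) (by positivity), Real.log_mul (by positivity) hk.ne',
      Real.log_mul h0.ne' hd.ne', Real.log_mul h1e.ne' he.ne']
    ring
  unfold twoGroup logGap
  rw [hT, max_self, max_eq_left (by nlinarith : β * (1 - θ) ≤ β),
    Real.log_div hd.ne' h1e.ne', Real.log_div hd.ne' he.ne', Real.log_div h0.ne' hp.ne',
    Real.log_div (by positivity) hq.ne', Real.log_mul h0.ne' hg.ne']
  have k1 := mul_nonneg h0.le j1
  have k2 := mul_nonneg h0.le j2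
  have e1 : β * (p * (d / (1 - e) * (1 - (1 - e) * ν)) / β) = p * (d / (1 - e)) - p * ν * d := by
    field_simp
  have e2 : β * (q * (d / e * ((1 - θ) * (1 - e * ν) + e * θ / d)) / (β * (1 - θ))) =
      q * (d / e) - q * ν * d + q / (1 - θ) - q := by
    field_simp; ring
  rw [mul_sub, mul_sub, e1] at k1
  rw [mul_sub, mul_sub, e2] at k2
  have e3 : β * (β / p)⁻¹ = p := by field_simp
  have e4 : β * (β * (1 - θ) / q)⁻¹ = q / (1 - θ) := by field_simp
  have e5 : (d / (1 - e))⁻¹ + (d / e)⁻¹ = 1 / d := by field_simp; ring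
  have hν' : p * ν * d + q * ν * d = ν * d := by
    rw [← add_mul, ← add_mul, hpq]; ring
  have e6 : (1 - β) * (Real.log d - Real.log (1 - e) + (d / (1 - e))⁻¹ - 1 +
      (Real.log d - Real.log e + (d / e)⁻¹ - 1)) = (1 - β) * (2 * Real.log d - Real.log (1 - e)
      - Real.log e - 2) + (1 - β) / d := by
    have : (1 - β) / d = (1 - β) * ((d / (1 - e))⁻¹ + (d / e)⁻¹) := by rw [e5]; ring
    rw [this]; ring
  rw [e6]
  linarith

/-- The multiplier in `twoGroup_dual` is ν = 0 when d and e are both at most 1/2, and ν = θ in all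
other cases. -/
theorem twoGroup_nonneg_of_eq_left {β p q b X Y : ℝ} (h0 : 0 < β) (h1 : β ≤ 1 / 2) (hp : 0 < p)
    (hq : 0 < q) (hpq : p + q = 1) (hb : 0 < b) (hbβ : b ≤ β) (hX : 0 < X) (hY : 0 < Y) :
    0 ≤ twoGroup β p q β b X Y := by
  obtain ⟨θ, hθe, hθ, hθ1⟩ : ∃ θ, b = β * (1 - θ) ∧ 0 ≤ θ ∧ θ < 1 := by
    refine ⟨1 - b / β, by field_simp; ring, ?_, ?_⟩
    · rw [sub_nonneg, div_le_one h0]; exact hbβ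
    · have : 0 < b / β := by positivity
      linarith
  obtain ⟨d, e, hd, he, he2, hXe, hYe⟩ : ∃ d e : ℝ, 0 < d ∧ 0 < e ∧ e < 1 ∧ X = d / (1 - e) ∧
      Y = d / e := by
    refine ⟨X * Y / (X + Y), X / (X + Y), by positivity, by positivity, ?_, ?_, ?_⟩
    · rw [div_lt_one (by positivity)]; linarith
    · have : 1 - X / (X + Y) = Y / (X + Y) := by field_simp; ring
      rw [this]; field_simp
    · field_simp
  rw [hθe, hXe, hYe]
  have hbase := base_bound h0 h1 hd
  have hψ := psi_nonneg (s := (1 - β) / d) (by apply div_pos <;> linarith)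
  rcases le_or_gt d (1 / 2) with hdh | hdh
  · rcases le_total e (1 / 2) with heh | heh
    · refine le_trans ?_ (twoGroup_dual h0 hp hq hpq hd he he2 hθ hθ1 (ν := 0) zero_le_one)
      have := dual_case_low_low h0 h1 hd hdh he heh hθ hθ1
      simp only [mul_zero, sub_zero, mul_one, Real.log_one, zero_mul, add_zero]
      linarith
    · refine le_trans ?_ (twoGroup_dual h0 hp hq hpq hd he he2 hθ hθ1 (ν := θ) hθ1.le)
      have := dual_case_low_high h0 h1 hd hdh heh he2 hθ hθ1
      linarith
  · refine le_trans ?_ (twoGroup_dual h0 hp hq hpq hd he he2 hθ hθ1 (ν := θ) hθ1.le)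
    have := dual_case_high h0 h1 hdh he he2 hθ hθ1
    linarith

/-- With t = √β and r = 1/t ≥ √2, the definition of y gives n(1+t)²(1+y) = y(1+r)². The claim
becomes exp y · (1+y) ≤ y(1+r)², in which n no longer occurs. -/
theorem exp_le_of_small {β n y : ℝ} (h0 : 0 < β) (h1 : β ≤ 1 / 2) (hn : 0 < n) (hn1 : n ≤ 1)
    (hnt : 1 ≤ n * (1 + √β)) (hy : y = β * n / (1 - β * n)) :
    Real.exp y ≤ n * (1 + √β) ^ 2 := by
  have ht : 0 < √β := Real.sqrt_pos.2 h0
  have htt : √β * √β = β := Real.mul_self_sqrt h0.le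
  generalize √β = t at *
  subst htt
  have hbn : t * t * n ≤ 1 / 2 := by nlinarith
  have hy0 : 0 < y := by rw [hy]; apply div_pos (by positivity); linarith
  have hy1 : y ≤ 1 := by rw [hy, div_le_one (by linarith)]; linarith
  have hny : t * t * n * (1 + y) = y := by
    have h3 : 1 - t * t * n ≠ 0 := by linarith
    have h4 : y * (1 - t * t * n) = t * t * n := by rw [hy]; exact div_mul_cancel₀ _ h3
    linarith
  obtain ⟨r, hr, hr0⟩ : ∃ r, t * r = 1 ∧ 0 < r := ⟨t⁻¹, by field_simp, by positivity⟩
  have hr1 : 1.41 ≤ r := by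
    by_contra hcon
    push Not at hcon
    have h3 : t * r < t * 1.41 := by gcongr
    nlinarith
  have hkey : n * (1 + t) ^ 2 * (1 + y) = y * (1 + r) ^ 2 := by
    calc n * (1 + t) ^ 2 * (1 + y) = n * (t * r + t) ^ 2 * (1 + y) := by rw [hr]
      _ = (t * t * n * (1 + y)) * (1 + r) ^ 2 := by ring
      _ = _ := by rw [hny]
  have hy1' : 0 < 1 + y := by linarith
  suffices h : Real.exp y * (1 + y) ≤ n * (1 + t) ^ 2 * (1 + y) from
    le_of_mul_le_mul_right h hy1'
  rw [hkey]
  -- For y ≤ 0.4 the bound exp y ≤ 1/(1-y) suffices, since `hnt` means 1 + y ≤ y(r² + r), and hence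
  -- 1 + 3.41y ≤ y(1+r)². For larger y a quadratic bound of exp is used, with 5.8081 = 2.41² and r ≥
  -- 1.41.
  rcases le_total y 0.4 with hc | hc
  · have hE : Real.exp y * (1 - y) ≤ 1 := by
      have := Real.add_one_le_exp (-y)
      have hp := Real.exp_pos y
      calc Real.exp y * (1 - y) ≤ Real.exp y * Real.exp (-y) := by gcongr; linarith
        _ = 1 := by rw [← Real.exp_add]; simp
    have h2 : 1 + 3.41 * y ≤ y * (1 + r) ^ 2 := by
      have h3 : (1 + y) ≤ y * (r ^ 2 + r) := by
        have e : y * (r ^ 2 + r) = n * (1 + t) * (1 + y) := by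
          calc y * (r ^ 2 + r) = t * t * n * (1 + y) * (r ^ 2 + r) := by rw [hny]
            _ = n * (1 + y) * ((t * r) * (t * r) + t * (t * r)) := by ring
            _ = _ := by rw [hr]; ring
        rw [e]; nlinarith
      nlinarith
    have h3 : 1 + y ≤ (1 + 3.41 * y) * (1 - y) := by nlinarith
    have hp := Real.exp_pos y
    calc Real.exp y * (1 + y) ≤ Real.exp y * ((1 + 3.41 * y) * (1 - y)) := by gcongr
      _ = (Real.exp y * (1 - y)) * (1 + 3.41 * y) := by ring
      _ ≤ 1 * (1 + 3.41 * y) := by gcongr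
      _ ≤ _ := by linarith
  · have hE := Real.exp_bound' hy0.le hy1 (n := 2) (by norm_num)
    simp [Finset.sum_range_succ] at hE
    have h2 : (2.41 : ℝ) ^ 2 ≤ (1 + r) ^ 2 := by gcongr; linarith
    have h3 : y * 5.8081 ≤ y * (1 + r) ^ 2 := by
      apply mul_le_mul_of_nonneg_left _ hy0.le; norm_num at h2 ⊢; linarith
    have h4 : Real.exp y * (1 + y) ≤ (1 + y + 3 / 4 * y ^ 2) * (1 + y) := by
      gcongr; linarith
    have h5 : (1 + y + 3 / 4 * y ^ 2) * (1 + y) ≤ y * 5.8081 := by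
      nlinarith [mul_nonneg (sub_nonneg.2 hc) (sub_nonneg.2 hy1),
        mul_nonneg (mul_nonneg (sub_nonneg.2 hc) (sub_nonneg.2 hy1)) hy0.le]
    linarith

/-- Up to a constant the right side is s + β(1-u)²/s with s = h + u ≥ u, minimal at s = √β |1-u|. If
this point is at most u, then h = 0 is the worst case; otherwise u < 1, and the minimum 2√β(1-u)
leads to `exp_le_of_small`. -/
theorem exp_le_weighted {β u h : ℝ} (h0 : 0 < β) (h1 : β ≤ 1 / 2) (hu : 0 < u) (hh : 0 ≤ h) :
    Real.exp (1 / (1 - β + β * u) - 1) ≤ β * (1 + h) ^ 2 / (h + u) + (1 - β) * (1 + h) := by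
  have hj : 0 < h + u := by linarith
  have hden : 0 < 1 - β + β * u := by nlinarith
  have hR : β * (1 + h) ^ 2 / (h + u) + (1 - β) * (1 + h) =
      (h + u) + β * (1 - u) ^ 2 / (h + u) + (1 + β) * (1 - u) := by
    field_simp; ring
  rw [hR]
  rcases le_or_gt (β * (1 - u) ^ 2) (u ^ 2) with hc | hc
  · have h2 : u + β * (1 - u) ^ 2 / u ≤ (h + u) + β * (1 - u) ^ 2 / (h + u) := by
      have : (h + u) + β * (1 - u) ^ 2 / (h + u) - (u + β * (1 - u) ^ 2 / u) =
        h * ((h + u) * u - β * (1 - u) ^ 2) / ((h + u) * u) := by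
        field_simp; ring
      have h3 : 0 ≤ h * ((h + u) * u - β * (1 - u) ^ 2) / ((h + u) * u) := by
        apply div_nonneg _ (by positivity)
        apply mul_nonneg hh; nlinarith
      linarith
    have h3 : Real.exp (1 / (1 - β + β * u) - 1) ≤ (1 - β) + β / u := by
      have hs : 0 < (1 - β) + β / u := by
        have : 0 < β / u := by positivity
        linarith
      rw [← Real.le_log_iff_exp_le hs]
      refine le_trans ?_ (Real.one_sub_inv_le_log_of_pos hs)
      have e1 : ((1 - β) + β / u)⁻¹ = u / ((1 - β) * u + β) := by
        have : (1 - β) + β / u = ((1 - β) * u + β) / u := by field_simp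
        rw [this, inv_div]
      have hd2 : 0 < (1 - β) * u + β := by nlinarith
      rw [e1]
      have e2 : 1 - u / ((1 - β) * u + β) - (1 / (1 - β + β * u) - 1) =
        (β * (1 - 2 * β) * (1 - u) ^ 2) / (((1 - β) * u + β) * (1 - β + β * u)) := by
        have n1 := hd2.ne'
        have n2 := hden.ne'
        rw [eq_div_iff (mul_ne_zero n1 n2)]
        have f1 : u / ((1 - β) * u + β) * ((1 - β) * u + β) = u := div_mul_cancel₀ _ n1
        have f2 : 1 / (1 - β + β * u) * (1 - β + β * u) = 1 := div_mul_cancel₀ _ n2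
        linear_combination (-(1 - β + β * u)) * f1 - ((1 - β) * u + β) * f2
      have : 0 ≤ (β * (1 - 2 * β) * (1 - u) ^ 2) / (((1 - β) * u + β) * (1 - β + β * u)) := by
        apply div_nonneg _ (by positivity)
        have : 0 ≤ 1 - 2 * β := by linarith
        positivity
      linarith
    have e3 : u + β * (1 - u) ^ 2 / u + (1 + β) * (1 - u) = (1 - β) + β / u := by
      field_simp; ring
    linarith
  · have hu1 : u < 1 := by
      by_contra hcon
      push Not at hcon
      nlinarith
    have hn : 0 < 1 - u := by linarith
    have ht : 0 < √β := Real.sqrt_pos.2 h0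
    have htt : √β * √β = β := Real.mul_self_sqrt h0.le
    have hnt : 1 ≤ (1 - u) * (1 + √β) := by
      have : u ≤ √β * (1 - u) := by
        apply le_of_sq_le_sq _ (by positivity)
        rw [mul_pow, sq (√β), htt]; exact hc.le
      linarith
    have hy : 1 / (1 - β + β * u) - 1 = β * (1 - u) / (1 - β * (1 - u)) := by
      have : 1 - β * (1 - u) = 1 - β + β * u := by ring
      rw [this]; field_simp; ring
    have h5 := exp_le_of_small h0 h1 hn (by linarith) hnt hy
    have h6 : 2 * √β * (1 - u) ≤ (h + u) + β * (1 - u) ^ 2 / (h + u) := by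
      have : (h + u) + β * (1 - u) ^ 2 / (h + u) - 2 * √β * (1 - u) =
        ((h + u) - √β * (1 - u)) ^ 2 / (h + u) := by
        have e5 : ((h + u) - √β * (1 - u)) ^ 2 =
          (h + u) ^ 2 - 2 * √β * (1 - u) * (h + u) + (√β * √β) * (1 - u) ^ 2 := by ring
        rw [e5, htt]
        field_simp
        ring
      have : 0 ≤ ((h + u) - √β * (1 - u)) ^ 2 / (h + u) := by positivity
      linarith
    have e4 : (1 - u) * (1 + √β) ^ 2 = 2 * √β * (1 - u) + (1 + β) * (1 - u) := by
      linear_combination (1 - u) * htt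
    linarith

/-- Both sides vanish at h = 0, and `exp_le_weighted` is the comparison of their derivatives in h.
-/
theorem log_mix_ge {β u h : ℝ} (h0 : 0 < β) (h1 : β ≤ 1 / 2) (hu : 0 < u) (hh : 0 ≤ h) :
    h * Real.exp (1 / (1 - β + β * u) - 1) / (1 + h) ≤
      β * Real.log (1 + h / u) + (1 - β) * Real.log (1 + h) := by
  set E := Real.exp (1 / (1 - β + β * u) - 1) with hE
  let f : ℝ → ℝ := fun t => β * Real.log (1 + t / u) + (1 - β) * Real.log (1 + t) - t * E / (1 + t)
  have hder : ∀ t, 0 ≤ t → HasDerivAt f (β * ((1 / u) / (1 + t / u)) + (1 - β) * (1 / (1 + t))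
      - (1 * E * (1 + t) - t * E * 1) / (1 + t) ^ 2) t := by
    intro t ht
    have p1 : 1 + t / u ≠ 0 := by positivity
    have p2 : 1 + t ≠ 0 := by positivity
    have d1 : HasDerivAt (fun t : ℝ => 1 + t / u) (1 / u) t :=
      ((hasDerivAt_id t).div_const u).const_add 1
    have d2 : HasDerivAt (fun t : ℝ => 1 + t) 1 t := (hasDerivAt_id t).const_add 1
    have d3 : HasDerivAt (fun t : ℝ => t * E) (1 * E) t := (hasDerivAt_id t).mul_const E
    exact (((d1.log p1).const_mul β).add ((d2.log p2).const_mul (1 - β))).sub (d3.div d2 p2)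
  have hmono : MonotoneOn f (Set.Ici 0) := by
    apply monotoneOn_of_deriv_nonneg (convex_Ici 0)
    · intro t ht; exact (hder t ht).continuousAt.continuousWithinAt
    · intro t ht
      rw [interior_Ici] at ht
      exact (hder t (le_of_lt ht)).differentiableAt.differentiableWithinAt
    · intro t ht
      rw [interior_Ici] at ht
      have ht0 : 0 ≤ t := le_of_lt ht
      rw [(hder t ht0).deriv]
      have key := exp_le_weighted h0 h1 hu ht0
      rw [← hE] at key
      have e : β * ((1 / u) / (1 + t / u)) + (1 - β) * (1 / (1 + t))
        - (1 * E * (1 + t) - t * E * 1) / (1 + t) ^ 2 =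
        (β * (1 + t) ^ 2 / (t + u) + (1 - β) * (1 + t) - E) / (1 + t) ^ 2 := by
        have : 1 + t / u = (t + u) / u := by field_simp; ring
        rw [this]
        field_simp; ring
      rw [e]
      apply div_nonneg _ (by positivity)
      linarith
  have := hmono (Set.mem_Ici.2 le_rfl) (Set.mem_Ici.2 hh) hh
  simp only [f, zero_div, add_zero, Real.log_one, mul_zero, zero_mul, sub_zero] at this
  linarith

/-- Here k is the mass of the first group beyond 1-β, and the left side bounds its effect on the
logarithm of the mixture. The exponential in `log_mix_ge` is traded for k log(X+k) by a tangent
inequality. -/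
theorem excess_mass_bound {β k X Y : ℝ} (h0 : 0 < β) (h1 : β ≤ 1 / 2) (hk : 0 ≤ k) (hX : 0 < X)
    (hY : 0 < Y) : k * X / ((1 - β) * X + β * Y) ≤
      (1 - β) * Real.log (1 + k / X) + β * Real.log (1 + k / Y) + k * Real.log (X + k) := by
  have hα : 0 < 1 - β := by linarith
  have h := log_mix_ge h0 h1 (u := Y / X) (h := k / X) (by positivity) (by positivity)
  have e1 : 1 + k / X / (Y / X) = 1 + k / Y := by field_simp
  have e2 : 1 / (1 - β + β * (Y / X)) = X / ((1 - β) * X + β * Y) := by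
    field_simp
  rw [e1, e2] at h
  set κ := X / ((1 - β) * X + β * Y) with hκ
  have e3 : k * X / ((1 - β) * X + β * Y) = k * κ := by rw [hκ]; ring
  rw [e3]
  have hp : 0 < 1 + k / X := by positivity
  have hl := psi_nonneg (s := Real.exp (κ - 1) / (X * (1 + k / X))) (by positivity)
  rw [Real.log_div (by positivity) (by positivity), Real.log_exp,
    Real.log_mul hX.ne' hp.ne'] at hl
  have hXk : Real.log (X + k) = Real.log X + Real.log (1 + k / X) := by
    rw [← Real.log_mul hX.ne' hp.ne']; congr 1; field_simp
  rw [hXk]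
  have h2 := mul_nonneg hk hl
  have e4 : k * (Real.exp (κ - 1) / (X * (1 + k / X))) = k / X * Real.exp (κ - 1) / (1 + k / X) := by
    field_simp
  rw [mul_sub, mul_sub, e4] at h2
  linarith

/-- The tangent inequality `mul_log_add_ge` at X + c and Y + c; the masses cancel because p + q = 1,
and c is the multiplier of that constraint. -/
theorem twoGroup_dual_shift {β p q b X Y c : ℝ} (h0 : 0 < β) (hp : 0 < p)
    (hq : 0 < q) (hpq : p + q = 1) (hbβ : β ≤ b) (hX : 0 < X) (hY : 0 < Y) (hc : 0 ≤ c) :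
    (1 - β) * (logGap X + logGap Y) + b * Real.log (X + c) + β * Real.log (Y + c) - c - 1 + b + β
      - Real.log (b * X + β * Y) ≤ twoGroup β p q b β X Y := by
  have i1 := mul_log_add_ge hp (h0.trans_le hbβ) (t := X + c) (by positivity)
  have i2 := mul_log_add_ge hq h0 (t := Y + c) (by positivity)
  unfold twoGroup
  rw [max_self, max_eq_right hbβ]
  have : p * c + q * c = c := by rw [← add_mul, hpq, one_mul]
  linarith

/-- Write log(bX + βY) = log X + log Y + log(b/Y + β/X). Tangent lines at the scale b/(1-β) bound
the last logarithm by multiples of 1/X and 1/Y, which the two `logGap` terms supply. -/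
theorem unshifted_nonneg {β b X Y : ℝ} (h0 : 0 < β) (h1 : β ≤ 1 / 2) (hbβ : β ≤ b)
    (hb : b ≤ 1 - β) (hX : 0 < X) (hY : 0 < Y) :
    0 ≤ (1 - β) * (logGap X + logGap Y) + b * Real.log X + β * Real.log Y - 1 + b + β
      - Real.log (b * X + β * Y) := by
  have hα : 0 < 1 - β := by linarith
  have hb0 : 0 < b := by linarith
  have hT : Real.log (b * X + β * Y) =
      Real.log X + Real.log Y + Real.log (b * Y⁻¹ + β * X⁻¹) := by
    rw [← Real.log_mul hX.ne' hY.ne', ← Real.log_mul (by positivity) (by positivity)]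
    congr 1; field_simp
  have j1 := psi_nonneg (s := (b * Y⁻¹ + β * X⁻¹) * ((1 - β) / b)) (by positivity)
  have j2 := psi_nonneg (s := X⁻¹ * ((1 - β) / b)) (by positivity)
  rw [Real.log_mul (by positivity) (by positivity)] at j1 j2
  rw [Real.log_inv] at j2
  have j3 := Real.le_log_one_add_of_nonneg (x := (1 - β) / b - 1) (by
    rw [sub_nonneg, le_div_iff₀ hb0]; linarith)
  have e1 : 1 + ((1 - β) / b - 1) = (1 - β) / b := by ring
  rw [e1] at j3
  set l := Real.log ((1 - β) / b)
  have j4 : 2 * ((1 - β) - b) ≤ ((1 - β) + b) * l := by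
    have e2 : 2 * ((1 - β) / b - 1) / ((1 - β) / b - 1 + 2) = 2 * ((1 - β) - b) / ((1 - β) + b) := by
      have : (1 - β) / b - 1 + 2 = ((1 - β) + b) / b := by field_simp; ring
      rw [this]; field_simp
    rw [e2, div_le_iff₀ (by linarith)] at j3
    linarith
  have j5 := mul_nonneg (sub_nonneg.2 hbβ) j2
  rw [hT]
  unfold logGap
  have e3 : (b * Y⁻¹ + β * X⁻¹) * ((1 - β) / b) = (1 - β) * Y⁻¹ + β / b * ((1 - β) * X⁻¹) := by
    field_simp
  rw [e3] at j1
  have e4 : (b - β) * (X⁻¹ * ((1 - β) / b) - 1 - (-Real.log X + l)) =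
    (1 - β) * X⁻¹ - β / b * ((1 - β) * X⁻¹) - (b - β) * (1 - Real.log X + l) := by
    field_simp; ring
  rw [e4] at j5
  linarith

/-- The multiplier is c = 0 for b ≤ 1-β. Beyond that it is the excess c = b - (1-β), and the claim
is the sum of the case b = 1-β and `excess_mass_bound`. -/
theorem twoGroup_nonneg_of_eq_right {β p q b X Y : ℝ} (h0 : 0 < β) (h1 : β ≤ 1 / 2) (hp : 0 < p)
    (hq : 0 < q) (hpq : p + q = 1) (hbβ : β ≤ b) (hX : 0 < X) (hY : 0 < Y) :
    0 ≤ twoGroup β p q b β X Y := by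
  rcases le_total b (1 - β) with hb | hb
  · refine le_trans ?_ (twoGroup_dual_shift h0 hp hq hpq hbβ hX hY (c := 0) le_rfl)
    have := unshifted_nonneg h0 h1 hbβ hb hX hY
    simp only [add_zero]
    linarith
  · have hk : 0 ≤ b - (1 - β) := by linarith
    have hα : 0 < 1 - β := by linarith
    have hb0 : 0 < b := by linarith
    refine le_trans ?_ (twoGroup_dual_shift h0 hp hq hpq hbβ hX hY hk)
    have hz := unshifted_nonneg h0 h1 (show β ≤ 1 - β by linarith) le_rfl hX hY
    have hex := excess_mass_bound h0 h1 hk hX hY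
    set k := b - (1 - β) with hkdef
    have hbk : b = (1 - β) + k := by rw [hkdef]; ring
    have hm : 0 < (1 - β) * X + β * Y := by positivity
    have hT : Real.log (b * X + β * Y) = Real.log ((1 - β) * X + β * Y) +
        Real.log (1 + k * X / ((1 - β) * X + β * Y)) := by
      rw [← Real.log_mul hm.ne' (by positivity)]
      congr 1; rw [hbk]; field_simp; ring
    have hl := Real.log_le_sub_one_of_pos
      (show 0 < 1 + k * X / ((1 - β) * X + β * Y) by positivity)
    have hXk : Real.log (X + k) = Real.log X + Real.log (1 + k / X) := by
      rw [← Real.log_mul hX.ne' (by positivity)]; congr 1; field_simp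
    have hYk : Real.log (Y + k) = Real.log Y + Real.log (1 + k / Y) := by
      rw [← Real.log_mul hY.ne' (by positivity)]; congr 1; field_simp
    rw [hT, hYk]
    have e1 : b * Real.log (X + k) = (1 - β) * (Real.log X + Real.log (1 + k / X)) +
      k * Real.log (X + k) := by rw [← hXk, hbk]; ring
    rw [e1]
    linarith

/-! ### The surrogate inequality with both weights equal to one half -/

open Finset in
theorem one_add_sum_le_prod {ι : Type*} (s : Finset ι) (f : ι → ℝ) (hf : ∀ i ∈ s, 0 ≤ f i) :
    1 + ∑ i ∈ s, f i ≤ ∏ i ∈ s, (1 + f i) := by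
  classical
  induction s using Finset.induction_on with
  | empty => simp
  | insert a s ha ih =>
    rw [sum_insert ha, prod_insert ha]
    have h1 := ih fun i hi => hf i (mem_insert_of_mem hi)
    have h2 := hf a (mem_insert_self a s)
    have h3 : 0 ≤ ∑ i ∈ s, f i := sum_nonneg fun i hi => hf i (mem_insert_of_mem hi)
    calc 1 + (f a + ∑ i ∈ s, f i) ≤ (1 + f a) * (1 + ∑ i ∈ s, f i) := by nlinarith
      _ ≤ _ := by gcongr

open Finset in
theorem one_sub_sum_le_prod {ι : Type*} (s : Finset ι) (f : ι → ℝ) (hf : ∀ i ∈ s, 0 ≤ f i)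
    (hf1 : ∀ i ∈ s, f i ≤ 1) : 1 - ∑ i ∈ s, f i ≤ ∏ i ∈ s, (1 - f i) ∧
      ∏ i ∈ s, (1 - f i) ≤ 1 := by
  classical
  induction s using Finset.induction_on with
  | empty => simp
  | insert a s ha ih =>
    rw [sum_insert ha, prod_insert ha]
    obtain ⟨h1, h1'⟩ := ih (fun i hi => hf i (mem_insert_of_mem hi))
      (fun i hi => hf1 i (mem_insert_of_mem hi))
    have h2 := hf a (mem_insert_self a s)
    have h3 := hf1 a (mem_insert_self a s)
    have h4 : 0 ≤ ∏ i ∈ s, (1 - f i) :=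
      prod_nonneg fun i hi => by linarith [hf1 i (mem_insert_of_mem hi)]
    constructor <;> nlinarith

theorem one_add_le_exp_logGap {w x : ℝ} (hx : 0 < x) :
    1 + 2 * w * x * (x - 1) ≤ Real.exp (logGap x + 2 * w * (x - 1)) := by
  have h := Real.add_one_le_exp (x⁻¹ + 2 * w * (x - 1) - 1)
  have e : logGap x + 2 * w * (x - 1) = Real.log x + (x⁻¹ + 2 * w * (x - 1) - 1) := by
    unfold logGap; ring
  rw [e, Real.exp_add, Real.exp_log hx]
  calc 1 + 2 * w * x * (x - 1) = x * (x⁻¹ + 2 * w * (x - 1) - 1 + 1) := by field_simp; ring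
    _ ≤ _ := by gcongr

-- After exponentiation the right side is at least ∏(1 + 2wᵢxᵢ(xᵢ-1)). Splitting at xᵢ = 1,
-- Weierstrass' product inequalities bound this below by (1+p)(1-q), while the left side is 1 + p -
-- q - A - B with weighted variances A, B around 1. What remains, pq ≤ A + B, follows from
-- Cauchy-Schwarz on each part.
open Finset in
theorem log_sum_sq_le {ι : Type*} [Fintype ι] (w x : ι → ℝ) (hw : ∀ i, 0 ≤ w i)
    (hw1 : ∑ i, w i = 1) (hx : ∀ i, 0 < x i) :
    Real.log (∑ i, w i * x i ^ 2) ≤ ∑ i, logGap (x i) + 2 * (∑ i, w i * x i - 1) := by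
  classical
  have hsq : 0 < ∑ i, w i * x i ^ 2 := by
    have h0 : 0 ≤ ∑ i, w i * x i ^ 2 := sum_nonneg fun i _ => by have := hw i; positivity
    refine lt_of_le_of_ne h0 fun h => ?_
    have h2 := (sum_eq_zero_iff_of_nonneg (fun i _ => by have := hw i; positivity)).1 h.symm
    have : ∑ i, w i = 0 := sum_eq_zero fun i hi => by
      have h3 := h2 i hi
      have h4 := hx i
      rcases mul_eq_zero.1 h3 with h5 | h5
      · exact h5
      · exact absurd h5 (by positivity)
    linarith
  rw [Real.log_le_iff_le_exp hsq]
  have hE : ∑ i, logGap (x i) + 2 * (∑ i, w i * x i - 1) =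
      ∑ i, (logGap (x i) + 2 * w i * (x i - 1)) := by
    have : ∑ i, 2 * w i * (x i - 1) = 2 * (∑ i, w i * x i - ∑ i, w i) := by
      rw [← sum_sub_distrib, mul_sum]
      exact sum_congr rfl fun i _ => by ring
    rw [sum_add_distrib, this, hw1]
  rw [hE, Real.exp_sum]
  have hwle : ∀ i, w i ≤ 1 := fun i => by
    rw [← hw1]; exact single_le_sum (fun i _ => hw i) (mem_univ i)
  -- Each factor is in fact at least 1/2, because x(x-1) ≥ -1/4 and w ≤ 1.
  have hlow : ∀ i, 0 ≤ 1 + 2 * w i * x i * (x i - 1) := fun i => by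
    nlinarith [sq_nonneg (2 * x i - 1), hw i, hwle i, hx i,
      mul_nonneg (sub_nonneg.2 (hwle i)) (sq_nonneg (2 * x i - 1)),
      mul_nonneg (hw i) (sq_nonneg (2 * x i - 1))]
  refine le_trans ?_ (prod_le_prod (fun i _ => hlow i) fun i _ => one_add_le_exp_logGap (hx i))
  set P : Finset ι := univ.filter fun i => 1 ≤ x i with hP
  set N : Finset ι := univ.filter fun i => ¬ 1 ≤ x i with hN
  have hsplit : ∀ f : ι → ℝ, ∑ i, f i = ∑ i ∈ P, f i + ∑ i ∈ N, f i := fun f =>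
    (sum_filter_add_sum_filter_not univ _ f).symm
  rw [← prod_filter_mul_prod_filter_not univ fun i => 1 ≤ x i]
  have hxP : ∀ i ∈ P, 1 ≤ x i := fun i hi => (mem_filter.1 hi).2
  have hxN : ∀ i ∈ N, x i ≤ 1 := fun i hi => (not_le.1 (mem_filter.1 hi).2).le
  have h1 := one_add_sum_le_prod P (fun i => 2 * w i * x i * (x i - 1)) fun i hi => by
    have := hw i; have := hx i; have : 0 ≤ x i - 1 := by linarith [hxP i hi]
    positivity
  have h2 := (one_sub_sum_le_prod N (fun i => 2 * w i * x i * (1 - x i)) (fun i hi => by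
    have := hw i; have := hx i; have : 0 ≤ 1 - x i := by linarith [hxN i hi]
    positivity) fun i hi => by linarith [hlow i]).1
  have h2' : ∏ i ∈ N, (1 - 2 * w i * x i * (1 - x i)) =
      ∏ i ∈ N, (1 + 2 * w i * x i * (x i - 1)) := prod_congr rfl fun i _ => by ring
  rw [h2'] at h2
  set p := ∑ i ∈ P, 2 * w i * x i * (x i - 1) with hp
  set q := ∑ i ∈ N, 2 * w i * x i * (1 - x i) with hq
  set m := ∑ i ∈ P, w i with hm
  set n := ∑ i ∈ N, w i with hn
  set A := ∑ i ∈ P, w i * (x i - 1) ^ 2 with hA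
  set B := ∑ i ∈ N, w i * (x i - 1) ^ 2 with hB
  have hmn : m + n = 1 := by rw [hm, hn, ← hsplit, hw1]
  have hA0 : 0 ≤ A := sum_nonneg fun i _ => by have := hw i; positivity
  have hB0 : 0 ≤ B := sum_nonneg fun i _ => by have := hw i; positivity
  have hm0 : 0 ≤ m := sum_nonneg fun i _ => hw i
  have hn0 : 0 ≤ n := sum_nonneg fun i _ => hw i
  have hq0 : 0 ≤ q := sum_nonneg fun i hi => by
    have := hw i; have := hx i; have : 0 ≤ 1 - x i := by linarith [hxN i hi]
    positivity
  have hp0 : 0 ≤ p := sum_nonneg fun i hi => by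
    have := hw i; have := hx i; have : 0 ≤ x i - 1 := by linarith [hxP i hi]
    positivity
  have hsum : ∑ i, w i * x i ^ 2 = 1 + p - q - A - B := by
    rw [← hw1, hsplit w, hsplit]
    have e1 : ∑ i ∈ P, w i * x i ^ 2 = m + p - A := by
      rw [hm, hp, hA, ← sum_add_distrib, ← sum_sub_distrib]
      exact sum_congr rfl fun i _ => by ring
    have e2 : ∑ i ∈ N, w i * x i ^ 2 = n - q - B := by
      rw [hn, hq, hB, ← sum_sub_distrib, ← sum_sub_distrib]
      exact sum_congr rfl fun i _ => by ring
    rw [e1, e2]; ring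
  have hcs : ∀ s : Finset ι, (∑ i ∈ s, w i * (x i - 1)) ^ 2 ≤
      (∑ i ∈ s, w i) * ∑ i ∈ s, w i * (x i - 1) ^ 2 := fun s =>
    sum_sq_le_sum_mul_sum_of_sq_le_mul s (fun i _ => hw i)
      (fun i _ => by have := hw i; positivity) fun i _ => le_of_eq (by ring)
  have hpA : p ≤ 2 * √A * (√A + √m) := by
    have e1 : p = 2 * A + 2 * ∑ i ∈ P, w i * (x i - 1) := by
      rw [hp, hA, mul_sum, mul_sum, ← sum_add_distrib]
      exact sum_congr rfl fun i _ => by ring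
    have e2 : ∑ i ∈ P, w i * (x i - 1) ≤ √m * √A := by
      rw [← Real.sqrt_mul hm0]; exact Real.le_sqrt_of_sq_le (hcs P)
    nlinarith [Real.mul_self_sqrt hA0]
  have hqB : q ≤ 2 * √B * (√n - √B) := by
    have e1 : q = 2 * (-∑ i ∈ N, w i * (x i - 1)) - 2 * B := by
      rw [hq, hB, ← sum_neg_distrib, mul_sum, mul_sum, ← sum_sub_distrib]
      exact sum_congr rfl fun i _ => by ring
    have e2 : -∑ i ∈ N, w i * (x i - 1) ≤ √n * √B := by
      rw [← Real.sqrt_mul hn0]; apply Real.le_sqrt_of_sq_le; rw [neg_sq]; exact hcs N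
    nlinarith [Real.mul_self_sqrt hB0]
  have hpq : p * q ≤ A + B := by
    have h3 : p * q ≤ (2 * √A * (√A + √m)) * (2 * √B * (√n - √B)) :=
      mul_le_mul hpA hqB hq0 (by positivity)
    have a1 := Real.mul_self_sqrt hA0
    have a2 := Real.mul_self_sqrt hB0
    have a3 := Real.mul_self_sqrt hm0
    have a4 := Real.mul_self_sqrt hn0
    generalize √A = a at *
    generalize √B = b at *
    generalize √m = s at *
    generalize √n = t at *
    have h4 : s * s + t * t = 1 := by linarith
    -- AM-GM, since at + bs = a(t-b) + b(a+s).
    have h5 : (2 * a * (a + s)) * (2 * b * (t - b)) ≤ (a * t + b * s) ^ 2 := by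
      nlinarith [sq_nonneg (a * (t - b) - b * (a + s))]
    have h6 : (a * t + b * s) ^ 2 ≤ a * a + b * b := by
      have : (a * a + b * b) * (s * s + t * t) - (a * t + b * s) ^ 2 = (a * s - b * t) ^ 2 := by
        ring
      rw [h4] at this
      nlinarith [sq_nonneg (a * s - b * t)]
    linarith
  have hNprod : 0 ≤ ∏ i ∈ N, (1 + 2 * w i * x i * (x i - 1)) := prod_nonneg fun i _ => hlow i
  calc ∑ i, w i * x i ^ 2 ≤ (1 + p) * (1 - q) := by rw [hsum]; nlinarith
    _ ≤ (1 + p) * ∏ i ∈ N, (1 + 2 * w i * x i * (x i - 1)) := by gcongr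
    _ ≤ _ := by gcongr

theorem log_le_half_add {T A B : ℝ} (hT : 0 < T) (hA : 0 < A) (hB : 0 < B)
    (h : T ^ 2 ≤ A * B) : Real.log T ≤ (Real.log A + Real.log B) / 2 := by
  rw [← Real.log_mul hA.ne' hB.ne']
  have := Real.log_le_log (by positivity) h
  rw [Real.log_pow] at this
  push_cast at this
  linarith

/-- The surrogate gap with both weights equal to one half, without any restriction on the atoms. -/
theorem log_sum_mul_le_half {ι κ : Type*} [Fintype ι] [Fintype κ] (π : ι → κ → ℝ) (x : ι → ℝ)
    (z : κ → ℝ) (hπ : ∀ i j, 0 ≤ π i j) (hπ1 : ∑ i, ∑ j, π i j = 1) (hx : ∀ i, 0 < x i)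
    (hz : ∀ j, 0 < z j) :
    Real.log (∑ i, ∑ j, π i j * (x i * z j)) ≤ (∑ i, logGap (x i)) / 2 + (∑ j, logGap (z j)) / 2
      + (∑ i, ∑ j, π i j * x i - 1) + (∑ i, ∑ j, π i j * z j - 1) := by
  have h1 := log_sum_sq_le (fun i => ∑ j, π i j) x (fun i => Finset.sum_nonneg fun j _ => hπ i j)
    hπ1 hx
  have h2 := log_sum_sq_le (fun j => ∑ i, π i j) z (fun j => Finset.sum_nonneg fun i _ => hπ i j)
    (by rw [Finset.sum_comm]; exact hπ1) hz
  simp only [Finset.sum_mul] at h1 h2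
  rw [Finset.sum_comm (f := fun j i => π i j * z j ^ 2),
    Finset.sum_comm (f := fun j i => π i j * z j)] at h2
  have hpos : ∀ f : ι → κ → ℝ, (∀ i j, 0 < f i j) → 0 < ∑ i, ∑ j, π i j * f i j := by
    intro f hf
    have h0 : ∀ p : ι × κ, 0 ≤ π p.1 p.2 * f p.1 p.2 := fun p =>
      mul_nonneg (hπ _ _) (hf _ _).le
    rw [← Fintype.sum_prod_type' (f := fun i j => π i j * f i j)]
    rw [← Fintype.sum_prod_type' (f := π)] at hπ1
    refine lt_of_le_of_ne (Finset.sum_nonneg fun p _ => h0 p) fun h => ?_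
    have h3 := (Finset.sum_eq_zero_iff_of_nonneg (fun p _ => h0 p)).1 h.symm
    have : ∑ p : ι × κ, π p.1 p.2 = 0 := Finset.sum_eq_zero fun p hp => by
      rcases mul_eq_zero.1 (h3 p hp) with h5 | h5
      · exact h5
      · exact absurd h5 (hf _ _).ne'
    linarith
  -- Cauchy-Schwarz, (E xz)² ≤ E x² · E z², reduces the mixed moment to the two marginals.
  have hT := log_le_half_add (hpos (fun i j => x i * z j) fun i j => mul_pos (hx i) (hz j))
    (hpos (fun i _ => x i ^ 2) fun i j => pow_pos (hx i) 2)
    (hpos (fun _ j => z j ^ 2) fun i j => pow_pos (hz j) 2) (by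
      simp only [← Fintype.sum_prod_type' (f := fun i j => π i j * (x i * z j)),
        ← Fintype.sum_prod_type' (f := fun i j => π i j * x i ^ 2),
        ← Fintype.sum_prod_type' (f := fun i j => π i j * z j ^ 2)]
      refine Finset.sum_sq_le_sum_mul_sum_of_sq_le_mul _ (fun p _ => ?_) (fun p _ => ?_)
        fun p _ => ?_
      · have := hπ p.1 p.2; positivity
      · have := hπ p.1 p.2; positivity
      · exact le_of_eq (by ring))
  linarith

/-- The case of `log_sum_mul_le_half` with diagonal mass matrix diag(p, q) and z = (b₁/p, b₂/q); the
maxima in the weights only help. -/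
theorem twoGroup_nonneg_half {p q b₁ b₂ X Y : ℝ} (hp : 0 < p) (hq : 0 < q) (hpq : p + q = 1)
    (hb₁ : 0 < b₁) (hb₂ : 0 < b₂) (hX : 0 < X) (hY : 0 < Y) :
    0 ≤ twoGroup (1 / 2) p q b₁ b₂ X Y := by
  have h := log_sum_mul_le_half (ι := Fin 2) (κ := Fin 2) !![p, 0; 0, q] ![X, Y] ![b₁ / p, b₂ / q]
    (by intro i j; fin_cases i <;> fin_cases j <;> simp [hp.le, hq.le])
    (by simp [Fin.sum_univ_two, hpq]) (by intro i; fin_cases i <;> simp [hX, hY])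
    (by intro i; fin_cases i <;> simp <;> positivity)
  simp only [Fin.sum_univ_two, Matrix.of_apply, Matrix.cons_val_zero, Matrix.cons_val_one,
    zero_mul, add_zero, zero_add] at h
  have e1 : p * (X * (b₁ / p)) = b₁ * X := by field_simp
  have e2 : q * (Y * (b₂ / q)) = b₂ * Y := by field_simp
  have e3 : p * (b₁ / p) = b₁ := by field_simp
  have e4 : q * (b₂ / q) = b₂ := by field_simp
  rw [e1, e2, e3, e4] at h
  have g1 := mul_le_mul_of_nonneg_right (le_max_left (1 / 2) b₁)
    (logGap_nonneg (show 0 < b₁ / p by positivity))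
  have g2 := mul_le_mul_of_nonneg_right (le_max_left (1 / 2) b₂)
    (logGap_nonneg (show 0 < b₂ / q by positivity))
  unfold twoGroup
  linarith

/-! ### The two-group inequality for all weights, by interpolation -/

theorem affine_nonneg {u v s t b : ℝ} (hs : 0 ≤ u + v * s) (ht : 0 ≤ u + v * t) (hsb : s ≤ b)
    (hbt : b ≤ t) : 0 ≤ u + v * b := by
  rcases le_total 0 v with h | h <;> nlinarith

/-- As a function of β the gap is affine between the knots b₂ ≤ b₁ and nonincreasing to the left of
b₂. On (0, 1/2] it is therefore enough to know it at the knots in this range and at 1/2. -/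
theorem twoGroup_nonneg_of_le {β p q b₁ b₂ X Y : ℝ} (h0 : 0 < β) (h1 : β ≤ 1 / 2) (hp : 0 < p)
    (hq : 0 < q) (hpq : p + q = 1) (hb₂ : 0 < b₂) (hb : b₂ ≤ b₁) (hX : 0 < X) (hY : 0 < Y) :
    0 ≤ twoGroup β p q b₁ b₂ X Y := by
  have hb₁ : 0 < b₁ := by linarith
  have hhalf := twoGroup_nonneg_half hp hq hpq hb₁ hb₂ hX hY
  have hright : b₂ ≤ 1 / 2 → 0 ≤ twoGroup b₂ p q b₁ b₂ X Y := fun h =>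
    twoGroup_nonneg_of_eq_right hb₂ h hp hq hpq hb hX hY
  have hleft : b₁ ≤ 1 / 2 → 0 ≤ twoGroup b₁ p q b₁ b₂ X Y := fun h =>
    twoGroup_nonneg_of_eq_left hb₁ h hp hq hpq hb₂ hb hX hY
  unfold twoGroup at *
  set A := logGap X + logGap Y
  have hA : 0 ≤ A := add_nonneg (logGap_nonneg hX) (logGap_nonneg hY)
  set B₁ := logGap (b₁ / p)
  set B₂ := logGap (b₂ / q)
  set l := Real.log (b₁ * X + b₂ * Y)
  rcases le_total β b₂ with h | h
  · rw [max_eq_right h, max_eq_right (h.trans hb)]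
    rcases le_total b₂ (1 / 2) with h2 | h2
    · have := hright h2
      rw [max_self, max_eq_right hb] at this
      nlinarith
    · rw [max_eq_right h2, max_eq_right (h2.trans hb)] at hhalf
      nlinarith
  · have h3 := hright (h.trans h1)
    rw [max_self, max_eq_right hb] at h3
    rw [max_eq_left h]
    rcases le_total β b₁ with h2 | h2
    · rw [max_eq_right h2]
      have key : ∀ t, β ≤ t → 0 ≤ (1 - t) * A + b₁ * B₁ + t * B₂ + p * X + q * Y + b₁ + b₂ - 2 - l →
          0 ≤ (1 - β) * A + b₁ * B₁ + β * B₂ + p * X + q * Y + b₁ + b₂ - 2 - l := by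
        intro t ht h4
        have := affine_nonneg (u := A + b₁ * B₁ + p * X + q * Y + b₁ + b₂ - 2 - l)
          (v := B₂ - A) (s := b₂) (t := t) (b := β) (by linarith) (by linarith) h ht
        linarith
      rcases le_total b₁ (1 / 2) with h5 | h5
      · have h6 := hleft h5
        rw [max_self, max_eq_left hb] at h6
        exact key b₁ h2 h6
      · rw [max_eq_right h5, max_eq_left (h.trans h1)] at hhalf
        exact key _ h1 hhalf
    · rw [max_eq_left h2]
      have h6 := hleft (h2.trans h1)
      rw [max_self, max_eq_left hb] at h6
      rw [max_eq_left (h2.trans h1), max_eq_left (h.trans h1)] at hhalf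
      have := affine_nonneg (u := A + p * X + q * Y + b₁ + b₂ - 2 - l)
          (v := B₁ + B₂ - A) (s := b₁) (t := 1 / 2) (b := β) (by linarith) (by linarith) h2 h1
      linarith

theorem twoGroup_nonneg {β p q b₁ b₂ X Y : ℝ} (h0 : 0 < β) (h1 : β ≤ 1 / 2) (hp : 0 < p)
    (hq : 0 < q) (hpq : p + q = 1) (hb₁ : 0 < b₁) (hb₂ : 0 < b₂) (hX : 0 < X) (hY : 0 < Y) :
    0 ≤ twoGroup β p q b₁ b₂ X Y := by
  rcases le_total b₂ b₁ with h | h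
  · exact twoGroup_nonneg_of_le h0 h1 hp hq hpq hb₂ h hX hY
  · rw [twoGroup_swap]
    exact twoGroup_nonneg_of_le h0 h1 hq hp (by linarith) hb₁ h hY hX

/-! ### Choice of the multiplier in the reduced gap -/

/-- The lower bound of the surrogate gap after elimination of the second family of variables,
as a function of the multiplier `c`. -/
noncomputable def reducedGap (β b₁ b₂ X Y c : ℝ) : ℝ :=
  (1 - β) * (logGap X + logGap Y) - 1 - c + b₁ + b₂
    + max β b₁ * Real.log (1 + b₁ / max β b₁ * (X + c - 1))
    + max β b₂ * Real.log (1 + b₂ / max β b₂ * (Y + c - 1)) - Real.log (b₁ * X + b₂ * Y)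

/-- The equality case of the tangent inequality, at mass b/Z with Z = 1 + (b/m)y. Consequently
`reducedGap` coincides with `twoGroup` at the masses p = b₁/Z₁, q = b₂/Z₂ as soon as p + q = 1. -/
theorem mul_logGap_eq {m b y : ℝ} (hm : 0 < m) (hb : 0 < b) (hZ : 0 < 1 + b / m * y) :
    m * logGap (b / (b / (1 + b / m * y))) = m * Real.log (1 + b / m * y)
      - b / (1 + b / m * y) * y := by
  have e : b / (b / (1 + b / m * y)) = 1 + b / m * y := by field_simp
  rw [e]
  unfold logGap
  have : m * ((1 + b / m * y)⁻¹ - 1) = - (b / (1 + b / m * y) * y) := by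
    have hby : b * y = m * ((1 + b / m * y) - 1) := by field_simp; ring
    generalize 1 + b / m * y = Z at *
    have : b / Z * y = m * (Z - 1) / Z := by rw [← hby]; ring
    rw [this]; field_simp; ring
  linarith

-- The right c makes b₁/Z₁(c) + b₂/Z₂(c) equal to 1 and is sought in [1-X, 1-Y] by the intermediate
-- value theorem. If the sum is still at least 1 at the right end, or already below 1 at the left
-- end, that end serves as c; there one of the Zs equals 1.
set_option maxHeartbeats 800000 in
theorem reducedGap_exists_nonneg {β b₁ b₂ X Y : ℝ} (h0 : 0 < β) (h1 : β ≤ 1 / 2) (hb₁ : 0 < b₁)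
    (hb₂ : 0 < b₂) (hX : 1 ≤ X) (hY0 : 0 < Y) (hY : Y ≤ 1) :
    ∃ c, 0 ≤ X + c - 1 ∧ Y + c - 1 ≤ 0 ∧ 0 < 1 + b₂ / max β b₂ * (Y + c - 1) ∧
      0 ≤ reducedGap β b₁ b₂ X Y c := by
  have hX0 : 0 < X := by linarith
  set m₁ := max β b₁ with hm₁
  set m₂ := max β b₂ with hm₂
  have hm₁0 : 0 < m₁ := lt_max_of_lt_left h0
  have hm₂0 : 0 < m₂ := lt_max_of_lt_left h0
  set Z₁ : ℝ → ℝ := fun c => 1 + b₁ / m₁ * (X + c - 1) with hZ₁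
  set Z₂ : ℝ → ℝ := fun c => 1 + b₂ / m₂ * (Y + c - 1) with hZ₂
  have hq₁ : 0 < b₁ / m₁ := by positivity
  have hq₂ : 0 < b₂ / m₂ := by positivity
  have hZ₁pos : ∀ c, 1 - X ≤ c → 0 < Z₁ c := fun c hc => by
    have : 0 ≤ b₁ / m₁ * (X + c - 1) := mul_nonneg hq₁.le (by linarith)
    simp only [hZ₁]; linarith
  have hlogG : 0 ≤ logGap X + logGap Y := add_nonneg (logGap_nonneg hX0) (logGap_nonneg hY0)
  have hinner : ∀ c, 1 - X ≤ c → 0 < Z₂ c → b₁ / Z₁ c + b₂ / Z₂ c = 1 →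
      0 ≤ reducedGap β b₁ b₂ X Y c := by
    intro c hc hz hk
    have h := twoGroup_nonneg h0 h1 (div_pos hb₁ (hZ₁pos c hc)) (div_pos hb₂ hz) hk hb₁ hb₂ hX0 hY0
    unfold twoGroup at h
    rw [mul_logGap_eq hm₁0 hb₁ (hZ₁pos c hc), mul_logGap_eq hm₂0 hb₂ hz] at h
    unfold reducedGap
    have e : b₁ / Z₁ c * (X + c - 1) + b₂ / Z₂ c * (Y + c - 1) =
        b₁ / Z₁ c * X + b₂ / Z₂ c * Y + (c - 1) := by
      linear_combination (c - 1) * hk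
    simp only [hZ₁, hZ₂] at e
    linarith
  by_cases hr : 1 ≤ b₁ / Z₁ (1 - Y) + b₂
  · refine ⟨1 - Y, by linarith, by linarith, by simp, ?_⟩
    have hz1 := hZ₁pos (1 - Y) (by linarith)
    have hone : 1 ≤ Z₁ (1 - Y) := by
      have : 0 ≤ b₁ / m₁ * (X + (1 - Y) - 1) := mul_nonneg hq₁.le (by linarith)
      simp only [hZ₁]; linarith
    have hpb : b₁ / Z₁ (1 - Y) ≤ b₁ := div_le_self hb₁.le hone
    have hp0 : 0 < b₁ / Z₁ (1 - Y) := div_pos hb₁ hz1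
    have ez : 1 + b₂ / max β b₂ * (Y + (1 - Y) - 1) = 1 := by ring
    unfold reducedGap
    rw [ez, Real.log_one]
    by_cases hp1 : b₁ / Z₁ (1 - Y) < 1
    -- With 1 - p ≤ b₂ in place of b₂ the masses sum to 1 and the second `logGap` vanishes. The
    -- change of the logarithm is at most the change of the linear term.
    · set p := b₁ / Z₁ (1 - Y) with hp
      have h := twoGroup_nonneg h0 h1 hp0 (show 0 < 1 - p by linarith) (by ring) hb₁
        (show 0 < 1 - p by linarith) hX0 hY0
      unfold twoGroup at h
      rw [div_self (by linarith : (1 : ℝ) - p ≠ 0), logGap_one] at h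
      nth_rewrite 2 [hp] at h
      rw [mul_logGap_eq hm₁0 hb₁ hz1] at h
      change 0 ≤ _ + (m₁ * Real.log (Z₁ (1 - Y)) - p * (X + (1 - Y) - 1)) + _ + _ + _ + _ + _
        - _ - _ at h
      change 0 ≤ _ - _ - _ + _ + _ + m₁ * Real.log (Z₁ (1 - Y)) + _ - _
      have hs : 0 < b₁ * X + (1 - p) * Y := by
        have : 0 < (1 - p) * Y := mul_pos (by linarith) hY0
        positivity
      have hT : 0 < b₁ * X + b₂ * Y := by positivity
      have hl := Real.log_le_sub_one_of_pos (div_pos hT hs)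
      rw [Real.log_div hT.ne' hs.ne'] at hl
      have h3 : (b₁ * X + b₂ * Y) / (b₁ * X + (1 - p) * Y) - 1 ≤ b₂ - (1 - p) := by
        rw [div_sub_one hs.ne', div_le_iff₀ hs]
        have : Y ≤ b₁ * X + (1 - p) * Y := by nlinarith
        nlinarith
      linarith
    -- No mass is left for the second group, so `twoGroup` does not apply. But then b₁ ≥ 1 + X - Y,
    -- so that b₁ log(1 + X - Y) ≥ X - Y.
    · push Not at hp1
      have hb1Z : Z₁ (1 - Y) ≤ b₁ := by rwa [le_div_iff₀ hz1, one_mul] at hp1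
      have hb1 : 1 ≤ b₁ := hone.trans hb1Z
      have hm : m₁ = b₁ := max_eq_right (by linarith)
      have hZe : Z₁ (1 - Y) = 1 + (X - Y) := by
        simp only [hZ₁, hm]; field_simp; ring
      change 0 ≤ _ - _ - _ + _ + _ + m₁ * Real.log (Z₁ (1 - Y)) + _ - _
      rw [hm, hZe]
      rw [hZe] at hb1Z
      have k1 : Real.log (b₁ * X + b₂ * Y) ≤ Real.log b₁ + Real.log X + b₂ := by
        have e : b₁ * X + b₂ * Y = b₁ * X * (1 + b₂ * Y / (b₁ * X)) := by field_simp
        rw [e, Real.log_mul (by positivity) (by positivity), Real.log_mul hb₁.ne' hX0.ne']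
        have := Real.log_le_sub_one_of_pos (show 0 < 1 + b₂ * Y / (b₁ * X) by positivity)
        have h5 : b₂ * Y / (b₁ * X) ≤ b₂ := by
          rw [div_le_iff₀ (by positivity)]
          have : Y ≤ b₁ * X := by nlinarith
          nlinarith
        linarith
      have k2 := psi_nonneg hb₁
      have k3 := psi_nonneg hX0
      have hD : 0 ≤ X - Y := by linarith
      have k4 : X - Y ≤ b₁ * Real.log (1 + (X - Y)) := by
        have h6 := Real.one_sub_inv_le_log_of_pos (show 0 < 1 + (X - Y) by linarith)
        have h7 : 0 ≤ Real.log (1 + (X - Y)) := Real.log_nonneg (by linarith)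
        have h8 := mul_le_mul_of_nonneg_left h6 (show 0 ≤ 1 + (X - Y) by linarith)
        have h9 : (1 + (X - Y)) * (1 - (1 + (X - Y))⁻¹) = X - Y := by
          have : 1 + (X - Y) ≠ 0 := by linarith
          field_simp; ring
        nlinarith
      have k5 : 0 ≤ (1 - β) * (logGap X + logGap Y) := mul_nonneg (by linarith) hlogG
      linarith
  · push Not at hr
    have hright : b₁ / Z₁ (1 - Y) + b₂ / Z₂ (1 - Y) ≤ 1 := by
      have : Z₂ (1 - Y) = 1 := by simp [hZ₂]
      rw [this, div_one]; exact hr.le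
    have hb₂1 : b₂ < 1 := by
      have := div_pos hb₁ (hZ₁pos (1 - Y) (by linarith))
      linarith
    have hivt : ∀ c₀, 1 - X ≤ c₀ → c₀ ≤ 1 - Y → 0 < Z₂ c₀ → 1 ≤ b₁ / Z₁ c₀ + b₂ / Z₂ c₀ →
        ∃ c, 0 ≤ X + c - 1 ∧ Y + c - 1 ≤ 0 ∧ 0 < 1 + b₂ / m₂ * (Y + c - 1) ∧
          0 ≤ reducedGap β b₁ b₂ X Y c := by
      intro c₀ hc0 hc1 hz hk
      have hz2 : ∀ c, c₀ ≤ c → 0 < Z₂ c := fun c hc => by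
        have : b₂ / m₂ * (Y + c₀ - 1) ≤ b₂ / m₂ * (Y + c - 1) := by gcongr
        simp only [hZ₂] at hz ⊢; linarith
      have hcont : ContinuousOn (fun c => b₁ / Z₁ c + b₂ / Z₂ c) (Set.Icc c₀ (1 - Y)) := by
        apply ContinuousOn.add
        · apply ContinuousOn.div continuousOn_const
          · simp only [hZ₁]; fun_prop
          · intro c hc; exact (hZ₁pos c (hc0.trans hc.1)).ne'
        · apply ContinuousOn.div continuousOn_const
          · simp only [hZ₂]; fun_prop
          · intro c hc; exact (hz2 c hc.1).ne'
      obtain ⟨c, hc, hce⟩ := intermediate_value_Icc' hc1 hcont ⟨hright, hk⟩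
      exact ⟨c, by linarith [hc.1], by linarith [hc.2], hz2 c hc.1,
        hinner c (hc0.trans hc.1) (hz2 c hc.1) hce⟩
    by_cases hz : 0 < Z₂ (1 - X)
    · by_cases hl : 1 ≤ b₁ / Z₁ (1 - X) + b₂ / Z₂ (1 - X)
      · exact hivt _ le_rfl (by linarith) hz hl
      · push Not at hl
        refine ⟨1 - X, by linarith, by linarith, hz, ?_⟩
        have hZ1 : Z₁ (1 - X) = 1 := by simp [hZ₁]
        rw [hZ1, div_one] at hl
        set q := b₂ / Z₂ (1 - X) with hq
        have hZ2le : Z₂ (1 - X) ≤ 1 := by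
          have : b₂ / m₂ * (Y + (1 - X) - 1) ≤ 0 :=
            mul_nonpos_of_nonneg_of_nonpos hq₂.le (by linarith)
          simp only [hZ₂]; linarith
        have hq0 : 0 < q := div_pos hb₂ hz
        have hbq : b₂ ≤ q := by rw [hq, le_div_iff₀ hz]; nlinarith
        have h := twoGroup_nonneg h0 h1 (show 0 < 1 - q by linarith) hq0 (by ring)
          (show 0 < 1 - q by linarith) hb₂ hX0 hY0
        unfold twoGroup at h
        rw [div_self (by linarith : (1 : ℝ) - q ≠ 0), logGap_one] at h
        nth_rewrite 2 [hq] at h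
        rw [mul_logGap_eq hm₂0 hb₂ hz] at h
        change 0 ≤ _ + _ + (m₂ * Real.log (Z₂ (1 - X)) - q * (Y + (1 - X) - 1)) + _ + _ + _ + _
          - _ - _ at h
        unfold reducedGap
        change 0 ≤ _ - _ - _ + _ + _ + _ * Real.log (Z₁ (1 - X)) + m₂ * Real.log (Z₂ (1 - X)) - _
        rw [hZ1, Real.log_one]
        have hs : 0 < (1 - q) * X + b₂ * Y := by
          have : 0 < (1 - q) * X := mul_pos (by linarith) hX0
          positivity
        have hT : 0 < b₁ * X + b₂ * Y := by positivity
        have hll := Real.log_le_sub_one_of_pos (div_pos hT hs)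
        rw [Real.log_div hT.ne' hs.ne'] at hll
        have h3 : (b₁ * X + b₂ * Y) / ((1 - q) * X + b₂ * Y) - 1 ≤ b₁ - (1 - q) := by
          rw [div_sub_one hs.ne', div_le_iff₀ hs]
          have : (1 - q) * X + b₂ * Y ≤ X := by nlinarith
          nlinarith
        linarith
    · push Not at hz
      -- Z₂ is not positive at the left end, so the search starts at the point where Z₂ = b₂: the
      -- second mass alone is 1 there.
      have hy2 : Z₂ (1 - (Y + (1 - b₂) * m₂ / b₂)) = b₂ := by
        have : b₂ / m₂ * ((1 - b₂) * m₂ / b₂) = 1 - b₂ := by field_simp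
        simp only [hZ₂]; linarith
      have hpos : 0 ≤ (1 - b₂) * m₂ / b₂ := by
        have : 0 < 1 - b₂ := by linarith
        positivity
      have hle : Y + (1 - b₂) * m₂ / b₂ ≤ X := by
        by_contra hcon
        push Not at hcon
        have : b₂ / m₂ * (Y + (1 - (Y + (1 - b₂) * m₂ / b₂)) - 1) ≤
          b₂ / m₂ * (Y + (1 - X) - 1) := by gcongr
        simp only [hZ₂] at hz hy2
        linarith
      refine hivt (1 - (Y + (1 - b₂) * m₂ / b₂)) (by linarith) (by linarith)
        (by rw [hy2]; exact hb₂) ?_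
      rw [hy2, div_self hb₂.ne']
      have := div_pos hb₁ (hZ₁pos (1 - (Y + (1 - b₂) * m₂ / b₂)) (by linarith))
      linarith

/-! ### The surrogate inequality for arbitrary families -/

/-- The range of x may be enlarged to contain 1 at no cost, as `logGap 1 = 0`. -/
theorem exists_range_bounds {ι : Type*} [Fintype ι] [Nonempty ι] (x : ι → ℝ)
    (hx : ∀ i, 0 < x i) :
    ∃ X Y, 1 ≤ X ∧ 0 < Y ∧ Y ≤ 1 ∧ (∀ i, x i ≤ X) ∧ (∀ i, Y ≤ x i) ∧
      logGap X + logGap Y ≤ ∑ i, logGap (x i) := by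
  classical
  obtain ⟨i, hi⟩ := Finite.exists_max x
  obtain ⟨j, hj⟩ := Finite.exists_min x
  have hn : ∀ i, 0 ≤ logGap (x i) := fun i => logGap_nonneg (hx i)
  have hsingle : ∀ i, logGap (x i) ≤ ∑ i, logGap (x i) := fun i =>
    Finset.single_le_sum (f := fun i => logGap (x i)) (fun i _ => hn i) (Finset.mem_univ i)
  rcases le_or_gt 1 (x i) with h1 | h1
  · rcases le_or_gt (x j) 1 with h2 | h2
    · refine ⟨x i, x j, h1, hx j, h2, hi, hj, ?_⟩
      by_cases hij : i = j
      · subst hij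
        have : x i = 1 := le_antisymm h2 h1
        rw [this, logGap_one, add_zero]
        exact Finset.sum_nonneg fun i _ => hn i
      · have := Finset.sum_le_sum_of_subset_of_nonneg (Finset.subset_univ {i, j})
          (f := fun i => logGap (x i)) (fun i _ _ => hn i)
        rwa [Finset.sum_pair hij] at this
    · refine ⟨x i, 1, h1, one_pos, le_rfl, hi, fun k => h2.le.trans (hj k), ?_⟩
      rw [logGap_one, add_zero]; exact hsingle i
  · refine ⟨1, x j, le_rfl, hx j, (hj i).trans h1.le, fun k => (hi k).trans h1.le, hj, ?_⟩
    rw [logGap_one, zero_add]; exact hsingle j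

theorem mul_log_one_add_le {β p z y : ℝ} (hβ : 0 < β) (hz : 0 < z)
    (hpos : 0 < 1 + p * z / β * y) :
    β * Real.log (1 + p * z / β * y) ≤ β * logGap z + p * y := by
  have h := psi_nonneg (s := (1 + p * z / β * y) / z) (by positivity)
  rw [Real.log_div hpos.ne' hz.ne'] at h
  have h2 := mul_nonneg hβ.le h
  have e : β * ((1 + p * z / β * y) / z) = β * z⁻¹ + p * y := by field_simp
  unfold logGap
  rw [mul_sub, mul_sub, e] at h2
  linarith

theorem log_one_add_add_ge {s t y₁ y₂ : ℝ} (hs : 0 ≤ s) (ht : 0 ≤ t) (hy₁ : 0 ≤ y₁)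
    (hy₂ : y₂ ≤ 0) (hpos : 0 < 1 + t * y₂) :
    0 < 1 + (s * y₁ + t * y₂) ∧
      Real.log (1 + s * y₁) + Real.log (1 + t * y₂) ≤ Real.log (1 + (s * y₁ + t * y₂)) := by
  have h1 : 0 ≤ s * y₁ := by positivity
  have h2 : t * y₂ ≤ 0 := mul_nonpos_of_nonneg_of_nonpos ht hy₂
  refine ⟨by linarith, ?_⟩
  rw [← Real.log_mul (by linarith) hpos.ne']
  apply Real.log_le_log (mul_pos (by linarith) hpos)
  nlinarith [mul_nonneg h1 (neg_nonneg.2 h2)]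

/-- By concavity each term is at least proportional to s j, with the chord taken up to the slope (∑
s)/max β (∑ s). The cap s j ≤ β ensures that s j / β does not exceed this slope. -/
theorem sum_log_one_add_ge {κ : Type*} [Fintype κ] {β y : ℝ} (s : κ → ℝ) (hβ : 0 < β)
    (hs : ∀ j, 0 ≤ s j) (hs1 : ∀ j, s j ≤ β) (hb : 0 < ∑ j, s j)
    (hpos : 0 < 1 + (∑ j, s j) / max β (∑ j, s j) * y) :
    max β (∑ j, s j) * Real.log (1 + (∑ j, s j) / max β (∑ j, s j) * y) ≤
      ∑ j, β * Real.log (1 + s j / β * y) := by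
  set b := ∑ j, s j with hbdef
  set m := max β b
  have hm : 0 < m := lt_max_of_lt_left hβ
  have hM : 0 < b / m := by positivity
  have hle : ∀ j, s j / β ≤ b / m := fun j => by
    rw [div_le_div_iff₀ hβ hm]
    have hjb : s j ≤ b := Finset.single_le_sum (fun i _ => hs i) (Finset.mem_univ j)
    rcases le_total β b with h | h
    · rw [show m = b from max_eq_right h]; nlinarith [hs1 j]
    · rw [show m = β from max_eq_left h]; nlinarith
  calc m * Real.log (1 + b / m * y)
      = ∑ j, β * (s j / β / (b / m) * Real.log (1 + b / m * y)) := by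
        have : ∀ j, β * (s j / β / (b / m) * Real.log (1 + b / m * y)) =
          s j * (m / b * Real.log (1 + b / m * y)) := fun j => by field_simp
        simp only [this]
        rw [← Finset.sum_mul, ← hbdef]; field_simp
    _ ≤ _ := by
        refine Finset.sum_le_sum fun j _ => mul_le_mul_of_nonneg_left ?_ hβ.le
        exact mul_log_le_log_one_add (div_nonneg (hs j) hβ.le) hM (hle j) hpos

theorem log_mul_le_sub_one {u v : ℝ} (hu : 0 < u) (hv : 0 < v) :
    Real.log (u * v) ≤ u - 1 + (v - 1) := by
  rw [Real.log_mul hu.ne' hv.ne']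
  linarith [psi_nonneg hu, psi_nonneg hv]

/-- The surrogate gap is nonnegative if only the second family of variables is capped. -/
theorem log_sum_mul_le_of_cap {ι κ : Type*} [Fintype ι] [Fintype κ] {β : ℝ} (π : ι → κ → ℝ)
    (x : ι → ℝ) (z : κ → ℝ) (hπ : ∀ i j, 0 ≤ π i j) (hπ1 : ∑ i, ∑ j, π i j = 1)
    (hx : ∀ i, 0 < x i) (hz : ∀ j, 0 < z j) (h0 : 0 < β) (h1 : β ≤ 1 / 2)
    (hcap : ∀ j, (∑ i, π i j) * z j ≤ β) :
    Real.log (∑ i, ∑ j, π i j * (x i * z j)) ≤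
      (1 - β) * ∑ i, logGap (x i) + β * ∑ j, logGap (z j)
      + (∑ i, ∑ j, π i j * x i - 1) + (∑ i, ∑ j, π i j * z j - 1) := by
  have hI : Nonempty ι := by
    by_contra hcon
    rw [not_nonempty_iff] at hcon
    simp at hπ1
  obtain ⟨X, Y, hX, hY0, hY, hxX, hYx, hΦ⟩ := exists_range_bounds x hx
  have hX0 : 0 < X := by linarith
  set p : κ → ℝ := fun j => ∑ i, π i j with hp
  set E : κ → ℝ := fun j => ∑ i, π i j * x i with hE
  have hp0 : ∀ j, 0 ≤ p j := fun j => Finset.sum_nonneg fun i _ => hπ i j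
  have hp1 : ∑ j, p j = 1 := by rw [← hπ1, Finset.sum_comm]
  have hEX : ∀ j, E j ≤ p j * X := fun j => by
    simp only [hE, hp, Finset.sum_mul]
    exact Finset.sum_le_sum fun i _ => mul_le_mul_of_nonneg_left (hxX i) (hπ i j)
  have hEY : ∀ j, p j * Y ≤ E j := fun j => by
    simp only [hE, hp, Finset.sum_mul]
    exact Finset.sum_le_sum fun i _ => mul_le_mul_of_nonneg_left (hYx i) (hπ i j)
  have hU : ∑ i, ∑ j, π i j * x i = ∑ j, E j := Finset.sum_comm
  have hV : ∑ i, ∑ j, π i j * z j = ∑ j, p j * z j := by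
    rw [Finset.sum_comm]; simp only [hp, Finset.sum_mul]
  have hT : ∑ i, ∑ j, π i j * (x i * z j) = ∑ j, E j * z j := by
    rw [Finset.sum_comm]; simp only [hE, Finset.sum_mul, mul_assoc]
  rw [hU, hV, hT]
  have hV0 : 0 < ∑ j, p j * z j := by
    have h2 : ∀ j, 0 ≤ p j * z j := fun j => mul_nonneg (hp0 j) (hz j).le
    refine lt_of_le_of_ne (Finset.sum_nonneg fun j _ => h2 j) fun h => ?_
    have h3 := (Finset.sum_eq_zero_iff_of_nonneg (fun j _ => h2 j)).1 h.symm
    have : ∑ j, p j = 0 := Finset.sum_eq_zero fun j hj =>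
      (mul_eq_zero.1 (h3 j hj)).resolve_right (hz j).ne'
    linarith
  have hα : 0 ≤ 1 - β := by linarith
  have hΦx : 0 ≤ (1 - β) * ∑ i, logGap (x i) :=
    mul_nonneg hα (Finset.sum_nonneg fun i _ => logGap_nonneg (hx i))
  have hΦz : 0 ≤ β * ∑ j, logGap (z j) :=
    mul_nonneg h0.le (Finset.sum_nonneg fun i _ => logGap_nonneg (hz i))
  -- Degenerate cases: the conditional mean of x is the same for all j, the mixed moment factorizes,
  -- and log t ≤ t - 1 for each factor suffices.
  have hprod : ∀ u, 0 < u → (∀ j, E j * z j = u * (p j * z j)) → (∑ j, E j = u) →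
      Real.log (∑ j, E j * z j) ≤ (1 - β) * ∑ i, logGap (x i) + β * ∑ j, logGap (z j)
      + (∑ j, E j - 1) + (∑ j, p j * z j - 1) := by
    intro u hu h2 h3
    rw [Finset.sum_congr rfl fun j _ => h2 j, ← Finset.mul_sum, h3]
    have := log_mul_le_sub_one hu hV0
    linarith
  rcases (hY.trans hX).eq_or_lt with hXY | hXY
  · have hEj : ∀ j, E j = X * p j := fun j => by
      have h2 := hEX j; have h3 := hEY j; rw [hXY] at h3; linarith
    exact hprod X hX0 (fun j => by rw [hEj]; ring) (by simp only [hEj, ← Finset.mul_sum, hp1, mul_one])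
  · have hD : 0 < X - Y := by linarith
    -- E j / p j lies between Y and X, so the column mass p j splits into a j at X and p j - a j at
    -- Y with the same mean. All terms but Σ `logGap (x i)` are unchanged, and that sum is at least
    -- `logGap X + logGap Y`.
    set a : κ → ℝ := fun j => (E j - p j * Y) / (X - Y) with ha
    have haE : ∀ j, E j = a j * X + (p j - a j) * Y := fun j => by
      have : a j * (X - Y) = E j - p j * Y := div_mul_cancel₀ _ hD.ne'
      linarith
    have ha0 : ∀ j, 0 ≤ a j := fun j => div_nonneg (by linarith [hEY j]) hD.le
    have hap : ∀ j, a j ≤ p j := fun j => by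
      simp only [ha]; rw [div_le_iff₀ hD]; linarith [hEX j]
    set s : κ → ℝ := fun j => a j * z j with hs
    set t : κ → ℝ := fun j => (p j - a j) * z j with ht
    have hs0 : ∀ j, 0 ≤ s j := fun j => mul_nonneg (ha0 j) (hz j).le
    have ht0 : ∀ j, 0 ≤ t j := fun j => mul_nonneg (by linarith [hap j]) (hz j).le
    have hst : ∀ j, s j + t j = p j * z j := fun j => by simp only [hs, ht]; ring
    have hsβ : ∀ j, s j ≤ β := fun j => by linarith [hst j, ht0 j, hcap j]
    have htβ : ∀ j, t j ≤ β := fun j => by linarith [hst j, hs0 j, hcap j]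
    rcases (Finset.sum_nonneg fun j _ => hs0 j : 0 ≤ ∑ j, s j).eq_or_lt with hb1 | hb1
    · have h2 := (Finset.sum_eq_zero_iff_of_nonneg (fun j _ => hs0 j)).1 hb1.symm
      have h3 : ∀ j, a j = 0 := fun j =>
        (mul_eq_zero.1 (h2 j (Finset.mem_univ j))).resolve_right (hz j).ne'
      exact hprod Y hY0 (fun j => by rw [haE, h3]; ring)
        (by simp only [haE, h3, zero_mul, zero_add, sub_zero, ← Finset.sum_mul, hp1, one_mul])
    rcases (Finset.sum_nonneg fun j _ => ht0 j : 0 ≤ ∑ j, t j).eq_or_lt with hb2 | hb2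
    · have h2 := (Finset.sum_eq_zero_iff_of_nonneg (fun j _ => ht0 j)).1 hb2.symm
      have h3 : ∀ j, a j = p j := fun j => by
        have := (mul_eq_zero.1 (h2 j (Finset.mem_univ j))).resolve_right (hz j).ne'
        linarith
      exact hprod X hX0 (fun j => by rw [haE, h3]; ring)
        (by simp only [haE, h3, sub_self, zero_mul, add_zero, ← Finset.sum_mul, hp1, one_mul])
    obtain ⟨c, hc1, hc2, hc3, hc⟩ := reducedGap_exists_nonneg h0 h1 hb1 hb2 hX hY0 hY
    have hq1 : 0 < 1 + (∑ j, s j) / max β (∑ j, s j) * (X + c - 1) := by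
      have : 0 < max β (∑ j, s j) := lt_max_of_lt_left h0
      positivity
    have k1 := sum_log_one_add_ge s h0 hs0 hsβ hb1 hq1
    have k2 := sum_log_one_add_ge t h0 ht0 htβ hb2 hc3
    have htpos : ∀ j, 0 < 1 + t j / β * (Y + c - 1) := fun j => by
      have hm : 0 < max β (∑ j, t j) := lt_max_of_lt_left h0
      have : t j / β ≤ (∑ j, t j) / max β (∑ j, t j) := by
        rw [div_le_div_iff₀ h0 hm]
        have hjb : t j ≤ ∑ j, t j := Finset.single_le_sum (fun i _ => ht0 i) (Finset.mem_univ j)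
        rcases le_total β (∑ j, t j) with h | h
        · rw [max_eq_right h]; nlinarith [htβ j]
        · rw [max_eq_left h]; nlinarith
      nlinarith
    -- The two groups belonging to the same j are rejoined, since y₁ ≥ 0 ≥ y₂ makes the logarithms
    -- superadditive; a tangent inequality then brings z j back.
    have k3 : ∀ j, β * Real.log (1 + s j / β * (X + c - 1)) +
        β * Real.log (1 + t j / β * (Y + c - 1)) ≤ β * logGap (z j) + (E j + p j * (c - 1)) := by
      intro j
      obtain ⟨l1, l2⟩ := log_one_add_add_ge (s := s j / β) (t := t j / β) (y₁ := X + c - 1)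
        (y₂ := Y + c - 1) (div_nonneg (hs0 j) h0.le) (div_nonneg (ht0 j) h0.le) hc1 hc2 (htpos j)
      rcases (hp0 j).eq_or_lt with hpz | hpp
      · have hz1 : a j = 0 := le_antisymm (hpz ▸ hap j) (ha0 j)
        have hg := mul_nonneg h0.le (logGap_nonneg (hz j))
        simp only [haE, hs, ht, hz1, ← hpz]
        simpa using hg
      · have e : s j / β * (X + c - 1) + t j / β * (Y + c - 1) =
          p j * z j / β * (E j / p j + (c - 1)) := by
          rw [haE]; simp only [hs, ht]; field_simp; ring
        rw [e] at l1 l2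
        have l3 := mul_log_one_add_le h0 (hz j) l1
        have e2 : p j * (E j / p j + (c - 1)) = E j + p j * (c - 1) := by field_simp
        rw [e2] at l3
        nlinarith
    have k4 := Finset.sum_le_sum fun j (_ : j ∈ Finset.univ) => k3 j
    rw [Finset.sum_add_distrib, Finset.sum_add_distrib, Finset.sum_add_distrib, ← Finset.sum_mul,
      hp1, ← Finset.mul_sum (f := fun j => logGap (z j))] at k4
    have hTe : ∑ j, E j * z j = (∑ j, s j) * X + (∑ j, t j) * Y := by
      rw [Finset.sum_mul, Finset.sum_mul, ← Finset.sum_add_distrib]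
      exact Finset.sum_congr rfl fun j _ => by rw [haE]; simp only [hs, ht]; ring
    have hVe : ∑ j, p j * z j = ∑ j, s j + ∑ j, t j := by
      rw [← Finset.sum_add_distrib]; exact Finset.sum_congr rfl fun j _ => (hst j).symm
    rw [hTe, hVe]
    unfold reducedGap at hc
    have := mul_le_mul_of_nonneg_left hΦ hα
    linarith

/-- After subtraction of the extra term the weights are 1-β and β. For β ≤ 1/2 this is the capped
inequality; for β ≥ 1/2 the larger weight stands at the larger sum, so the weights 1/2 are a worse
case. -/
theorem surrogate_gap_of_le {ι κ : Type*} [Fintype ι] [Fintype κ] {α β : ℝ} (π : ι → κ → ℝ)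
    (x : ι → ℝ) (z : κ → ℝ) (hπ : ∀ i j, 0 ≤ π i j) (hπ1 : ∑ i, ∑ j, π i j = 1)
    (hx : ∀ i, 0 < x i) (hz : ∀ j, 0 < z j) (h0 : 0 < β)
    (hcap : ∀ j, (∑ i, π i j) * z j ≤ β) (hle : ∑ i, logGap (x i) ≤ ∑ j, logGap (z j)) :
    Real.log (∑ i, ∑ j, π i j * (x i * z j)) + (α + β - 1) * ∑ i, logGap (x i) ≤
      α * ∑ i, logGap (x i) + β * ∑ j, logGap (z j)
      + (∑ i, ∑ j, π i j * x i - 1) + (∑ i, ∑ j, π i j * z j - 1) := by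
  rcases le_total β (1 / 2) with h | h
  · have := log_sum_mul_le_of_cap π x z hπ hπ1 hx hz h0 h hcap
    linarith
  · have := log_sum_mul_le_half π x z hπ hπ1 hx hz
    nlinarith

/-- The surrogate gap dominates a multiple of the smaller one of the two distances. -/
theorem surrogate_gap {ι κ : Type*} [Fintype ι] [Fintype κ] {α β : ℝ} (π : ι → κ → ℝ)
    (x : ι → ℝ) (z : κ → ℝ) (hπ : ∀ i j, 0 ≤ π i j) (hπ1 : ∑ i, ∑ j, π i j = 1)
    (hx : ∀ i, 0 < x i) (hz : ∀ j, 0 < z j) (hα : 0 < α) (hβ : 0 < β)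
    (hcapx : ∀ i, (∑ j, π i j) * x i ≤ α) (hcap : ∀ j, (∑ i, π i j) * z j ≤ β) :
    Real.log (∑ i, ∑ j, π i j * (x i * z j)) +
      (α + β - 1) * min (∑ i, logGap (x i)) (∑ j, logGap (z j)) ≤
      α * ∑ i, logGap (x i) + β * ∑ j, logGap (z j)
      + (∑ i, ∑ j, π i j * x i - 1) + (∑ i, ∑ j, π i j * z j - 1) := by
  rcases le_total (∑ i, logGap (x i)) (∑ j, logGap (z j)) with h | h
  · rw [min_eq_left h]
    exact surrogate_gap_of_le π x z hπ hπ1 hx hz hβ hcap h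
  · rw [min_eq_right h]
    have := surrogate_gap_of_le (α := β) (fun j i => π i j) z x (fun j i => hπ i j)
      (by rw [Finset.sum_comm]; exact hπ1) hz hx hα hcapx h
    rw [Finset.sum_comm (f := fun j i => π i j * (z j * x i)),
      Finset.sum_comm (f := fun j i => π i j * z j),
      Finset.sum_comm (f := fun j i => π i j * x i)] at this
    simp only [mul_comm (z _)] at this
    linarith

/-! ### A small surrogate gap controls both distances -/

/-- The guaranteed decrease of the cost, in coordinates that diagonalize an update. -/
noncomputable def surrogateGap {ι κ : Type*} [Fintype ι] [Fintype κ] (α β : ℝ) (π : ι → κ → ℝ)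
    (x : ι → ℝ) (z : κ → ℝ) : ℝ :=
  α * ∑ i, logGap (x i) + β * ∑ j, logGap (z j) + (∑ i, ∑ j, π i j * x i - 1)
    + (∑ i, ∑ j, π i j * z j - 1) - Real.log (∑ i, ∑ j, π i j * (x i * z j))

theorem surrogateGap_swap {ι κ : Type*} [Fintype ι] [Fintype κ] (α β : ℝ) (π : ι → κ → ℝ)
    (x : ι → ℝ) (z : κ → ℝ) :
    surrogateGap α β π x z = surrogateGap β α (fun j i => π i j) z x := by
  unfold surrogateGap
  rw [Finset.sum_comm (f := fun j i => π i j * (z j * x i)),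
    Finset.sum_comm (f := fun j i => π i j * z j),
    Finset.sum_comm (f := fun j i => π i j * x i)]
  simp only [mul_comm (z _)]
  ring

/-- On (0, 1] this comes from log s ≤ (s - 1/s)/2 at s = 1/x, on [1, 2] from the quadratic bound for
ψ(1/x). -/
theorem sq_sub_one_le_logGap {x : ℝ} (hx : 0 < x) (hx2 : x ≤ 2) :
    (x - 1) ^ 2 ≤ 8 * logGap x := by
  have hi : 0 < x⁻¹ := by positivity
  have e : logGap x = x⁻¹ - 1 - Real.log x⁻¹ := by unfold logGap; rw [Real.log_inv]; ring
  have hxi : x * x⁻¹ = 1 := mul_inv_cancel₀ hx.ne'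
  rcases le_total x 1 with h | h
  · have h5 : Real.log x⁻¹ ≤ (x⁻¹ - x) / 2 := by
      have h6 : ∀ s : ℝ, 1 ≤ s → Real.log s ≤ (s - s⁻¹) / 2 := by
        intro s hs
        have hmono : MonotoneOn (fun s : ℝ => (s - s⁻¹) / 2 - Real.log s) (Set.Ici 1) := by
          have hd : ∀ t : ℝ, 1 ≤ t → HasDerivAt (fun s : ℝ => (s - s⁻¹) / 2 - Real.log s)
              ((1 - (-(t ^ 2)⁻¹)) / 2 - t⁻¹) t := fun t ht => by
            have ht0 : t ≠ 0 := by linarith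
            exact (((hasDerivAt_id t).sub (hasDerivAt_inv ht0)).div_const 2).sub
              (Real.hasDerivAt_log ht0)
          apply monotoneOn_of_deriv_nonneg (convex_Ici 1)
          · intro t ht; exact (hd t ht).continuousAt.continuousWithinAt
          · intro t ht
            rw [interior_Ici] at ht
            exact (hd t (le_of_lt ht)).differentiableAt.differentiableWithinAt
          · intro t ht
            rw [interior_Ici] at ht
            rw [(hd t (le_of_lt ht)).deriv]
            have : (1 - (-(t ^ 2)⁻¹)) / 2 - t⁻¹ = (1 - t⁻¹) ^ 2 / 2 := by
              ring
            rw [this]; positivity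
        have := hmono (Set.mem_Ici.2 le_rfl) (Set.mem_Ici.2 hs) hs
        simp at this
        linarith
      have := h6 x⁻¹ ((one_le_inv₀ hx).2 h)
      rwa [inv_inv] at this
    rw [e]
    have h8 : 1 ≤ x⁻¹ := (one_le_inv₀ hx).2 h
    nlinarith
  · have h2 := sq_sub_half_le_psi hi (inv_le_one_of_one_le₀ h)
    rw [e]
    have h3 : (x - 1) ^ 2 = x ^ 2 * (1 - x⁻¹) ^ 2 := by
      rw [← mul_pow, mul_sub, hxi, mul_one]
    have h4 : x ^ 2 ≤ 4 := by nlinarith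
    rw [h3]
    nlinarith [sq_nonneg (1 - x⁻¹)]

theorem le_two_of_logGap {x : ℝ} (hx : 0 < x) (h : logGap x ≤ 1 / 8) : x ≤ 2 := by
  by_contra hcon
  push Not at hcon
  have hi : 0 < x⁻¹ := by positivity
  have h1 : x⁻¹ < 1 / 2 := by rw [inv_lt_comm₀ hx (by norm_num)]; norm_num; exact hcon
  have e : logGap x = x⁻¹ - 1 - Real.log x⁻¹ := by unfold logGap; rw [Real.log_inv]; ring
  have h2 := sq_sub_half_le_psi hi (by linarith)
  rw [← e] at h2
  nlinarith

theorem abs_sub_one_le_of_logGap {x ε : ℝ} (hx : 0 < x) (h : logGap x ≤ 1 / 8) (hε : 0 ≤ ε)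
    (h2 : 8 * logGap x ≤ ε ^ 2) : |x - 1| ≤ ε :=
  abs_le_of_sq_le_sq ((sq_sub_one_le_logGap hx (le_two_of_logGap hx h)).trans h2) hε

section

variable {ι κ : Type*} [Fintype ι] [Fintype κ] {α β : ℝ} {π : ι → κ → ℝ} {x : ι → ℝ} {z : κ → ℝ}

/-- The mixed logarithm is at most log((1+ε) E z) ≤ ε + E z - 1, which cancels the linear term in z;
the other ε comes from E x ≥ 1 - ε. -/
theorem surrogateGap_ge_of_near_one (hα : 0 ≤ α) {ε : ℝ}
    (hε : 0 ≤ ε) (hε1 : ε < 1)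
    (hπ : ∀ i j, 0 ≤ π i j) (hπ1 : ∑ i, ∑ j, π i j = 1) (hx : ∀ i, 0 < x i) (hz : ∀ j, 0 < z j)
    (hxε : ∀ i, |x i - 1| ≤ ε) :
    β * ∑ j, logGap (z j) ≤ surrogateGap α β π x z + 2 * ε := by
  have hlo : 1 - ε ≤ ∑ i, ∑ j, π i j * x i := by
    calc 1 - ε = ∑ i, ∑ j, π i j * (1 - ε) := by
          simp only [← Finset.sum_mul, hπ1, one_mul]
      _ ≤ _ := Finset.sum_le_sum fun i _ => Finset.sum_le_sum fun j _ =>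
          mul_le_mul_of_nonneg_left (by linarith [(abs_le.1 (hxε i)).1]) (hπ i j)
  have hT : ∑ i, ∑ j, π i j * (x i * z j) ≤ (1 + ε) * ∑ i, ∑ j, π i j * z j := by
    simp only [Finset.mul_sum]
    refine Finset.sum_le_sum fun i _ => Finset.sum_le_sum fun j _ => ?_
    have h1 : x i ≤ 1 + ε := by linarith [(abs_le.1 (hxε i)).2]
    have h2 := mul_nonneg (hπ i j) (hz j).le
    nlinarith
  have hT0 : (1 - ε) * ∑ i, ∑ j, π i j * z j ≤ ∑ i, ∑ j, π i j * (x i * z j) := by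
    simp only [Finset.mul_sum]
    refine Finset.sum_le_sum fun i _ => Finset.sum_le_sum fun j _ => ?_
    have h1 : 1 - ε ≤ x i := by linarith [(abs_le.1 (hxε i)).1]
    have h2 := mul_nonneg (hπ i j) (hz j).le
    nlinarith
  have hV : 0 < ∑ i, ∑ j, π i j * z j := by
    have h0 : ∀ p : ι × κ, 0 ≤ π p.1 p.2 * z p.2 := fun p => mul_nonneg (hπ _ _) (hz _).le
    rw [← Fintype.sum_prod_type' (f := fun i j => π i j * z j)]
    rw [← Fintype.sum_prod_type' (f := π)] at hπ1
    refine lt_of_le_of_ne (Finset.sum_nonneg fun p _ => h0 p) fun h => ?_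
    have h3 := (Finset.sum_eq_zero_iff_of_nonneg (fun p _ => h0 p)).1 h.symm
    have : ∑ p : ι × κ, π p.1 p.2 = 0 := Finset.sum_eq_zero fun p hp =>
      (mul_eq_zero.1 (h3 p hp)).resolve_right (hz _).ne'
    linarith
  have hTpos : 0 < ∑ i, ∑ j, π i j * (x i * z j) :=
    lt_of_lt_of_le (mul_pos (by linarith) hV) hT0
  have hlog := Real.log_le_log hTpos hT
  have := log_mul_le_sub_one (show 0 < 1 + ε by linarith) hV
  have hΦ : 0 ≤ α * ∑ i, logGap (x i) :=
    mul_nonneg hα (Finset.sum_nonneg fun i _ => logGap_nonneg (hx i))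
  unfold surrogateGap
  linarith

/-- The bound log T ≤ T - 1 cancels all first-order terms and leaves E[(x-1)(z-1)]. Weighted AM-GM
splits it so that only half of β Σ `logGap (z j)` is used up. -/
theorem surrogateGap_ge_local (hβ : 0 < β) (hα : 0 ≤ α) (hπ : ∀ i j, 0 ≤ π i j)
    (hπ1 : ∑ i, ∑ j, π i j = 1) (hx : ∀ i, 0 < x i) (hz : ∀ j, 0 < z j) (hx2 : ∀ i, x i ≤ 2)
    (hz2 : ∀ j, z j ≤ 2) :
    β / 2 * ∑ j, logGap (z j) - 32 / β * ∑ i, logGap (x i) ≤ surrogateGap α β π x z := by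
  have hrow : ∀ i, ∑ j, π i j ≤ 1 := fun i => by
    rw [← hπ1]
    exact Finset.single_le_sum (f := fun i => ∑ j, π i j)
      (fun i _ => Finset.sum_nonneg fun j _ => hπ i j) (Finset.mem_univ i)
  have hcol : ∀ j, ∑ i, π i j ≤ 1 := fun j => by
    rw [← hπ1, Finset.sum_comm]
    exact Finset.single_le_sum (f := fun j => ∑ i, π i j)
      (fun j _ => Finset.sum_nonneg fun i _ => hπ i j) (Finset.mem_univ j)
  have hTpos : 0 ≤ ∑ i, ∑ j, π i j * (x i * z j) :=
    Finset.sum_nonneg fun i _ => Finset.sum_nonneg fun j _ =>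
      mul_nonneg (hπ i j) (mul_pos (hx i) (hz j)).le
  have hlog : Real.log (∑ i, ∑ j, π i j * (x i * z j)) ≤
      ∑ i, ∑ j, π i j * (x i * z j) - 1 ∨ ∑ i, ∑ j, π i j * (x i * z j) = 0 := by
    rcases hTpos.eq_or_lt with h | h
    · exact Or.inr h.symm
    · exact Or.inl (Real.log_le_sub_one_of_pos h)
  have hlog' : Real.log (∑ i, ∑ j, π i j * (x i * z j)) ≤
      ∑ i, ∑ j, π i j * (x i * z j) - 1 := by
    rcases hlog with h | h
    · exact h
    · exfalso
      have h0 : ∀ p : ι × κ, 0 ≤ π p.1 p.2 * (x p.1 * z p.2) := fun p =>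
        mul_nonneg (hπ _ _) (mul_pos (hx _) (hz _)).le
      rw [← Fintype.sum_prod_type' (f := fun i j => π i j * (x i * z j))] at h
      rw [← Fintype.sum_prod_type' (f := π)] at hπ1
      have h3 := (Finset.sum_eq_zero_iff_of_nonneg (fun p _ => h0 p)).1 h
      have : ∑ p : ι × κ, π p.1 p.2 = 0 := Finset.sum_eq_zero fun p hp =>
        (mul_eq_zero.1 (h3 p hp)).resolve_right (mul_pos (hx _) (hz _)).ne'
      linarith
  have hcross : ∑ i, ∑ j, π i j * (x i * z j) - 1 = (∑ i, ∑ j, π i j * x i - 1) +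
      (∑ i, ∑ j, π i j * z j - 1) + ∑ i, ∑ j, π i j * ((x i - 1) * (z j - 1)) := by
    have : ∑ i, ∑ j, π i j * ((x i - 1) * (z j - 1)) = ∑ i, ∑ j, π i j * (x i * z j) -
      ∑ i, ∑ j, π i j * x i - ∑ i, ∑ j, π i j * z j + ∑ i, ∑ j, π i j := by
      simp only [← Finset.sum_sub_distrib, ← Finset.sum_add_distrib]
      exact Finset.sum_congr rfl fun i _ => Finset.sum_congr rfl fun j _ => by ring
    rw [this, hπ1]; ring
  have hbd : ∑ i, ∑ j, π i j * ((x i - 1) * (z j - 1)) ≤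
      32 / β * ∑ i, logGap (x i) + β / 2 * ∑ j, logGap (z j) := by
    have h1 : ∀ i j, π i j * ((x i - 1) * (z j - 1)) ≤
        32 / β * (π i j * logGap (x i)) + β / 2 * (π i j * logGap (z j)) := by
      intro i j
      have h2 := sq_sub_one_le_logGap (hx i) (hx2 i)
      have h3 := sq_sub_one_le_logGap (hz j) (hz2 j)
      have h4 : (x i - 1) * (z j - 1) ≤ 4 / β * (x i - 1) ^ 2 + β / 16 * (z j - 1) ^ 2 := by
        have : 4 / β * (x i - 1) ^ 2 + β / 16 * (z j - 1) ^ 2 - (x i - 1) * (z j - 1) =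
          (8 * (x i - 1) - β * (z j - 1)) ^ 2 / (16 * β) := by field_simp; ring
        have h5 : 0 ≤ (8 * (x i - 1) - β * (z j - 1)) ^ 2 / (16 * β) := by positivity
        linarith
      have h6 : 4 / β * (x i - 1) ^ 2 ≤ 4 / β * (8 * logGap (x i)) := by gcongr
      have h7 : β / 16 * (z j - 1) ^ 2 ≤ β / 16 * (8 * logGap (z j)) := by gcongr
      have h8 : (x i - 1) * (z j - 1) ≤ 32 / β * logGap (x i) + β / 2 * logGap (z j) := by
        have e1 : 4 / β * (8 * logGap (x i)) = 32 / β * logGap (x i) := by ring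
        have e2 : β / 16 * (8 * logGap (z j)) = β / 2 * logGap (z j) := by ring
        linarith
      calc _ ≤ π i j * (32 / β * logGap (x i) + β / 2 * logGap (z j)) :=
            mul_le_mul_of_nonneg_left h8 (hπ i j)
        _ = _ := by ring
    calc _ ≤ ∑ i, ∑ j, (32 / β * (π i j * logGap (x i)) + β / 2 * (π i j * logGap (z j))) :=
          Finset.sum_le_sum fun i _ => Finset.sum_le_sum fun j _ => h1 i j
      _ = 32 / β * ∑ i, (∑ j, π i j) * logGap (x i) +
          β / 2 * ∑ j, (∑ i, π i j) * logGap (z j) := by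
          simp only [Finset.sum_add_distrib, ← Finset.mul_sum, Finset.sum_mul]
          rw [Finset.sum_comm (f := fun j i => π i j * logGap (z j))]
      _ ≤ _ := by
          gcongr with i _ j _
          · exact mul_le_of_le_one_left (logGap_nonneg (hx i)) (hrow i)
          · exact mul_le_of_le_one_left (logGap_nonneg (hz j)) (hcol j)
  have hΦ : 0 ≤ α * ∑ i, logGap (x i) :=
    mul_nonneg hα (Finset.sum_nonneg fun i _ => logGap_nonneg (hx i))
  unfold surrogateGap
  linarith

/-- A bootstrap: the small gap puts every x i near 1, then `surrogateGap_ge_of_near_one` puts every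
z j near 1, and only then does `surrogateGap_ge_local` give a linear bound. -/
theorem sum_logGap_le_of_left (hβ : 0 < β) (hα : 0 ≤ α) {η : ℝ} (hη : 0 < η) :
    ∃ δ > 0, ∃ C, ∀ (π : ι → κ → ℝ) (x : ι → ℝ) (z : κ → ℝ), (∀ i j, 0 ≤ π i j) →
      ∑ i, ∑ j, π i j = 1 → (∀ i, 0 < x i) → (∀ j, 0 < z j) → surrogateGap α β π x z ≤ δ →
      η * ∑ i, logGap (x i) ≤ surrogateGap α β π x z →
      ∑ i, logGap (x i) + ∑ j, logGap (z j) ≤ C * surrogateGap α β π x z := by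
  obtain ⟨ε, hε0, hε1, hεβ⟩ : ∃ ε : ℝ, 0 < ε ∧ ε ≤ 1 / 2 ∧ ε ≤ β / 32 :=
    ⟨min (1 / 2) (β / 32), lt_min (by norm_num) (by positivity), min_le_left _ _, min_le_right _ _⟩
  -- The second entry gives 8·`logGap (x i)` ≤ ε². The first one and 2ε ≤ β/16 give Σ `logGap (z j)`
  -- ≤ 1/8.
  refine ⟨min (β / 16) (η * ε ^ 2 / 8), lt_min (by positivity) (by positivity),
    1 / η + 2 / β * (1 + 32 / β * (1 / η)), ?_⟩
  intro π x z hπ hπ1 hx hz hG hΦ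
  set G := surrogateGap α β π x z with hGdef
  have hG1 : G ≤ β / 16 := hG.trans (min_le_left _ _)
  have hG2 : G ≤ η * ε ^ 2 / 8 := hG.trans (min_le_right _ _)
  have hΦ1 : ∑ i, logGap (x i) ≤ 1 / η * G := by
    rw [one_div, inv_mul_eq_div, le_div_iff₀ hη]; linarith
  have hΦ2 : ∑ i, logGap (x i) ≤ ε ^ 2 / 8 := by
    have : η * ∑ i, logGap (x i) ≤ η * (ε ^ 2 / 8) := by linarith
    exact le_of_mul_le_mul_left this hη
  have hxi : ∀ i, logGap (x i) ≤ ε ^ 2 / 8 := fun i =>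
    (Finset.single_le_sum (f := fun i => logGap (x i)) (fun i _ => logGap_nonneg (hx i))
      (Finset.mem_univ i)).trans hΦ2
  have hε2 : ε ^ 2 / 8 ≤ 1 / 8 := by nlinarith
  have h1 := surrogateGap_ge_of_near_one (β := β) hα hε0.le (by linarith) hπ hπ1 hx hz fun i =>
    abs_sub_one_le_of_logGap (hx i) ((hxi i).trans hε2) hε0.le (by linarith [hxi i])
  have hΦz : ∑ j, logGap (z j) ≤ 1 / 8 := by
    have : β * ∑ j, logGap (z j) ≤ β * (1 / 8) := by linarith
    exact le_of_mul_le_mul_left this hβ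
  have hzj : ∀ j, logGap (z j) ≤ 1 / 8 := fun j =>
    (Finset.single_le_sum (f := fun j => logGap (z j)) (fun j _ => logGap_nonneg (hz j))
      (Finset.mem_univ j)).trans hΦz
  have h2 := surrogateGap_ge_local hβ hα hπ hπ1 hx hz
    (fun i => le_two_of_logGap (hx i) ((hxi i).trans hε2))
    fun j => le_two_of_logGap (hz j) (hzj j)
  have h3 : 32 / β * ∑ i, logGap (x i) ≤ 32 / β * (1 / η * G) := by gcongr
  have h4 : ∑ j, logGap (z j) = 2 / β * (β / 2 * ∑ j, logGap (z j)) := by field_simp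
  have h5 : 2 / β * (β / 2 * ∑ j, logGap (z j)) ≤ 2 / β * (G + 32 / β * (1 / η * G)) := by
    gcongr; linarith
  rw [h4]
  linarith

/-- Where the surrogate gap is small, it dominates a multiple of both distances. -/
theorem sum_logGap_le_surrogateGap (ι κ : Type*) [Fintype ι] [Fintype κ] {α β : ℝ} (hα : 0 < α)
    (hβ : 0 < β) (hαβ : 1 < α + β) :
    ∃ δ > 0, ∃ C, ∀ (π : ι → κ → ℝ) (x : ι → ℝ) (z : κ → ℝ), (∀ i j, 0 ≤ π i j) →
      ∑ i, ∑ j, π i j = 1 → (∀ i, 0 < x i) → (∀ j, 0 < z j) → (∀ i, (∑ j, π i j) * x i ≤ α) →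
      (∀ j, (∑ i, π i j) * z j ≤ β) → 0 ≤ surrogateGap α β π x z ∧
      (surrogateGap α β π x z ≤ δ →
      ∑ i, logGap (x i) + ∑ j, logGap (z j) ≤ C * surrogateGap α β π x z) := by
  have hη : 0 < α + β - 1 := by linarith
  obtain ⟨δ₁, hδ₁, C₁, h₁⟩ := sum_logGap_le_of_left (ι := ι) (κ := κ) hβ hα.le hη
  obtain ⟨δ₂, hδ₂, C₂, h₂⟩ := sum_logGap_le_of_left (ι := κ) (κ := ι) hα hβ.le hη
  refine ⟨min δ₁ δ₂, lt_min hδ₁ hδ₂, max C₁ C₂, ?_⟩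
  intro π x z hπ hπ1 hx hz hcx hcz
  have hgap := surrogate_gap π x z hπ hπ1 hx hz hα hβ hcx hcz
  have hgap' : (α + β - 1) * min (∑ i, logGap (x i)) (∑ j, logGap (z j)) ≤
      surrogateGap α β π x z := by unfold surrogateGap; linarith
  have hmin : 0 ≤ min (∑ i, logGap (x i)) (∑ j, logGap (z j)) :=
    le_min (Finset.sum_nonneg fun i _ => logGap_nonneg (hx i))
      (Finset.sum_nonneg fun i _ => logGap_nonneg (hz i))
  have hG0 : 0 ≤ surrogateGap α β π x z := (mul_nonneg hη.le hmin).trans hgap'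
  refine ⟨hG0, fun hδ => ?_⟩
  rcases le_total (∑ i, logGap (x i)) (∑ j, logGap (z j)) with h | h
  · rw [min_eq_left h] at hgap'
    have := h₁ π x z hπ hπ1 hx hz (hδ.trans (min_le_left _ _)) hgap'
    have h3 := mul_le_mul_of_nonneg_right (le_max_left C₁ C₂) hG0
    linarith
  · rw [min_eq_right h] at hgap'
    rw [surrogateGap_swap] at hgap' hδ hG0 ⊢
    have := h₂ (fun j i => π i j) z x (fun j i => hπ i j) (by rw [Finset.sum_comm]; exact hπ1)
      hz hx (hδ.trans (min_le_right _ _)) hgap'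
    have h3 := mul_le_mul_of_nonneg_right (le_max_right C₁ C₂) hG0
    linarith

end

/-! ### Congruence coordinates for positive definite matrices -/

section Coordinates

variable {n : Type*} [DecidableEq n]

/-- The diagonal complex matrix with real diagonal `d`. -/
noncomputable def rdiag (d : n → ℝ) : Matrix n n ℂ := Matrix.diagonal fun i => (d i : ℂ)

theorem rdiag_one : rdiag (fun _ : n => (1 : ℝ)) = 1 := by simp [rdiag]

theorem rdiag_posDef {d : n → ℝ} (hd : ∀ i, 0 < d i) : (rdiag d).PosDef :=
  Matrix.PosDef.diagonal fun i => by exact_mod_cast hd i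

variable [Fintype n]

theorem rdiag_inv {d : n → ℝ} (hd : ∀ i, 0 < d i) : (rdiag d)⁻¹ = rdiag fun i => (d i)⁻¹ := by
  apply Matrix.inv_eq_right_inv
  rw [rdiag, rdiag, Matrix.diagonal_mul_diagonal, ← Matrix.diagonal_one]
  congr 1
  ext i
  have : (d i : ℂ) ≠ 0 := by exact_mod_cast (hd i).ne'
  push_cast
  field_simp

theorem posDef_congr {P : Matrix n n ℂ} (hP : IsUnit P) {d : n → ℝ} (hd : ∀ i, 0 < d i) :
    (P * rdiag d * Pᴴ).PosDef :=
  (Matrix.IsUnit.posDef_star_right_conjugate_iff hP).2 (rdiag_posDef hd)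

theorem spectral_decomposition {A : Matrix n n ℂ} (hA : A.IsHermitian) :
    ∃ U ∈ Matrix.unitaryGroup n ℂ, ∃ d : n → ℝ, A = U * rdiag d * Uᴴ :=
  ⟨hA.eigenvectorUnitary, hA.eigenvectorUnitary.2, hA.eigenvalues, hA.spectral_theorem⟩

theorem isUnit_of_mem_unitary {U : Matrix n n ℂ} (hU : U ∈ Matrix.unitaryGroup n ℂ) : IsUnit U :=
  ⟨Unitary.toUnits ⟨U, hU⟩, rfl⟩

theorem posDef_spectral {A : Matrix n n ℂ} (hA : A.PosDef) :
    ∃ U ∈ Matrix.unitaryGroup n ℂ, ∃ d : n → ℝ, (∀ i, 0 < d i) ∧ A = U * rdiag d * Uᴴ :=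
  ⟨hA.1.eigenvectorUnitary, hA.1.eigenvectorUnitary.2, hA.1.eigenvalues, hA.eigenvalues_pos,
    hA.1.spectral_theorem⟩

theorem posDef_eq_mul_conjTranspose {A : Matrix n n ℂ} (hA : A.PosDef) :
    ∃ P : Matrix n n ℂ, IsUnit P ∧ A = P * Pᴴ := by
  obtain ⟨U, hU, d, hd, rfl⟩ := posDef_spectral hA
  have hs : ∀ i, 0 < √(d i) := fun i => Real.sqrt_pos.2 (hd i)
  refine ⟨U * rdiag fun i => √(d i), (isUnit_of_mem_unitary hU).mul (rdiag_posDef hs).isUnit, ?_⟩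
  rw [Matrix.conjTranspose_mul, (rdiag_posDef hs).1.eq]
  have : rdiag d = rdiag (fun i => √(d i)) * rdiag fun i => √(d i) := by
    rw [rdiag, rdiag, Matrix.diagonal_mul_diagonal]
    congr 1; ext i
    rw [← Complex.ofReal_mul, Real.mul_self_sqrt (hd i).le]
  rw [this]; simp only [Matrix.mul_assoc]

/-- Simultaneous diagonalization by congruence. -/
theorem exists_simultaneous_diagonalization {A B : Matrix n n ℂ} (hA : A.PosDef)
    (hB : B.IsHermitian) :
    ∃ P : Matrix n n ℂ, IsUnit P ∧ ∃ d : n → ℝ, A = P * Pᴴ ∧ B = P * rdiag d * Pᴴ := by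
  obtain ⟨P, hP, rfl⟩ := posDef_eq_mul_conjTranspose hA
  have hdet := (Matrix.isUnit_iff_isUnit_det P).1 hP
  have hC : (P⁻¹ * B * P⁻¹ᴴ).IsHermitian := Matrix.isHermitian_mul_mul_conjTranspose _ hB
  obtain ⟨U, hU, d, hd⟩ := spectral_decomposition hC
  refine ⟨P * U, hP.mul (isUnit_of_mem_unitary hU), d, ?_, ?_⟩
  · rw [Matrix.conjTranspose_mul, Matrix.mul_assoc, ← Matrix.mul_assoc U,
      show U * Uᴴ = 1 from (Matrix.mem_unitaryGroup_iff).1 hU, Matrix.one_mul]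
  · have hPH : P⁻¹ᴴ * Pᴴ = 1 := by
      rw [← Matrix.conjTranspose_mul, Matrix.mul_nonsing_inv _ hdet, Matrix.conjTranspose_one]
    calc B = P * P⁻¹ * B * (P⁻¹ᴴ * Pᴴ) := by
          rw [hPH, Matrix.mul_nonsing_inv _ hdet, Matrix.one_mul, Matrix.mul_one]
      _ = P * (P⁻¹ * B * P⁻¹ᴴ) * Pᴴ := by simp only [Matrix.mul_assoc]
      _ = _ := by rw [hd, Matrix.conjTranspose_mul]; simp only [Matrix.mul_assoc]

theorem inv_congr (P : Matrix n n ℂ) {d : n → ℝ} (hd : ∀ i, 0 < d i) :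
    (P * rdiag d * Pᴴ)⁻¹ = P⁻¹ᴴ * rdiag (fun i => (d i)⁻¹) * P⁻¹ := by
  rw [Matrix.mul_inv_rev, Matrix.mul_inv_rev, rdiag_inv hd, Matrix.conjTranspose_nonsing_inv,
    Matrix.mul_assoc]

/-- The diagonal entries of `(Pᴴ P)⁻¹`. -/
noncomputable def invGram (P : Matrix n n ℂ) (i : n) : ℝ := ∑ k, ‖P⁻¹ i k‖ ^ 2

theorem invGram_pos {P : Matrix n n ℂ} (hP : IsUnit P) (i : n) : 0 < invGram P i := by
  unfold invGram
  have h0 : ∀ k ∈ Finset.univ, 0 ≤ ‖P⁻¹ i k‖ ^ 2 := fun k _ => by positivity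
  refine lt_of_le_of_ne (Finset.sum_nonneg h0) fun h => ?_
  have h1 := (Finset.sum_eq_zero_iff_of_nonneg h0).1 h.symm
  have h2 := Matrix.nonsing_inv_mul P ((Matrix.isUnit_iff_isUnit_det P).1 hP)
  have h3 := congrFun (congrFun h2 i) i
  rw [Matrix.mul_apply, Matrix.one_apply_eq, Finset.sum_eq_zero] at h3
  · exact zero_ne_one h3
  · intro k hk
    have : P⁻¹ i k = 0 := by simpa using h1 k hk
    rw [this, zero_mul]

theorem trace_inv_congr (P : Matrix n n ℂ) {d : n → ℝ} (hd : ∀ i, 0 < d i) :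
    ((P * rdiag d * Pᴴ)⁻¹).trace.re = ∑ i, invGram P i * (d i)⁻¹ := by
  rw [inv_congr P hd, Matrix.trace_mul_comm, ← Matrix.mul_assoc, Matrix.trace, Complex.re_sum]
  refine Finset.sum_congr rfl fun i _ => ?_
  rw [Matrix.diag_apply, rdiag, Matrix.mul_diagonal, Matrix.mul_apply, invGram, Complex.re_mul_ofReal]
  congr 1
  rw [Complex.re_sum]
  refine Finset.sum_congr rfl fun k _ => ?_
  rw [Matrix.conjTranspose_apply, Complex.star_def, Complex.mul_conj, Complex.ofReal_re,
    Complex.normSq_eq_norm_sq]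

theorem det_congr (P : Matrix n n ℂ) (d : n → ℝ) :
    (P * rdiag d * Pᴴ).det.re = ‖P.det‖ ^ 2 * ∏ i, d i := by
  rw [Matrix.det_mul, Matrix.det_mul, Matrix.det_conjTranspose, rdiag, Matrix.det_diagonal]
  have : P.det * (∏ i, (d i : ℂ)) * star P.det = ((‖P.det‖ ^ 2 * ∏ i, d i : ℝ) : ℂ) := by
    rw [mul_right_comm, Complex.star_def, Complex.mul_conj, Complex.normSq_eq_norm_sq]
    push_cast; rfl
  rw [this, Complex.ofReal_re]

theorem log_det_congr {P : Matrix n n ℂ} (hP : IsUnit P) {d : n → ℝ} (hd : ∀ i, 0 < d i) :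
    Real.log (P * rdiag d * Pᴴ).det.re = Real.log (‖P.det‖ ^ 2) + ∑ i, Real.log (d i) := by
  have hdet : P.det ≠ 0 := ((Matrix.isUnit_iff_isUnit_det P).1 hP).ne_zero
  rw [det_congr, Real.log_mul (by positivity) (Finset.prod_pos fun i _ => hd i).ne',
    Real.log_prod (fun i _ => (hd i).ne')]

end Coordinates

/-! ### Quadratic forms and updates in coordinates -/

section Data

variable {L Nst Np : ℕ}

/-- The data `y` in the coordinates given by the bases `P`, `Q`. -/
noncomputable def coords (P : Matrix (Fin Nst) (Fin Nst) ℂ) (Q : Matrix (Fin Np) (Fin Np) ℂ)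
    (y : Fin Nst × Fin Np → ℂ) : Matrix (Fin Np) (Fin Nst) ℂ :=
  Q⁻¹ * unvec y * P⁻¹ᵀ

theorem quadForm_eq_trace (y : Fin Nst × Fin Np → ℂ) (R : Matrix (Fin Nst) (Fin Nst) ℂ)
    (S : Matrix (Fin Np) (Fin Np) ℂ) :
    quadForm y R S = ((unvec y)ᴴ * (S⁻¹ * unvec y * R⁻¹ᵀ)).trace.re := by
  have hy : y = Matrix.vec (unvec y) := rfl
  unfold quadForm
  rw [Matrix.inv_kronecker]
  conv_lhs => rw [hy]
  rw [Matrix.kronecker_mulVec_vec, Matrix.star_vec_dotProduct_vec]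

theorem trace_weighted (W : Matrix (Fin Np) (Fin Nst) ℂ) (d : Fin Nst → ℝ) (e : Fin Np → ℝ) :
    (Wᴴ * (rdiag e * W * rdiag d)).trace.re = ∑ i, ∑ j, ‖W j i‖ ^ 2 * (d i * e j) := by
  rw [Matrix.trace, Complex.re_sum]
  refine Finset.sum_congr rfl fun i _ => ?_
  rw [Matrix.diag_apply, Matrix.mul_apply, Complex.re_sum]
  refine Finset.sum_congr rfl fun j _ => ?_
  rw [rdiag, rdiag, Matrix.mul_diagonal, Matrix.diagonal_mul, Matrix.conjTranspose_apply]
  have : star (W j i) * (↑(e j) * W j i * ↑(d i)) = ((‖W j i‖ ^ 2 * (d i * e j) : ℝ) : ℂ) := by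
    have h := Complex.mul_conj (W j i)
    rw [Complex.normSq_eq_norm_sq] at h
    push_cast at h ⊢
    rw [← h, Complex.star_def]; ring
  rw [this, Complex.ofReal_re]

theorem quadForm_congr (y : Fin Nst × Fin Np → ℂ) (P : Matrix (Fin Nst) (Fin Nst) ℂ)
    (Q : Matrix (Fin Np) (Fin Np) ℂ) {d : Fin Nst → ℝ} {e : Fin Np → ℝ} (hd : ∀ i, 0 < d i)
    (he : ∀ j, 0 < e j) :
    quadForm y (P * rdiag d * Pᴴ) (Q * rdiag e * Qᴴ) =
      ∑ i, ∑ j, ‖coords P Q y j i‖ ^ 2 * ((d i)⁻¹ * (e j)⁻¹) := by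
  rw [quadForm_eq_trace, ← trace_weighted, inv_congr P hd, inv_congr Q he]
  congr 1
  have hT : (P⁻¹ᴴ * rdiag (fun i => (d i)⁻¹) * P⁻¹)ᵀ =
      P⁻¹ᵀ * rdiag (fun i => (d i)⁻¹) * P⁻¹ᵀᴴ := by
    rw [Matrix.transpose_mul, Matrix.transpose_mul, rdiag, Matrix.diagonal_transpose,
      Matrix.mul_assoc]
    rfl
  rw [hT, coords, Matrix.conjTranspose_mul, Matrix.conjTranspose_mul]
  set D := rdiag fun i => (d i)⁻¹
  set E := rdiag fun j => (e j)⁻¹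
  calc ((unvec y)ᴴ * (Q⁻¹ᴴ * E * Q⁻¹ * unvec y * (P⁻¹ᵀ * D * P⁻¹ᵀᴴ))).trace
      = ((unvec y)ᴴ * (Q⁻¹ᴴ * E * Q⁻¹ * unvec y * (P⁻¹ᵀ * D)) * P⁻¹ᵀᴴ).trace := by
        simp only [Matrix.mul_assoc]
    _ = (P⁻¹ᵀᴴ * ((unvec y)ᴴ * (Q⁻¹ᴴ * E * Q⁻¹ * unvec y * (P⁻¹ᵀ * D)))).trace :=
        Matrix.trace_mul_comm _ _
    _ = _ := by simp only [Matrix.mul_assoc]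

theorem coords_ne_zero {P : Matrix (Fin Nst) (Fin Nst) ℂ} {Q : Matrix (Fin Np) (Fin Np) ℂ}
    (hP : IsUnit P) (hQ : IsUnit Q) {y : Fin Nst × Fin Np → ℂ} (hy : y ≠ 0) :
    coords P Q y ≠ 0 := by
  intro h
  have hPd := (Matrix.isUnit_iff_isUnit_det P).1 hP
  have hQd := (Matrix.isUnit_iff_isUnit_det Q).1 hQ
  have hPT : P⁻¹ᵀ * Pᵀ = 1 := by
    rw [← Matrix.transpose_mul, Matrix.mul_nonsing_inv _ hPd, Matrix.transpose_one]
  have h2 : unvec y = 0 := by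
    calc unvec y = Q * Q⁻¹ * unvec y * (P⁻¹ᵀ * Pᵀ) := by
          rw [hPT, Matrix.mul_nonsing_inv _ hQd, Matrix.one_mul, Matrix.mul_one]
      _ = Q * coords P Q y * Pᵀ := by rw [coords]; simp only [Matrix.mul_assoc]
      _ = 0 := by rw [h]; simp
  apply hy
  ext ⟨i, j⟩
  exact congrFun (congrFun h2 j) i

/-- The update of the first factor in coordinates in which the current factors are the identity. -/
theorem updateSt_coords (y : Fin L → Fin Nst × Fin Np → ℂ) (ρ : ℝ)
    {P : Matrix (Fin Nst) (Fin Nst) ℂ} (Q : Matrix (Fin Np) (Fin Np) ℂ) (i : Fin Nst) :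
    (P⁻¹ * updateSt y ρ (P * Pᴴ) (Q * Qᴴ) * P⁻¹ᴴ) i i =
      (((1 - ρ) * (Nst / L * ∑ l, (quadForm (y l) (P * Pᴴ) (Q * Qᴴ))⁻¹ *
        ∑ j, ‖coords P Q (y l) j i‖ ^ 2) + ρ * invGram P i : ℝ) : ℂ) := by
  have h1 : ∀ l, (P⁻¹ * ((unvec (y l))ᴴ * (Q * Qᴴ)⁻¹ * unvec (y l))ᵀ * P⁻¹ᴴ) i i =
      ((∑ j, ‖coords P Q (y l) j i‖ ^ 2 : ℝ) : ℂ) := by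
    intro l
    have e : P⁻¹ * ((unvec (y l))ᴴ * (Q * Qᴴ)⁻¹ * unvec (y l))ᵀ * P⁻¹ᴴ =
        ((coords P Q (y l))ᴴ * coords P Q (y l))ᵀ := by
      rw [coords, Matrix.mul_inv_rev, Matrix.conjTranspose_mul, Matrix.conjTranspose_mul,
        ← Matrix.conjTranspose_nonsing_inv]
      simp only [Matrix.transpose_mul, Matrix.transpose_transpose, Matrix.mul_assoc]
      rfl
    rw [e, Matrix.transpose_apply, Matrix.mul_apply]
    push_cast
    refine Finset.sum_congr rfl fun j _ => ?_
    have h := Complex.mul_conj (coords P Q (y l) j i)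
    rw [Complex.normSq_eq_norm_sq] at h
    push_cast at h
    rw [Matrix.conjTranspose_apply, ← h, Complex.star_def, mul_comm]
  have h2 : (P⁻¹ * P⁻¹ᴴ) i i = ((invGram P i : ℝ) : ℂ) := by
    rw [Matrix.mul_apply, invGram]
    push_cast
    refine Finset.sum_congr rfl fun j _ => ?_
    have h := Complex.mul_conj (P⁻¹ i j)
    rw [Complex.normSq_eq_norm_sq] at h
    push_cast at h
    rw [Matrix.conjTranspose_apply, ← h, Complex.star_def]
  unfold updateSt Cst
  simp only [Matrix.mul_add, Matrix.add_mul, Matrix.mul_smul, Matrix.smul_mul, Matrix.mul_one,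
    Matrix.mul_sum, Matrix.sum_mul, Matrix.add_apply, Matrix.smul_apply, Matrix.sum_apply, h1, h2,
    Complex.real_smul]
  push_cast
  rfl

end Data

/-! ### Normalized masses and the decrease of the cost -/

section Mass

variable {L Nst Np : ℕ}

/-- The squared norm of the data vector `y` in the coordinates given by `P`, `Q`. -/
noncomputable def totalMass (P : Matrix (Fin Nst) (Fin Nst) ℂ) (Q : Matrix (Fin Np) (Fin Np) ℂ)
    (y : Fin Nst × Fin Np → ℂ) : ℝ :=
  ∑ i, ∑ j, ‖coords P Q y j i‖ ^ 2

/-- The normalized squared moduli of the coordinates of `y`. -/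
noncomputable def mass (P : Matrix (Fin Nst) (Fin Nst) ℂ) (Q : Matrix (Fin Np) (Fin Np) ℂ)
    (y : Fin Nst × Fin Np → ℂ) (i : Fin Nst) (j : Fin Np) : ℝ :=
  ‖coords P Q y j i‖ ^ 2 / totalMass P Q y

/-- The mean of the normalized squared moduli over the samples. -/
noncomputable def avgMass (y : Fin L → Fin Nst × Fin Np → ℂ) (P : Matrix (Fin Nst) (Fin Nst) ℂ)
    (Q : Matrix (Fin Np) (Fin Np) ℂ) (i : Fin Nst) (j : Fin Np) : ℝ :=
  (∑ l, mass P Q (y l) i j) / L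

variable {P : Matrix (Fin Nst) (Fin Nst) ℂ} {Q : Matrix (Fin Np) (Fin Np) ℂ}

theorem totalMass_pos (hP : IsUnit P) (hQ : IsUnit Q) {y : Fin Nst × Fin Np → ℂ} (hy : y ≠ 0) :
    0 < totalMass P Q y := by
  unfold totalMass
  refine lt_of_le_of_ne (Finset.sum_nonneg fun i _ => Finset.sum_nonneg fun j _ => by positivity)
    fun h => coords_ne_zero hP hQ hy ?_
  have h1 := (Finset.sum_eq_zero_iff_of_nonneg
    (fun i _ => Finset.sum_nonneg fun j _ => by positivity)).1 h.symm
  ext j i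
  have h2 := (Finset.sum_eq_zero_iff_of_nonneg (fun j _ => by positivity)).1
    (h1 i (Finset.mem_univ i)) j (Finset.mem_univ j)
  simpa using h2

theorem totalMass_nonneg (y : Fin Nst × Fin Np → ℂ) : 0 ≤ totalMass P Q y :=
  Finset.sum_nonneg fun i _ => Finset.sum_nonneg fun j _ => by positivity

theorem mass_nonneg (y : Fin Nst × Fin Np → ℂ) (i : Fin Nst) (j : Fin Np) : 0 ≤ mass P Q y i j :=
  div_nonneg (by positivity) (totalMass_nonneg y)

theorem sum_mass (hP : IsUnit P) (hQ : IsUnit Q) {y : Fin Nst × Fin Np → ℂ} (hy : y ≠ 0) :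
    ∑ i, ∑ j, mass P Q y i j = 1 := by
  simp only [mass, ← Finset.sum_div]
  exact div_self (totalMass_pos hP hQ hy).ne'

theorem mass_pos (hP : IsUnit P) (hQ : IsUnit Q) {y : Fin Nst × Fin Np → ℂ} (hy : y ≠ 0)
    {i : Fin Nst} {j : Fin Np} (h : coords P Q y j i ≠ 0) : 0 < mass P Q y i j := by
  have h1 : 0 < ‖coords P Q y j i‖ := norm_pos_iff.2 h
  exact div_pos (by positivity) (totalMass_pos hP hQ hy)

theorem avgMass_nonneg (y : Fin L → Fin Nst × Fin Np → ℂ) (i : Fin Nst) (j : Fin Np) :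
    0 ≤ avgMass y P Q i j :=
  div_nonneg (Finset.sum_nonneg fun l _ => mass_nonneg (y l) i j) (Nat.cast_nonneg L)

theorem sum_avgMass (hL : 0 < L) (hP : IsUnit P) (hQ : IsUnit Q)
    {y : Fin L → Fin Nst × Fin Np → ℂ} (hy : ∀ l, y l ≠ 0) :
    ∑ i, ∑ j, avgMass y P Q i j = 1 := by
  simp only [avgMass, ← Finset.sum_div]
  rw [Finset.sum_congr rfl fun i _ => Finset.sum_comm, Finset.sum_comm,
    Finset.sum_congr rfl fun l _ => sum_mass hP hQ (hy l)]
  have : (L : ℝ) ≠ 0 := by exact_mod_cast hL.ne'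
  simp [this]

theorem sum_avgMass_mul (y : Fin L → Fin Nst × Fin Np → ℂ) (f : Fin Nst → Fin Np → ℝ) :
    ∑ i, ∑ j, avgMass y P Q i j * f i j =
      (∑ l, ∑ i, ∑ j, mass P Q (y l) i j * f i j) / L := by
  simp only [avgMass, div_mul_eq_mul_div, ← Finset.sum_div, Finset.sum_mul]
  congr 1
  rw [Finset.sum_congr rfl fun i _ => Finset.sum_comm, Finset.sum_comm]

theorem quadForm_self (y : Fin Nst × Fin Np → ℂ) :
    quadForm y (P * Pᴴ) (Q * Qᴴ) = totalMass P Q y := by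
  have h := quadForm_congr y P Q (d := fun _ => 1) (e := fun _ => 1) (fun _ => one_pos)
    fun _ => one_pos
  rw [rdiag_one, rdiag_one, Matrix.mul_one, Matrix.mul_one] at h
  rw [h, totalMass]
  simp

theorem quadForm_eq_mass (hP : IsUnit P) (hQ : IsUnit Q) {y : Fin Nst × Fin Np → ℂ} (hy : y ≠ 0)
    {d : Fin Nst → ℝ} {e : Fin Np → ℝ} (hd : ∀ i, 0 < d i) (he : ∀ j, 0 < e j) :
    quadForm y (P * rdiag d * Pᴴ) (Q * rdiag e * Qᴴ) =
      totalMass P Q y * ∑ i, ∑ j, mass P Q y i j * ((d i)⁻¹ * (e j)⁻¹) := by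
  rw [quadForm_congr y P Q hd he, Finset.mul_sum]
  refine Finset.sum_congr rfl fun i _ => ?_
  rw [Finset.mul_sum]
  refine Finset.sum_congr rfl fun j _ => ?_
  have := (totalMass_pos hP hQ hy).ne'
  unfold mass
  field_simp

theorem sum_mass_mul_pos (hP : IsUnit P) (hQ : IsUnit Q) {y : Fin Nst × Fin Np → ℂ} (hy : y ≠ 0)
    {f : Fin Nst → Fin Np → ℝ} (hf : ∀ i j, 0 < f i j) :
    0 < ∑ i, ∑ j, mass P Q y i j * f i j := by
  have h0 : ∀ p : Fin Nst × Fin Np, 0 ≤ mass P Q y p.1 p.2 * f p.1 p.2 := fun p =>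
    mul_nonneg (mass_nonneg y _ _) (hf _ _).le
  have h1 := sum_mass hP hQ hy
  rw [← Fintype.sum_prod_type' (f := fun i j => mass P Q y i j * f i j)]
  rw [← Fintype.sum_prod_type' (f := mass P Q y)] at h1
  refine lt_of_le_of_ne (Finset.sum_nonneg fun p _ => h0 p) fun h => ?_
  have h3 := (Finset.sum_eq_zero_iff_of_nonneg (fun p _ => h0 p)).1 h.symm
  have : ∑ p : Fin Nst × Fin Np, mass P Q y p.1 p.2 = 0 := Finset.sum_eq_zero fun p hp =>
    (mul_eq_zero.1 (h3 p hp)).resolve_right (hf _ _).ne'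
  linarith

/-- The coefficient `1 / (N (1 - ρ))` of `log det` in the cost divided by the number of entries. -/
noncomputable def weight (ρ : ℝ) (N : ℕ) : ℝ := 1 / (N * (1 - ρ))

theorem weight_pos {ρ : ℝ} (hρ : ρ < 1) {N : ℕ} (hN : 0 < N) : 0 < weight ρ N := by
  have : 0 < 1 - ρ := by linarith
  unfold weight; positivity

theorem weight_mul {ρ : ℝ} (hρ : ρ < 1) {N : ℕ} (hN : 0 < N) :
    weight ρ N * ((1 - ρ) * N) = 1 := by
  have h1 : 1 - ρ ≠ 0 := by linarith
  have h2 : (N : ℝ) ≠ 0 := by exact_mod_cast hN.ne'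
  unfold weight; field_simp

/-- Differences of the cost do not involve the determinants of P and Q or the total masses, and
dividing by Nst·Np turns the coefficients of the log-determinants into the weights. -/
theorem cost_congr_eq (hNst : 0 < Nst) (hNp : 0 < Np) (hP : IsUnit P) (hQ : IsUnit Q)
    {y : Fin L → Fin Nst × Fin Np → ℂ} (hy : ∀ l, y l ≠ 0) {ρst ρp : ℝ} (hρst : ρst < 1)
    (hρp : ρp < 1) {d : Fin Nst → ℝ} {e : Fin Np → ℝ} (hd : ∀ i, 0 < d i) (he : ∀ j, 0 < e j) :
    cost y ρst ρp (P * rdiag d * Pᴴ) (Q * rdiag e * Qᴴ) = cost y ρst ρp (P * Pᴴ) (Q * Qᴴ) +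
      Nst * Np * (weight ρst Nst * ∑ i, (Real.log (d i) + ρst * invGram P i * ((d i)⁻¹ - 1))
        + weight ρp Np * ∑ j, (Real.log (e j) + ρp * invGram Q j * ((e j)⁻¹ - 1))
        + (∑ l, Real.log (∑ i, ∑ j, mass P Q (y l) i j * ((d i)⁻¹ * (e j)⁻¹))) / L) := by
  have h1 := log_det_congr hP hd
  have h2 := log_det_congr hQ he
  have h3 := log_det_congr hP (d := fun _ => 1) (fun _ => one_pos)
  have h4 := log_det_congr hQ (d := fun _ => 1) (fun _ => one_pos)
  have t1 := trace_inv_congr P hd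
  have t2 := trace_inv_congr Q he
  have t3 := trace_inv_congr P (d := fun _ => 1) (fun _ => one_pos)
  have t4 := trace_inv_congr Q (d := fun _ => 1) (fun _ => one_pos)
  rw [rdiag_one, Matrix.mul_one] at h3 h4 t3 t4
  simp only [Real.log_one, Finset.sum_const_zero, add_zero, inv_one, mul_one] at h3 h4 t3 t4
  have hq : ∀ l, Real.log (quadForm (y l) (P * rdiag d * Pᴴ) (Q * rdiag e * Qᴴ)) =
      Real.log (quadForm (y l) (P * Pᴴ) (Q * Qᴴ)) +
        Real.log (∑ i, ∑ j, mass P Q (y l) i j * ((d i)⁻¹ * (e j)⁻¹)) := by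
    intro l
    rw [quadForm_eq_mass hP hQ (hy l) hd he, quadForm_self,
      Real.log_mul (totalMass_pos hP hQ (hy l)).ne' (sum_mass_mul_pos hP hQ (hy l)
        fun i j => mul_pos (inv_pos.2 (hd i)) (inv_pos.2 (he j))).ne']
  have n1 : 1 - ρst ≠ 0 := by linarith
  have n2 : 1 - ρp ≠ 0 := by linarith
  have n3 : (Nst : ℝ) ≠ 0 := by exact_mod_cast hNst.ne'
  have n4 : (Np : ℝ) ≠ 0 := by exact_mod_cast hNp.ne'
  unfold cost
  rw [h1, h2, h3, h4, t1, t2, t3, t4]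
  simp only [hq, Finset.sum_add_distrib, mul_sub, mul_one, Finset.sum_sub_distrib]
  have s1 : ∑ i, ρst * invGram P i * (d i)⁻¹ = ρst * ∑ i, invGram P i * (d i)⁻¹ := by
    rw [Finset.mul_sum]; exact Finset.sum_congr rfl fun i _ => by ring
  have s2 : ∑ j, ρp * invGram Q j * (e j)⁻¹ = ρp * ∑ j, invGram Q j * (e j)⁻¹ := by
    rw [Finset.mul_sum]; exact Finset.sum_congr rfl fun i _ => by ring
  rw [s1, s2, ← Finset.mul_sum, ← Finset.mul_sum]
  push_cast
  generalize ∑ i, invGram P i * (d i)⁻¹ = a1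
  generalize ∑ i, invGram Q i * (e i)⁻¹ = a2
  generalize ∑ i, invGram P i = a3
  generalize ∑ i, invGram Q i = a4
  generalize ∑ i, Real.log (d i) = a5
  generalize ∑ i, Real.log (e i) = a6
  have e1 : (Nst : ℝ) * Np * weight ρst Nst = Np / (1 - ρst) := by unfold weight; field_simp
  have e2 : (Nst : ℝ) * Np * weight ρp Np = Nst / (1 - ρp) := by unfold weight; field_simp
  have e3 : (Np : ℝ) * ρst / (1 - ρst) = Np / (1 - ρst) * ρst := by ring
  have e4 : (Nst : ℝ) * ρp / (1 - ρp) = Nst / (1 - ρp) * ρp := by ring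
  rw [e3, e4, mul_add (Nst * Np : ℝ), mul_add (Nst * Np : ℝ), ← mul_assoc, ← mul_assoc, e1, e2]
  ring

theorem mean_log_le_log_mean {ι : Type*} [Fintype ι] [Nonempty ι] {t : ι → ℝ}
    (ht : ∀ l, 0 < t l) :
    (∑ l, Real.log (t l)) / Fintype.card ι ≤ Real.log ((∑ l, t l) / Fintype.card ι) := by
  have hc : (0 : ℝ) < Fintype.card ι := by exact_mod_cast Fintype.card_pos
  set T := (∑ l, t l) / Fintype.card ι with hT
  have hT0 : 0 < T := div_pos (Finset.sum_pos (fun l _ => ht l) Finset.univ_nonempty) hc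
  have h1 : ∀ l, Real.log (t l) ≤ Real.log T + (t l / T - 1) := fun l => by
    have := Real.log_le_sub_one_of_pos (div_pos (ht l) hT0)
    rw [Real.log_div (ht l).ne' hT0.ne'] at this
    linarith
  rw [div_le_iff₀ hc]
  calc ∑ l, Real.log (t l) ≤ ∑ l, (Real.log T + (t l / T - 1)) := Finset.sum_le_sum fun l _ => h1 l
    _ = Real.log T * Fintype.card ι := by
      have : (∑ l, t l) / T = Fintype.card ι := by
        rw [hT]; rw [div_div_eq_mul_div, mul_div_cancel_left₀]
        exact (Finset.sum_pos (fun l _ => ht l) Finset.univ_nonempty).ne'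
      rw [Finset.sum_add_distrib, Finset.sum_sub_distrib, ← Finset.sum_div, this]
      simp [mul_comm]

/-- The update of the first factor satisfies this equation for its coordinates. -/
def IsStep (ρ : ℝ) (N : ℕ) (μ k d : ℝ) : Prop := d = 1 ∨ d = (1 - ρ) * N * μ + ρ * k

/-- The update equation replaces ρk by d - (1-ρ)Nμ, and `weight ρ N` is the inverse of (1-ρ)N. The
alternative d = 1, for a factor left unchanged, is trivial. -/
theorem IsStep.identity {ρ : ℝ} (hρ : ρ < 1) {N : ℕ} (hN : 0 < N) {μ k d : ℝ} (hd : 0 < d)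
    (h : IsStep ρ N μ k d) :
    weight ρ N * (Real.log d + ρ * k * (d⁻¹ - 1)) =
      - (weight ρ N * logGap d⁻¹) - μ * (d⁻¹ - 1) := by
  rcases h with h | h
  · rw [h]; simp [logGap_one]
  · have h2 : ρ * k = d - (1 - ρ) * N * μ := by linarith
    have h3 := weight_mul hρ hN
    unfold logGap
    rw [h2, Real.log_inv, inv_inv]
    have h4 : d * d⁻¹ = 1 := mul_inv_cancel₀ hd.ne'
    linear_combination (weight ρ N) * h4 - μ * (d⁻¹ - 1) * h3

/-- The determinant and penalty terms are evaluated exactly by `IsStep.identity`. The only loss is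
Jensen's inequality, which replaces the mean of the logarithms over the samples by the logarithm of
the mean. -/
theorem cost_step_le (hL : 0 < L) (hNst : 0 < Nst) (hNp : 0 < Np) (hP : IsUnit P) (hQ : IsUnit Q)
    {y : Fin L → Fin Nst × Fin Np → ℂ} (hy : ∀ l, y l ≠ 0) {ρst ρp : ℝ} (hρst : ρst < 1)
    (hρp : ρp < 1) {d : Fin Nst → ℝ} {e : Fin Np → ℝ} (hd : ∀ i, 0 < d i) (he : ∀ j, 0 < e j)
    (hds : ∀ i, IsStep ρst Nst (∑ j, avgMass y P Q i j) (invGram P i) (d i))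
    (hes : ∀ j, IsStep ρp Np (∑ i, avgMass y P Q i j) (invGram Q j) (e j)) :
    cost y ρst ρp (P * rdiag d * Pᴴ) (Q * rdiag e * Qᴴ) ≤ cost y ρst ρp (P * Pᴴ) (Q * Qᴴ) -
      Nst * Np * surrogateGap (weight ρst Nst) (weight ρp Np) (avgMass y P Q)
        (fun i => (d i)⁻¹) (fun j => (e j)⁻¹) := by
  rw [cost_congr_eq hNst hNp hP hQ hy hρst hρp hd he, sub_eq_add_neg, ← mul_neg]
  gcongr
  have h1 : weight ρst Nst * ∑ i, (Real.log (d i) + ρst * invGram P i * ((d i)⁻¹ - 1)) =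
      -(weight ρst Nst * ∑ i, logGap (d i)⁻¹) - (∑ i, ∑ j, avgMass y P Q i j * (d i)⁻¹ - 1) := by
    have e1 : ∑ i, ∑ j, avgMass y P Q i j * (d i)⁻¹ - 1 =
        ∑ i, (∑ j, avgMass y P Q i j) * ((d i)⁻¹ - 1) := by
      simp only [mul_sub, mul_one, Finset.sum_sub_distrib, sum_avgMass hL hP hQ hy, Finset.sum_mul]
    rw [e1, Finset.mul_sum, Finset.mul_sum, ← Finset.sum_neg_distrib, ← Finset.sum_sub_distrib]
    refine Finset.sum_congr rfl fun i _ => ?_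
    rw [(hds i).identity hρst hNst (hd i)]
  have h2 : weight ρp Np * ∑ j, (Real.log (e j) + ρp * invGram Q j * ((e j)⁻¹ - 1)) =
      -(weight ρp Np * ∑ j, logGap (e j)⁻¹) - (∑ i, ∑ j, avgMass y P Q i j * (e j)⁻¹ - 1) := by
    have e1 : ∑ i, ∑ j, avgMass y P Q i j * (e j)⁻¹ - 1 =
        ∑ j, (∑ i, avgMass y P Q i j) * ((e j)⁻¹ - 1) := by
      rw [Finset.sum_comm]
      simp only [mul_sub, mul_one, Finset.sum_sub_distrib, Finset.sum_mul]
      rw [Finset.sum_comm (f := fun j i => avgMass y P Q i j), sum_avgMass hL hP hQ hy]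
    rw [e1, Finset.mul_sum, Finset.mul_sum, ← Finset.sum_neg_distrib, ← Finset.sum_sub_distrib]
    refine Finset.sum_congr rfl fun j _ => ?_
    rw [(hes j).identity hρp hNp (he j)]
  have : Nonempty (Fin L) := ⟨⟨0, hL⟩⟩
  have h3 := mean_log_le_log_mean (ι := Fin L)
    (t := fun l => ∑ i, ∑ j, mass P Q (y l) i j * ((d i)⁻¹ * (e j)⁻¹)) fun l =>
    sum_mass_mul_pos hP hQ (hy l) fun i j => mul_pos (inv_pos.2 (hd i)) (inv_pos.2 (he j))
  rw [Fintype.card_fin, ← sum_avgMass_mul y fun i j => (d i)⁻¹ * (e j)⁻¹] at h3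
  unfold surrogateGap
  linarith

end Mass

/-! ### The recession inequality -/

section Flag

/-- A weighted count of subsets controls a sum of minima over these subsets. -/
theorem flag_inequality {n ι : Type*} [Fintype n] [DecidableEq n] [Fintype ι] [Nonempty ι]
    {W : ι → Finset n} {α β₁ β₂ : ℝ} (hβ₁ : 0 ≤ β₁) (hβ₂ : 0 ≤ β₂) (hβ : β₁ + β₂ = 1)
    (hW : ∀ r, (W r).Nonempty)
    (hc : ∀ T : Finset n, T.Nonempty → T ≠ Finset.univ →
      β₁ * ((Finset.univ.filter fun r => W r ⊆ T).card / Fintype.card ι) < α * T.card - β₂)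
    {v : ℝ} (a : n → ℝ) (hv : ∀ i, v ≤ a i) (hv' : ∃ i, a i = v) (g : ι → ℝ)
    (hg : ∀ r, ∀ i ∈ W r, g r ≤ a i) (M : ℝ) (hM : ∃ i, M ≤ a i) :
    β₁ * ((∑ r, g r) / Fintype.card ι) + β₂ * M + (α * Fintype.card n - 1) * v ≤ α * ∑ i, a i ∧
    ((∃ i, a i ≠ v) → β₁ * ((∑ r, g r) / Fintype.card ι) + β₂ * M
      + (α * Fintype.card n - 1) * v < α * ∑ i, a i) := by
  -- Induction on the number of entries above v. Lowering all of them by their smallest excess δ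
  -- changes the two sides by δ times the two sides of `hc` for T = {a > v}, up to the term in v.
  induction hk : (Finset.univ.filter fun i => v < a i).card using Nat.strong_induction_on
    generalizing a g M with
  | _ k ih =>
  set T := Finset.univ.filter fun i => v < a i with hT
  have hcard : (0 : ℝ) < Fintype.card ι := by exact_mod_cast Fintype.card_pos
  rcases T.eq_empty_or_nonempty with hTe | hTn
  · have hall : ∀ i, a i = v := fun i => by
      by_contra hne
      have : i ∈ T := Finset.mem_filter.2 ⟨Finset.mem_univ i, lt_of_le_of_ne (hv i) (Ne.symm hne)⟩
      simp [hTe] at this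
    refine ⟨?_, fun ⟨i, hi⟩ => absurd (hall i) hi⟩
    have h1 : (∑ r, g r) / Fintype.card ι ≤ v := by
      rw [div_le_iff₀ hcard]
      calc ∑ r, g r ≤ ∑ _r : ι, v := Finset.sum_le_sum fun r _ => by
            obtain ⟨i, hi⟩ := hW r
            rw [← hall i]; exact hg r i hi
        _ = _ := by simp [mul_comm]
    have h2 : M ≤ v := by obtain ⟨i, hi⟩ := hM; rwa [hall i] at hi
    have h3 : ∑ i, a i = Fintype.card n * v := by simp [hall]
    rw [h3]
    have e1 := mul_le_mul_of_nonneg_left h1 hβ₁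
    have e2 := mul_le_mul_of_nonneg_left h2 hβ₂
    have e3 : β₁ * v + β₂ * v = v := by rw [← add_mul, hβ, one_mul]
    linarith
  · obtain ⟨i₀, hi₀, hmin⟩ := Finset.exists_min_image T a hTn
    obtain ⟨i₁, hi₁⟩ := hv'
    have hTu : T ≠ Finset.univ := fun h => by
      have : i₁ ∈ T := h ▸ Finset.mem_univ i₁
      have := (Finset.mem_filter.1 this).2
      linarith
    set δ := a i₀ - v with hδ
    have hδ0 : 0 < δ := sub_pos.2 (Finset.mem_filter.1 hi₀).2
    set a' : n → ℝ := fun i => if i ∈ T then a i - δ else a i with ha'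
    set g' : ι → ℝ := fun r => if W r ⊆ T then g r - δ else g r with hg'
    have hnT : ∀ i, i ∉ T → a i = v := fun i hi => by
      by_contra hne
      exact hi (Finset.mem_filter.2 ⟨Finset.mem_univ i, lt_of_le_of_ne (hv i) (Ne.symm hne)⟩)
    have hva' : ∀ i, v ≤ a' i := fun i => by
      simp only [ha']
      split_ifs with h
      · have := hmin i h; linarith
      · exact hv i
    have hlt : (Finset.univ.filter fun i => v < a' i).card < k := by
      rw [← hk]
      apply Finset.card_lt_card
      rw [Finset.ssubset_iff_of_subset]
      · refine ⟨i₀, hi₀, fun h => ?_⟩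
        have := (Finset.mem_filter.1 h).2
        simp only [ha', if_pos hi₀] at this
        linarith
      · intro i hi
        by_contra hiT
        have := (Finset.mem_filter.1 hi).2
        simp only [ha', if_neg hiT] at this
        exact hiT (Finset.mem_filter.2 ⟨Finset.mem_univ i, this⟩)
    have hIH := (ih _ hlt a' hva' ⟨i₁, by
      have : i₁ ∉ T := fun h => by have := (Finset.mem_filter.1 h).2; linarith
      simp only [ha', if_neg this, hi₁]⟩ g' (by
        intro r i hi
        simp only [hg']
        split_ifs with h
        · simp only [ha', if_pos (h hi)]
          linarith [hg r i hi]
        -- A set not contained in T has an index where a = v, so g r ≤ v already and needs no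
        -- lowering.
        · obtain ⟨j, hj, hjT⟩ := Finset.not_subset.1 h
          have h1 := hg r j hj
          rw [hnT j hjT] at h1
          exact h1.trans (hva' i)) (M - δ) (by
        obtain ⟨i, hi⟩ := hM
        refine ⟨i, ?_⟩
        simp only [ha']
        split_ifs <;> linarith) rfl).1
    have hsa : ∑ i, a i = ∑ i, a' i + δ * T.card := by
      have : ∀ i, a i = a' i + if i ∈ T then δ else 0 := fun i => by
        simp only [ha']; split_ifs <;> ring
      rw [Finset.sum_congr rfl fun i _ => this i, Finset.sum_add_distrib,
        ← Finset.sum_filter, Finset.filter_mem_eq_inter, Finset.univ_inter, Finset.sum_const,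
        nsmul_eq_mul, mul_comm δ]
    have hsg : ∑ r, g r = ∑ r, g' r + δ * (Finset.univ.filter fun r => W r ⊆ T).card := by
      have : ∀ r, g r = g' r + if W r ⊆ T then δ else 0 := fun r => by
        simp only [hg']; split_ifs <;> ring
      rw [Finset.sum_congr rfl fun r _ => this r, Finset.sum_add_distrib,
        ← Finset.sum_filter, Finset.sum_const, nsmul_eq_mul, mul_comm δ]
    have hstep := mul_lt_mul_of_pos_left (hc T hTn hTu) hδ0
    have hfin : β₁ * ((∑ r, g r) / Fintype.card ι) + β₂ * M
        + (α * Fintype.card n - 1) * v < α * ∑ i, a i := by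
      rw [hsa, hsg, add_div, mul_add, mul_add]
      have e : β₁ * (δ * (Finset.univ.filter fun r => W r ⊆ T).card / Fintype.card ι) =
        δ * (β₁ * ((Finset.univ.filter fun r => W r ⊆ T).card / Fintype.card ι)) := by ring
      rw [e]
      linarith
    exact ⟨hfin.le, fun _ => hfin⟩

variable {L Nst Np : ℕ}

/-- The data with the roles of the two factors exchanged. -/
def swapData (y : Fin L → Fin Nst × Fin Np → ℂ) : Fin L → Fin Np × Fin Nst → ℂ :=
  fun l p => y l p.swap

theorem unvec_swapData (y : Fin L → Fin Nst × Fin Np → ℂ) (l : Fin L) :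
    unvec (swapData y l) = (unvec (y l))ᵀ := rfl

theorem coords_swapData (y : Fin L → Fin Nst × Fin Np → ℂ) (P : Matrix (Fin Nst) (Fin Nst) ℂ)
    (Q : Matrix (Fin Np) (Fin Np) ℂ) (l : Fin L) :
    coords Q P (swapData y l) = (coords P Q (y l))ᵀ := by
  simp only [coords, unvec_swapData, Matrix.transpose_mul, Matrix.transpose_transpose,
    Matrix.mul_assoc]

/-- The bound of the proportion of samples in subspaces, for spans of basis vectors. -/
theorem fraction_bound (hL : 0 < L) (hNst : 0 < Nst) (hNp : 0 < Np)
    {y : Fin L → Fin Nst × Fin Np → ℂ} {ρ β₁ β₂ : ℝ} (hρ : ρ < 1) (hβ₁ : 0 ≤ β₁)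
    (hc : ∀ S : Submodule ℂ (Fin Nst → ℂ), S ≠ ⊥ → S ≠ ⊤ →
      β₁ * ((L : ℝ) * (Nst * Np : ℕ)) * rowFraction y S <
        ((L : ℝ) * Np + (Np : ℝ) * ρ / (1 - ρ) * L) * Module.finrank ℂ S
          - β₂ * ((L : ℝ) * (Nst * Np : ℕ)))
    {P : Matrix (Fin Nst) (Fin Nst) ℂ} (hP : IsUnit P) (T : Finset (Fin Nst)) (hT : T.Nonempty)
    (hTu : T ≠ Finset.univ) :
    β₁ * ((Finset.univ.filter fun r : Fin Np × Fin L =>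
      (Finset.univ.filter fun i => (unvec (y r.2) * P⁻¹ᵀ) r.1 i ≠ 0) ⊆ T).card /
        Fintype.card (Fin Np × Fin L)) < weight ρ Nst * T.card - β₂ := by
  classical
  have hPd := (Matrix.isUnit_iff_isUnit_det P).1 hP
  -- A data row whose coordinates vanish outside T is a combination of the columns of P indexed by
  -- T, so the count is at most the one for their span.
  set S : Submodule ℂ (Fin Nst → ℂ) := Submodule.span ℂ (T.image fun i => P.col i : Finset _)
    with hS
  have hfr : Module.finrank ℂ S ≤ T.card :=
    (finrank_span_finset_le_card _).trans Finset.card_image_le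
  have hSbot : S ≠ ⊥ := by
    obtain ⟨i, hi⟩ := hT
    intro h
    have h1 : P.col i ∈ S := Submodule.subset_span (Finset.mem_coe.2 (Finset.mem_image_of_mem _ hi))
    rw [h, Submodule.mem_bot] at h1
    have h2 := Matrix.nonsing_inv_mul P hPd
    have h3 := congrFun (congrFun h2 i) i
    rw [Matrix.mul_apply, Matrix.one_apply_eq, Finset.sum_eq_zero] at h3
    · exact zero_ne_one h3
    · intro k _
      have : P k i = 0 := congrFun h1 k
      rw [this, mul_zero]
  have hTlt : T.card < Nst := by
    simpa using (Finset.card_lt_iff_ne_univ T).2 hTu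
  have hStop : S ≠ ⊤ := by
    intro h
    have h1 : Module.finrank ℂ S = Nst := by rw [h, finrank_top]; simp
    omega
  have hcS := hc S hSbot hStop
  have hmem : ∀ r : Fin Np × Fin L,
      (Finset.univ.filter fun i => (unvec (y r.2) * P⁻¹ᵀ) r.1 i ≠ 0) ⊆ T →
      (unvec (y r.2)).row r.1 ∈ S := by
    intro r hr
    have h1 : (unvec (y r.2)).row r.1 = ∑ i, ((unvec (y r.2) * P⁻¹ᵀ) r.1 i) • P.col i := by
      have hPT : P⁻¹ᵀ * Pᵀ = 1 := by
        rw [← Matrix.transpose_mul, Matrix.mul_nonsing_inv _ hPd, Matrix.transpose_one]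
      have h2 : unvec (y r.2) = unvec (y r.2) * P⁻¹ᵀ * Pᵀ := by
        rw [Matrix.mul_assoc, hPT, Matrix.mul_one]
      ext k
      rw [Finset.sum_apply]
      conv_lhs => rw [h2]
      rfl
    rw [h1]
    refine Submodule.sum_mem _ fun i _ => ?_
    by_cases hi : (unvec (y r.2) * P⁻¹ᵀ) r.1 i = 0
    · rw [hi, zero_smul]; exact S.zero_mem
    · refine S.smul_mem _ (Submodule.subset_span (Finset.mem_coe.2 (Finset.mem_image_of_mem _ ?_)))
      exact hr (Finset.mem_filter.2 ⟨Finset.mem_univ i, hi⟩)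
  have hcount : (((Finset.univ.filter fun r : Fin Np × Fin L =>
      (Finset.univ.filter fun i => (unvec (y r.2) * P⁻¹ᵀ) r.1 i ≠ 0) ⊆ T).card : ℕ) : ℝ) /
        Fintype.card (Fin Np × Fin L) ≤ rowFraction y S := by
    unfold rowFraction
    have h1 : (Finset.univ.filter fun r : Fin Np × Fin L =>
      (Finset.univ.filter fun i => (unvec (y r.2) * P⁻¹ᵀ) r.1 i ≠ 0) ⊆ T).card ≤
      Nat.card {p : Fin Np × Fin L // (unvec (y p.2)).row p.1 ∈ S} := by
      rw [Nat.card_eq_fintype_card, Fintype.card_subtype]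
      exact Finset.card_le_card fun r hr => Finset.mem_filter.2
        ⟨Finset.mem_univ r, hmem r (Finset.mem_filter.1 hr).2⟩
    have h2 : (Fintype.card (Fin Np × Fin L) : ℝ) = L * Np := by
      simp [mul_comm]
    rw [h2]
    gcongr
  have hLr : (0 : ℝ) < L := by exact_mod_cast hL
  have hNr : (0 : ℝ) < Nst := by exact_mod_cast hNst
  have hMr : (0 : ℝ) < Np := by exact_mod_cast hNp
  have h1ρ : 0 < 1 - ρ := by linarith
  have hw : ((L : ℝ) * Np + (Np : ℝ) * ρ / (1 - ρ) * L) =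
      (L * (Nst * Np)) * weight ρ Nst := by
    unfold weight; field_simp; ring
  push_cast at hcS
  rw [hw] at hcS
  have h3 : β₁ * rowFraction y S < weight ρ Nst * Module.finrank ℂ S - β₂ := by
    have hpos : 0 < (L : ℝ) * (Nst * Np) := by positivity
    have : (L : ℝ) * (Nst * Np) * (β₁ * rowFraction y S) <
        L * (Nst * Np) * (weight ρ Nst * Module.finrank ℂ S - β₂) := by linarith
    exact lt_of_mul_lt_mul_left this hpos.le
  have h4 : weight ρ Nst * Module.finrank ℂ S ≤ weight ρ Nst * T.card :=
    mul_le_mul_of_nonneg_left (by exact_mod_cast hfr) (weight_pos hρ hNst).le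
  have h5 := mul_le_mul_of_nonneg_left hcount hβ₁
  linarith

theorem ExistenceCondition.swap {y : Fin L → Fin Nst × Fin Np → ℂ} {ρst ρp : ℝ}
    (h : ExistenceCondition y ρst ρp) : ExistenceCondition (swapData y) ρp ρst := by
  obtain ⟨h1, β₁, β₂, hβ₁, hβ₂, hβ, h2, h3⟩ := h
  refine ⟨fun l => ⟨(h1 l).2, (h1 l).1⟩, β₂, β₁, hβ₂, hβ₁, by linarith, ?_, ?_⟩
  · rw [mul_comm Np]; exact h3
  · rw [mul_comm Np]; exact h2

theorem ExistenceCondition.ne_zero {y : Fin L → Fin Nst × Fin Np → ℂ} {ρst ρp : ℝ} (hNp : 0 < Np)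
    (h : ExistenceCondition y ρst ρp) (l : Fin L) : y l ≠ 0 := by
  intro h0
  apply (h.1 l).1 ⟨0, hNp⟩
  ext i
  exact congrFun h0 (i, ⟨0, hNp⟩)

theorem support_row_nonempty {y : Fin L → Fin Nst × Fin Np → ℂ} {ρst ρp : ℝ}
    (h : ExistenceCondition y ρst ρp) {P : Matrix (Fin Nst) (Fin Nst) ℂ} (hP : IsUnit P)
    (r : Fin Np × Fin L) :
    (Finset.univ.filter fun i => (unvec (y r.2) * P⁻¹ᵀ) r.1 i ≠ 0).Nonempty := by
  by_contra hne
  rw [Finset.not_nonempty_iff_eq_empty, Finset.filter_eq_empty_iff] at hne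
  apply (h.1 r.2).1 r.1
  have hPT : P⁻¹ᵀ * Pᵀ = 1 := by
    rw [← Matrix.transpose_mul, Matrix.mul_nonsing_inv _ ((Matrix.isUnit_iff_isUnit_det P).1 hP),
      Matrix.transpose_one]
  have h2 : unvec (y r.2) = unvec (y r.2) * P⁻¹ᵀ * Pᵀ := by
    rw [Matrix.mul_assoc, hPT, Matrix.mul_one]
  ext k
  change unvec (y r.2) r.1 k = 0
  rw [h2, Matrix.mul_apply]
  exact Finset.sum_eq_zero fun i _ => by
    have := hne (Finset.mem_univ i)
    rw [not_not] at this
    rw [this, zero_mul]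

theorem exists_coords_ne_zero {y : Fin Nst × Fin Np → ℂ} {P : Matrix (Fin Nst) (Fin Nst) ℂ}
    {Q : Matrix (Fin Np) (Fin Np) ℂ} (hQ : IsUnit Q) {j : Fin Np} {i : Fin Nst}
    (h : (unvec y * P⁻¹ᵀ) j i ≠ 0) : ∃ j', coords P Q y j' i ≠ 0 := by
  by_contra hcon
  push Not at hcon
  apply h
  have h2 : unvec y * P⁻¹ᵀ = Q * coords P Q y := by
    rw [coords, Matrix.mul_assoc Q⁻¹, ← Matrix.mul_assoc,
      Matrix.mul_nonsing_inv _ ((Matrix.isUnit_iff_isUnit_det Q).1 hQ), Matrix.one_mul]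
  rw [h2, Matrix.mul_apply]
  exact Finset.sum_eq_zero fun k _ => by rw [hcon k, mul_zero]

/-- The recession inequality: linear growth of the logarithmic determinants dominates the decay of
the quadratic forms. -/
theorem recession_inequality (hL : 0 < L) (hNst : 0 < Nst) (hNp : 0 < Np)
    {y : Fin L → Fin Nst × Fin Np → ℂ} {ρst ρp : ℝ} (hρst : ρst < 1) (hρp : ρp < 1)
    (h : ExistenceCondition y ρst ρp) {P : Matrix (Fin Nst) (Fin Nst) ℂ}
    {Q : Matrix (Fin Np) (Fin Np) ℂ} (hP : IsUnit P) (hQ : IsUnit Q) {a : Fin Nst → ℝ}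
    {b : Fin Np → ℝ} {u v : ℝ} (hu : ∀ i, u ≤ a i) (hu' : ∃ i, a i = u) (hv : ∀ j, v ≤ b j)
    (hv' : ∃ j, b j = v) {m : Fin L → ℝ}
    (hm : ∀ l i j, coords P Q (y l) j i ≠ 0 → m l ≤ a i + b j) :
    (∑ l, m l) / L + (weight ρst Nst * Nst - 1) * u + (weight ρp Np * Np - 1) * v ≤
      weight ρst Nst * ∑ i, a i + weight ρp Np * ∑ j, b j ∧
    ((∃ i, a i ≠ u) ∨ (∃ j, b j ≠ v) →
      (∑ l, m l) / L + (weight ρst Nst * Nst - 1) * u + (weight ρp Np * Np - 1) * v <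
      weight ρst Nst * ∑ i, a i + weight ρp Np * ∑ j, b j) := by
  have : Nonempty (Fin L) := ⟨⟨0, hL⟩⟩
  have : Nonempty (Fin Nst) := ⟨⟨0, hNst⟩⟩
  have : Nonempty (Fin Np) := ⟨⟨0, hNp⟩⟩
  obtain ⟨ia, hia⟩ := Finite.exists_max a
  obtain ⟨jb, hjb⟩ := Finite.exists_max b
  have hsw := h.swap
  obtain ⟨h1, β₁, β₂, hβ₁, hβ₂, hβ, h2, h3⟩ := id h
  have hLr : (0 : ℝ) < L := by exact_mod_cast hL
  have hNr : (0 : ℝ) < Nst := by exact_mod_cast hNst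
  have hMr : (0 : ℝ) < Np := by exact_mod_cast hNp
  -- The flag inequality is used once for each factor, on m minus the largest exponent of the other
  -- factor. These maxima return as the terms M with the same weights β₁, β₂ and cancel in the sum.
  have f1 := flag_inequality hβ₁ hβ₂ hβ (fun r => support_row_nonempty h hP r)
    (fraction_bound hL hNst hNp hρst hβ₁ h2 hP) a hu hu' (fun r => m r.2 - b jb) (by
      intro r i hi
      obtain ⟨j', hj'⟩ := exists_coords_ne_zero (Q := Q) hQ (Finset.mem_filter.1 hi).2
      have := hm r.2 i j' hj'
      have := hjb j'
      linarith) (a ia) ⟨ia, le_rfl⟩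
  have f2 := flag_inequality hβ₂ hβ₁ (by linarith) (fun r => support_row_nonempty hsw hQ r)
    (fraction_bound (y := swapData y) hL hNp hNst hρp hβ₂ (by rw [mul_comm Np]; exact h3) hQ) b
    hv hv' (fun r => m r.2 - a ia) (by
      intro r j hj
      obtain ⟨i', hi'⟩ := exists_coords_ne_zero (Q := P) hP (Finset.mem_filter.1 hj).2
      rw [coords_swapData] at hi'
      have := hm r.2 i' j hi'
      have := hia i'
      linarith) (b jb) ⟨jb, le_rfl⟩
  have s1 : (∑ r : Fin Np × Fin L, (m r.2 - b jb)) / Fintype.card (Fin Np × Fin L) =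
      (∑ l, m l) / L - b jb := by
    rw [Fintype.sum_prod_type]
    simp only [Finset.sum_sub_distrib, Finset.sum_const, Finset.card_univ, Fintype.card_fin,
      Fintype.card_prod, nsmul_eq_mul, Nat.cast_mul]
    field_simp
  have s2 : (∑ r : Fin Nst × Fin L, (m r.2 - a ia)) / Fintype.card (Fin Nst × Fin L) =
      (∑ l, m l) / L - a ia := by
    rw [Fintype.sum_prod_type]
    simp only [Finset.sum_sub_distrib, Finset.sum_const, Finset.card_univ, Fintype.card_fin,
      Fintype.card_prod, nsmul_eq_mul, Nat.cast_mul]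
    field_simp
  rw [s1, Fintype.card_fin] at f1
  rw [s2, Fintype.card_fin] at f2
  have e1 : (∑ l, m l) / L = β₁ * ((∑ l, m l) / L) + β₂ * ((∑ l, m l) / L) := by
    rw [← add_mul, hβ, one_mul]
  refine ⟨by linarith [f1.1, f2.1], ?_⟩
  rintro (hx | hx)
  · linarith [f1.2 hx, f2.1]
  · linarith [f1.1, f2.2 hx]

theorem weight_mul_card_sub_one {ρ : ℝ} (hρ : ρ < 1) {N : ℕ} (hN : 0 < N) :
    weight ρ N * N - 1 = ρ / (1 - ρ) := by
  have h1 : 1 - ρ ≠ 0 := by linarith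
  have h2 : (N : ℝ) ≠ 0 := by exact_mod_cast hN.ne'
  unfold weight; field_simp; ring

/-- For singletons `fraction_bound` makes the two weights exceed β₂ and β₁. A factor of size 1 has
no proper nonzero subspaces, but its weight is 1/(1-ρ) ≥ 1. -/
theorem one_lt_weight_add_weight (hL : 0 < L) (hNst : 0 < Nst) (hNp : 0 < Np)
    {y : Fin L → Fin Nst × Fin Np → ℂ} {ρst ρp : ℝ} (hρst : ρst ∈ Set.Ico (0 : ℝ) 1)
    (hρp : ρp ∈ Set.Ico (0 : ℝ) 1) (h : ExistenceCondition y ρst ρp) :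
    1 < weight ρst Nst + weight ρp Np := by
  have key : ∀ {N : ℕ} {ρ : ℝ}, ρ ∈ Set.Ico (0 : ℝ) 1 → N = 1 → 1 ≤ weight ρ N := by
    intro N ρ hρ hN
    have h1 := weight_mul_card_sub_one hρ.2 (N := N) (by omega)
    have h2 : 0 ≤ ρ / (1 - ρ) := div_nonneg hρ.1 (by linarith [hρ.2])
    rw [hN] at h1 ⊢
    push_cast at h1
    linarith
  rcases Nat.lt_or_ge 1 Nst with hn | hn
  · rcases Nat.lt_or_ge 1 Np with hp | hp
    · obtain ⟨h1, β₁, β₂, hβ₁, hβ₂, hβ, h2, h3⟩ := h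
      have : Nontrivial (Fin Nst) := Fin.nontrivial_iff_two_le.2 hn
      have : Nontrivial (Fin Np) := Fin.nontrivial_iff_two_le.2 hp
      have g1 := fraction_bound hL hNst hNp hρst.2 hβ₁ h2 isUnit_one {⟨0, hNst⟩}
        (Finset.singleton_nonempty _) (Finset.singleton_ne_univ _)
      have g2 := fraction_bound (y := swapData y) hL hNp hNst hρp.2 hβ₂
        (by rw [mul_comm Np]; exact h3) isUnit_one {⟨0, hNp⟩} (Finset.singleton_nonempty _)
        (Finset.singleton_ne_univ _)
      rw [Finset.card_singleton, Nat.cast_one, mul_one] at g1 g2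
      have g3 := lt_of_le_of_lt (mul_nonneg hβ₁ (by positivity)) g1
      have g4 := lt_of_le_of_lt (mul_nonneg hβ₂ (by positivity)) g2
      linarith
    · have := key hρp (by omega : Np = 1)
      linarith [weight_pos hρst.2 hNst]
  · have := key hρst (by omega : Nst = 1)
    linarith [weight_pos hρp.2 hNp]

end Flag

/-! ### Positive definiteness of the updates and the decrease per iteration -/

section Step

/-- Stein's loss `tr (A⁻¹ B) - log det (A⁻¹ B) - n`. -/
noncomputable def steinLoss {n : Type*} [Fintype n] [DecidableEq n] (A B : Matrix n n ℂ) : ℝ :=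
  (A⁻¹ * B).trace.re - Fintype.card n - (Real.log B.det.re - Real.log A.det.re)

theorem steinLoss_congr {n : Type*} [Fintype n] [DecidableEq n] {P : Matrix n n ℂ} (hP : IsUnit P)
    {d : n → ℝ} (hd : ∀ i, 0 < d i) :
    steinLoss (P * Pᴴ) (P * rdiag d * Pᴴ) = ∑ i, logGap (d i)⁻¹ := by
  have hPd := (Matrix.isUnit_iff_isUnit_det P).1 hP
  have h1 := log_det_congr hP hd
  have h2 := log_det_congr hP (d := fun _ => 1) (fun _ => one_pos)
  rw [rdiag_one, Matrix.mul_one] at h2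
  have h3 : ((P * Pᴴ)⁻¹ * (P * rdiag d * Pᴴ)).trace = ((∑ i, d i : ℝ) : ℂ) := by
    have hPH : Pᴴ * P⁻¹ᴴ = 1 := by
      rw [← Matrix.conjTranspose_mul, Matrix.nonsing_inv_mul _ hPd, Matrix.conjTranspose_one]
    calc ((P * Pᴴ)⁻¹ * (P * rdiag d * Pᴴ)).trace
        = (P⁻¹ᴴ * (P⁻¹ * P) * rdiag d * Pᴴ).trace := by
          rw [Matrix.mul_inv_rev, Matrix.conjTranspose_nonsing_inv]; simp only [Matrix.mul_assoc]
      _ = (Pᴴ * (P⁻¹ᴴ * rdiag d)).trace := by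
          rw [Matrix.nonsing_inv_mul _ hPd, Matrix.mul_one, Matrix.trace_mul_comm]
      _ = (rdiag d).trace := by rw [← Matrix.mul_assoc, hPH, Matrix.one_mul]
      _ = _ := by rw [rdiag, Matrix.trace_diagonal]; push_cast; rfl
  unfold steinLoss logGap
  rw [h1, h2, h3, Complex.ofReal_re]
  simp only [Real.log_inv, inv_inv, Real.log_one, Finset.sum_const_zero, Finset.sum_sub_distrib,
    Finset.sum_add_distrib, Finset.sum_neg_distrib, Finset.sum_const, Finset.card_univ,
    nsmul_eq_mul, mul_one]
  ring

variable {L Nst Np : ℕ}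

theorem quadForm_swapData (y : Fin L → Fin Nst × Fin Np → ℂ) (l : Fin L)
    (R : Matrix (Fin Nst) (Fin Nst) ℂ) (S : Matrix (Fin Np) (Fin Np) ℂ) :
    quadForm (swapData y l) S R = quadForm (y l) R S := by
  rw [quadForm_eq_trace, quadForm_eq_trace, unvec_swapData]
  congr 1
  have : (unvec (y l))ᵀᴴ * (R⁻¹ * (unvec (y l))ᵀ * S⁻¹ᵀ) =
      (S⁻¹ * unvec (y l) * R⁻¹ᵀ * (unvec (y l))ᴴ)ᵀ := by
    simp only [Matrix.transpose_mul, Matrix.transpose_transpose, Matrix.mul_assoc]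
    rfl
  rw [this, Matrix.trace_transpose, Matrix.trace_mul_comm]

theorem cost_swapData (y : Fin L → Fin Nst × Fin Np → ℂ) (ρst ρp : ℝ)
    (R : Matrix (Fin Nst) (Fin Nst) ℂ) (S : Matrix (Fin Np) (Fin Np) ℂ) :
    cost (swapData y) ρp ρst S R = cost y ρst ρp R S := by
  unfold cost
  simp only [quadForm_swapData]
  rw [mul_comm Np]
  ring

/-- Transposing the data exchanges the two factors, so every statement about the second update
follows from the one about the first. -/
theorem updateP_eq_updateSt (y : Fin L → Fin Nst × Fin Np → ℂ) (ρ : ℝ)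
    (R : Matrix (Fin Nst) (Fin Nst) ℂ) (S : Matrix (Fin Np) (Fin Np) ℂ) :
    updateP y ρ R S = updateSt (swapData y) ρ S R := by
  unfold updateP updateSt Cp Cst
  simp only [quadForm_swapData, unvec_swapData]
  have : ∀ l, unvec (y l) * R⁻¹ᵀ * (unvec (y l))ᴴ = ((unvec (y l))ᵀᴴ * R⁻¹ * (unvec (y l))ᵀ)ᵀ := by
    intro l
    simp only [Matrix.transpose_mul, Matrix.transpose_transpose, Matrix.mul_assoc]
    rfl
  simp only [this]

theorem avgMass_swapData (y : Fin L → Fin Nst × Fin Np → ℂ) (P : Matrix (Fin Nst) (Fin Nst) ℂ)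
    (Q : Matrix (Fin Np) (Fin Np) ℂ) (i : Fin Nst) (j : Fin Np) :
    avgMass (swapData y) Q P j i = avgMass y P Q i j := by
  unfold avgMass mass totalMass
  simp only [coords_swapData, Matrix.transpose_apply]
  congr 1
  refine Finset.sum_congr rfl fun l _ => ?_
  rw [Finset.sum_comm]

theorem updateSt_isHermitian (y : Fin L → Fin Nst × Fin Np → ℂ) (ρ : ℝ)
    (R : Matrix (Fin Nst) (Fin Nst) ℂ) {S : Matrix (Fin Np) (Fin Np) ℂ} (hS : S.IsHermitian) :
    (updateSt y ρ R S).IsHermitian := by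
  have hr : ∀ (c : ℝ) (M : Matrix (Fin Nst) (Fin Nst) ℂ), M.IsHermitian → (c • M).IsHermitian := by
    intro c M hM
    unfold Matrix.IsHermitian
    rw [Matrix.conjTranspose_smul, hM.eq, star_trivial]
  unfold updateSt Cst
  refine (hr _ _ (hr _ _ ?_)).add (hr _ _ Matrix.isHermitian_one)
  have hsum : ∀ s : Finset (Fin L), (∑ l ∈ s, (quadForm (y l) R S)⁻¹ •
      ((unvec (y l))ᴴ * S⁻¹ * unvec (y l))ᵀ).IsHermitian := by
    intro s
    induction s using Finset.induction_on with
    | empty => simp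
    | insert a s ha ih =>
      rw [Finset.sum_insert ha]
      refine (hr _ _ ?_).add ih
      exact (Matrix.isHermitian_conjTranspose_mul_mul _ hS.inv).transpose
  exact hsum _

theorem update_diag_eq {y : Fin L → Fin Nst × Fin Np → ℂ} {ρ : ℝ}
    {P : Matrix (Fin Nst) (Fin Nst) ℂ} {Q : Matrix (Fin Np) (Fin Np) ℂ} (hP : IsUnit P)
    {d : Fin Nst → ℝ} (h : updateSt y ρ (P * Pᴴ) (Q * Qᴴ) = P * rdiag d * Pᴴ) (i : Fin Nst) :
    d i = (1 - ρ) * Nst * (∑ j, avgMass y P Q i j) + ρ * invGram P i := by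
  have hPd := (Matrix.isUnit_iff_isUnit_det P).1 hP
  have h1 := updateSt_coords y ρ (P := P) Q i
  have hPH : Pᴴ * P⁻¹ᴴ = 1 := by
    rw [← Matrix.conjTranspose_mul, Matrix.nonsing_inv_mul _ hPd, Matrix.conjTranspose_one]
  have h2 : P⁻¹ * (P * rdiag d * Pᴴ) * P⁻¹ᴴ = rdiag d := by
    calc P⁻¹ * (P * rdiag d * Pᴴ) * P⁻¹ᴴ = (P⁻¹ * P) * rdiag d * (Pᴴ * P⁻¹ᴴ) := by
          simp only [Matrix.mul_assoc]
      _ = _ := by rw [hPH, Matrix.nonsing_inv_mul _ hPd, Matrix.one_mul, Matrix.mul_one]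
  rw [h, h2, rdiag, Matrix.diagonal_apply_eq] at h1
  have h3 := Complex.ofReal_injective h1
  rw [h3]
  congr 1
  rw [mul_assoc]
  congr 1
  simp only [avgMass, ← Finset.sum_div, quadForm_self]
  rw [Finset.sum_comm, div_mul_eq_mul_div, mul_div_assoc]
  congr 2
  refine Finset.sum_congr rfl fun l _ => ?_
  simp only [mass, ← Finset.sum_div]
  rw [inv_mul_eq_div]

/-- If row i carried no mass, all data rows would lie in the span of the other basis vectors, and
the existence condition for this hyperplane would read β₁ < 1 - w - β₂, with w the weight at ρ = 0.
-/
theorem avgMass_row_pos (hL : 0 < L) (hNst : 0 < Nst) (hNp : 0 < Np)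
    {y : Fin L → Fin Nst × Fin Np → ℂ} {ρp : ℝ}
    (h : ExistenceCondition y 0 ρp) {P : Matrix (Fin Nst) (Fin Nst) ℂ}
    {Q : Matrix (Fin Np) (Fin Np) ℂ} (hP : IsUnit P) (hQ : IsUnit Q) (i : Fin Nst) :
    0 < ∑ j, avgMass y P Q i j := by
  have hLr : (0 : ℝ) < L := by exact_mod_cast hL
  by_contra hcon
  have h0 : ∑ j, avgMass y P Q i j = 0 := le_antisymm (not_lt.1 hcon)
    (Finset.sum_nonneg fun j _ => avgMass_nonneg y i j)
  have hzero : ∀ l j, coords P Q (y l) j i = 0 := by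
    intro l j
    by_contra hne
    have h1 := (Finset.sum_eq_zero_iff_of_nonneg fun j _ => avgMass_nonneg y i j).1 h0 j
      (Finset.mem_univ j)
    have h2 := mass_pos hP hQ (h.ne_zero hNp l) hne
    have h3 : 0 < avgMass y P Q i j := by
      unfold avgMass
      refine div_pos (Finset.sum_pos' (fun l _ => mass_nonneg (y l) i j) ?_) hLr
      exact ⟨l, Finset.mem_univ l, h2⟩
    linarith
  obtain ⟨h1, β₁, β₂, hβ₁, hβ₂, hβ, h2, h3⟩ := id h
  have hsub : ∀ r : Fin Np × Fin L,
      (Finset.univ.filter fun i => (unvec (y r.2) * P⁻¹ᵀ) r.1 i ≠ 0) ⊆ Finset.univ.erase i := by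
    intro r k hk
    refine Finset.mem_erase.2 ⟨fun hki => ?_, Finset.mem_univ k⟩
    obtain ⟨j', hj'⟩ := exists_coords_ne_zero (Q := Q) hQ (Finset.mem_filter.1 hk).2
    rw [hki] at hj'
    exact hj' (hzero r.2 j')
  have hne : (Finset.univ.erase i : Finset (Fin Nst)).Nonempty :=
    (support_row_nonempty h hP (⟨0, hNp⟩, ⟨0, hL⟩)).mono (hsub _)
  have hfb := fraction_bound hL hNst hNp zero_lt_one hβ₁ h2 hP (Finset.univ.erase i) hne
    (fun h => Finset.notMem_erase i Finset.univ (by rw [h]; exact Finset.mem_univ i))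
  rw [Finset.filter_true_of_mem fun r _ => hsub r, Finset.card_univ, div_self] at hfb
  · have hw := weight_mul_card_sub_one (ρ := 0) zero_lt_one hNst
    rw [Finset.card_erase_of_mem (Finset.mem_univ i), Finset.card_univ, Fintype.card_fin,
      Nat.cast_sub (by omega)] at hfb
    have := weight_pos (ρ := 0) zero_lt_one hNst
    push_cast at hfb
    rw [zero_div] at hw
    linarith
  · have : Nonempty (Fin L) := ⟨⟨0, hL⟩⟩
    have : Nonempty (Fin Np) := ⟨⟨0, hNp⟩⟩
    exact_mod_cast Fintype.card_ne_zero

/-- Coordinates that diagonalize an update. -/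
theorem exists_update_coords (hL : 0 < L) (hNst : 0 < Nst) (hNp : 0 < Np)
    {y : Fin L → Fin Nst × Fin Np → ℂ} {ρst ρp : ℝ} (hρst : ρst ∈ Set.Ico (0 : ℝ) 1)
    (h : ExistenceCondition y ρst ρp)
    {R : Matrix (Fin Nst) (Fin Nst) ℂ} {S : Matrix (Fin Np) (Fin Np) ℂ} (hR : R.PosDef)
    (hS : S.PosDef) :
    ∃ P : Matrix (Fin Nst) (Fin Nst) ℂ, IsUnit P ∧ ∃ d : Fin Nst → ℝ, (∀ i, 0 < d i) ∧
      R = P * Pᴴ ∧ updateSt y ρst R S = P * rdiag d * Pᴴ ∧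
      ∀ Q : Matrix (Fin Np) (Fin Np) ℂ, S = Q * Qᴴ → ∀ i,
        d i = (1 - ρst) * Nst * (∑ j, avgMass y P Q i j) + ρst * invGram P i := by
  obtain ⟨P, hP, d, hRP, hd⟩ := exists_simultaneous_diagonalization hR
    (updateSt_isHermitian y ρst R hS.1)
  have key : ∀ Q : Matrix (Fin Np) (Fin Np) ℂ, S = Q * Qᴴ → ∀ i,
        d i = (1 - ρst) * Nst * (∑ j, avgMass y P Q i j) + ρst * invGram P i := by
    intro Q hQ i
    apply update_diag_eq hP
    rw [← hRP, ← hQ, hd]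
  refine ⟨P, hP, d, fun i => ?_, hRP, hd, key⟩
  obtain ⟨Q, hQ, hSQ⟩ := posDef_eq_mul_conjTranspose hS
  rw [key Q hSQ i]
  have hK := invGram_pos hP i
  have hNr : (0 : ℝ) < Nst := by exact_mod_cast hNst
  have h1 : 0 < 1 - ρst := by linarith [hρst.2]
  -- Positivity comes from the penalty when ρst > 0; without penalty it needs the existence
  -- condition.
  rcases hρst.1.eq_or_lt with h0 | h0
  · subst h0
    have := avgMass_row_pos hL hNst hNp h hP hQ i
    simp only [sub_zero, one_mul, zero_mul, add_zero]
    positivity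
  · have : 0 ≤ ∑ j, avgMass y P Q i j := Finset.sum_nonneg fun j _ => avgMass_nonneg y i j
    positivity

theorem updateSt_posDef (hL : 0 < L) (hNst : 0 < Nst) (hNp : 0 < Np)
    {y : Fin L → Fin Nst × Fin Np → ℂ} {ρst ρp : ℝ} (hρst : ρst ∈ Set.Ico (0 : ℝ) 1)
    (h : ExistenceCondition y ρst ρp)
    {R : Matrix (Fin Nst) (Fin Nst) ℂ} {S : Matrix (Fin Np) (Fin Np) ℂ} (hR : R.PosDef)
    (hS : S.PosDef) : (updateSt y ρst R S).PosDef := by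
  obtain ⟨P, hP, d, hd, -, hu, -⟩ := exists_update_coords hL hNst hNp hρst h hR hS
  rw [hu]; exact posDef_congr hP hd

theorem updateP_posDef (hL : 0 < L) (hNst : 0 < Nst) (hNp : 0 < Np)
    {y : Fin L → Fin Nst × Fin Np → ℂ} {ρst ρp : ℝ} (hρp : ρp ∈ Set.Ico (0 : ℝ) 1)
    (h : ExistenceCondition y ρst ρp)
    {R : Matrix (Fin Nst) (Fin Nst) ℂ} {S : Matrix (Fin Np) (Fin Np) ℂ} (hR : R.PosDef)
    (hS : S.PosDef) : (updateP y ρp R S).PosDef := by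
  rw [updateP_eq_updateSt]
  exact updateSt_posDef hL hNp hNst hρp h.swap hS hR

/-- With z = 1 the surrogate gap is the weighted Stein loss plus ψ(E x), and ψ is nonnegative. -/
theorem cost_updateSt_le (hL : 0 < L) (hNst : 0 < Nst) (hNp : 0 < Np)
    {y : Fin L → Fin Nst × Fin Np → ℂ} {ρst ρp : ℝ} (hρst : ρst ∈ Set.Ico (0 : ℝ) 1)
    (hρp : ρp < 1) (h : ExistenceCondition y ρst ρp)
    {R : Matrix (Fin Nst) (Fin Nst) ℂ} {S : Matrix (Fin Np) (Fin Np) ℂ} (hR : R.PosDef)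
    (hS : S.PosDef) :
    cost y ρst ρp (updateSt y ρst R S) S ≤ cost y ρst ρp R S -
      Nst * Np * (weight ρst Nst * steinLoss R (updateSt y ρst R S)) := by
  obtain ⟨P, hP, d, hd, hRP, hu, hdi⟩ := exists_update_coords hL hNst hNp hρst h hR hS
  obtain ⟨Q, hQ, hSQ⟩ := posDef_eq_mul_conjTranspose hS
  have hy := fun l => h.ne_zero hNp l
  have hstep := cost_step_le hL hNst hNp hP hQ hy hρst.2 hρp hd (e := fun _ => 1)
    (fun _ => one_pos) (fun i => Or.inr (hdi Q hSQ i)) fun j => Or.inl rfl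
  have hSQ1 : S = Q * rdiag (fun _ => 1) * Qᴴ := by rw [rdiag_one, Matrix.mul_one, hSQ]
  rw [← hu, ← hSQ1, ← hSQ, ← hRP] at hstep
  refine hstep.trans (sub_le_sub_left (mul_le_mul_of_nonneg_left ?_ (by positivity)) _)
  have hst : steinLoss R (updateSt y ρst R S) = ∑ i, logGap (d i)⁻¹ := by
    rw [hu, hRP, steinLoss_congr hP hd]
  rw [hst]
  have hsum := sum_avgMass hL hP hQ hy
  have hpos : 0 < ∑ i, ∑ j, avgMass y P Q i j * (d i)⁻¹ := by
    rw [sum_avgMass_mul y fun i _ => (d i)⁻¹]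
    have : Nonempty (Fin L) := ⟨⟨0, hL⟩⟩
    exact div_pos (Finset.sum_pos (fun l _ => sum_mass_mul_pos hP hQ (hy l) fun i _ =>
      inv_pos.2 (hd i)) Finset.univ_nonempty) (by exact_mod_cast hL)
  unfold surrogateGap
  simp only [inv_one, logGap_one, mul_one, Finset.sum_const_zero, mul_zero, hsum, sub_self,
    add_zero]
  have := psi_nonneg hpos
  linarith

theorem steinLoss_nonneg {n : Type*} [Fintype n] [DecidableEq n] {A B : Matrix n n ℂ}
    (hA : A.PosDef) (hB : B.PosDef) : 0 ≤ steinLoss A B := by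
  obtain ⟨P, hP, d, hAP, hBP⟩ := exists_simultaneous_diagonalization hA hB.1
  have hd : ∀ i, 0 < d i := by
    have h1 : (rdiag d).PosDef := by
      rw [hBP] at hB; exact (Matrix.IsUnit.posDef_star_right_conjugate_iff hP).1 hB
    intro i
    have := Matrix.posDef_diagonal_iff.1 h1 i
    exact_mod_cast this
  rw [hAP, hBP, steinLoss_congr hP hd]
  exact Finset.sum_nonneg fun i _ => logGap_nonneg (inv_pos.2 (hd i))

/-- The decrease of the cost in one iteration controls the distance of consecutive iterates. -/
def DecreaseControls (y : Fin L → Fin Nst × Fin Np → ℂ) (ρst ρp δ C : ℝ)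
    (R R' : Matrix (Fin Nst) (Fin Nst) ℂ) (S S' : Matrix (Fin Np) (Fin Np) ℂ) : Prop :=
  cost y ρst ρp R' S' ≤ cost y ρst ρp R S ∧
    (cost y ρst ρp R S - cost y ρst ρp R' S' ≤ δ → steinLoss R R' + steinLoss S S' ≤
      C * (cost y ρst ρp R S - cost y ρst ρp R' S'))

/-- This is `sum_logGap_le_surrogateGap` in coordinates that diagonalize both updates. Its caps hold
because the update equation gives d ≥ (1-ρ)Nμ, and its assumption on the weights is
`one_lt_weight_add_weight`. -/
theorem decrease_simultaneous (hL : 0 < L) (hNst : 0 < Nst) (hNp : 0 < Np)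
    {y : Fin L → Fin Nst × Fin Np → ℂ} {ρst ρp : ℝ} (hρst : ρst ∈ Set.Ico (0 : ℝ) 1)
    (hρp : ρp ∈ Set.Ico (0 : ℝ) 1) (h : ExistenceCondition y ρst ρp) :
    ∃ δ > 0, ∃ C, 0 ≤ C ∧ ∀ (R : Matrix (Fin Nst) (Fin Nst) ℂ) (S : Matrix (Fin Np) (Fin Np) ℂ),
      R.PosDef → S.PosDef →
        DecreaseControls y ρst ρp δ C R (updateSt y ρst R S) S (updateP y ρp R S) := by
  have hα := weight_pos hρst.2 hNst
  have hβ := weight_pos hρp.2 hNp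
  obtain ⟨δ, hδ, C, hC⟩ := sum_logGap_le_surrogateGap (Fin Nst) (Fin Np) hα hβ
    (one_lt_weight_add_weight hL hNst hNp hρst hρp h)
  have hN : (0 : ℝ) < Nst * Np := by
    have : (0 : ℝ) < Nst := by exact_mod_cast hNst
    have : (0 : ℝ) < Np := by exact_mod_cast hNp
    positivity
  refine ⟨Nst * Np * δ, by positivity, max C 0 / (Nst * Np), by positivity, ?_⟩
  intro R S hR hS
  obtain ⟨P, hP, d, hd, hRP, hu, hdi⟩ := exists_update_coords hL hNst hNp hρst h hR hS
  obtain ⟨Q, hQ, e, he, hSQ, hv, hei⟩ := exists_update_coords hL hNp hNst hρp h.swap hS hR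
  have hei' : ∀ j, e j = (1 - ρp) * Np * (∑ i, avgMass y P Q i j) + ρp * invGram Q j := fun j => by
    rw [hei P hRP j]
    simp only [avgMass_swapData]
  rw [← updateP_eq_updateSt] at hv
  have hy := fun l => h.ne_zero hNp l
  have hstep := cost_step_le hL hNst hNp hP hQ hy hρst.2 hρp.2 hd he
    (fun i => Or.inr (hdi Q hSQ i)) fun j => Or.inr (hei' j)
  rw [← hu, ← hv, ← hSQ, ← hRP] at hstep
  have s1 : steinLoss R (updateSt y ρst R S) = ∑ i, logGap (d i)⁻¹ := by
    rw [hu, hRP, steinLoss_congr hP hd]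
  have s2 : steinLoss S (updateP y ρp R S) = ∑ j, logGap (e j)⁻¹ := by
    rw [hv, hSQ, steinLoss_congr hQ he]
  have hcap : ∀ {ρ : ℝ} {N : ℕ} {μ k t : ℝ}, ρ ∈ Set.Ico (0 : ℝ) 1 → 0 < N → 0 < t → 0 < k →
      t = (1 - ρ) * N * μ + ρ * k → μ * t⁻¹ ≤ weight ρ N := by
    intro ρ N μ k t hρ hN ht hk he
    rw [← div_eq_mul_inv, div_le_iff₀ ht]
    have h1 := weight_mul hρ.2 hN
    have h2 := mul_nonneg (weight_pos hρ.2 hN).le (mul_nonneg hρ.1 hk.le)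
    calc μ = weight ρ N * ((1 - ρ) * N) * μ := by rw [h1, one_mul]
      _ ≤ weight ρ N * t := by rw [he]; linarith
  obtain ⟨hG0, hG⟩ := hC (avgMass y P Q) (fun i => (d i)⁻¹) (fun j => (e j)⁻¹)
    (fun i j => avgMass_nonneg y i j) (sum_avgMass hL hP hQ hy) (fun i => inv_pos.2 (hd i))
    (fun j => inv_pos.2 (he j))
    (fun i => hcap hρst hNst (hd i) (invGram_pos hP i) (hdi Q hSQ i))
    (fun j => hcap hρp hNp (he j) (invGram_pos hQ j) (hei' j))
  set G := surrogateGap (weight ρst Nst) (weight ρp Np) (avgMass y P Q) (fun i => (d i)⁻¹)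
    fun j => (e j)⁻¹
  have hNG : 0 ≤ Nst * Np * G := mul_nonneg hN.le hG0
  refine ⟨by linarith, fun hle => ?_⟩
  have hGδ : G ≤ δ := by
    have : (Nst : ℝ) * Np * G ≤ Nst * Np * δ := by linarith
    exact le_of_mul_le_mul_left this hN
  rw [s1, s2]
  refine (hG hGδ).trans ?_
  have h1 : C * G ≤ max C 0 * G := mul_le_mul_of_nonneg_right (le_max_left _ _) hG0
  have h2 : max C 0 * G = max C 0 / (Nst * Np) * (Nst * Np * G) := by field_simp
  have h3 : max C 0 / (Nst * Np) * (Nst * Np * G) ≤ max C 0 / (Nst * Np) *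
      (cost y ρst ρp R S - cost y ρst ρp (updateSt y ρst R S) (updateP y ρp R S)) := by
    gcongr; linarith
  linarith

/-- Two single-factor steps, each of which lowers the cost by a multiple of its own Stein loss. No
smallness is involved, so δ = 1 is an arbitrary choice. -/
theorem decrease_alternating (hL : 0 < L) (hNst : 0 < Nst) (hNp : 0 < Np)
    {y : Fin L → Fin Nst × Fin Np → ℂ} {ρst ρp : ℝ} (hρst : ρst ∈ Set.Ico (0 : ℝ) 1)
    (hρp : ρp ∈ Set.Ico (0 : ℝ) 1) (h : ExistenceCondition y ρst ρp) :
    ∃ δ > 0, ∃ C, 0 ≤ C ∧ ∀ (R : Matrix (Fin Nst) (Fin Nst) ℂ) (S : Matrix (Fin Np) (Fin Np) ℂ),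
      R.PosDef → S.PosDef → DecreaseControls y ρst ρp δ C R (updateSt y ρst R S) S
        (updateP y ρp (updateSt y ρst R S) S) := by
  have hα := weight_pos hρst.2 hNst
  have hβ := weight_pos hρp.2 hNp
  have hN : (0 : ℝ) < Nst * Np := by
    have : (0 : ℝ) < Nst := by exact_mod_cast hNst
    have : (0 : ℝ) < Np := by exact_mod_cast hNp
    positivity
  refine ⟨1, one_pos, 1 / (Nst * Np * weight ρst Nst) + 1 / (Nst * Np * weight ρp Np),
    by positivity, ?_⟩
  intro R S hR hS
  have hR' := updateSt_posDef hL hNst hNp hρst h hR hS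
  have h1 := cost_updateSt_le hL hNst hNp hρst hρp.2 h hR hS
  have h2 := cost_updateSt_le hL hNp hNst hρp hρst.2 h.swap hS hR'
  have hS' := updateP_posDef hL hNst hNp hρp h hR' hS
  rw [← updateP_eq_updateSt, cost_swapData, cost_swapData, mul_comm (Np : ℝ)] at h2
  set R' := updateSt y ρst R S
  set S' := updateP y ρp R' S
  have k1 := steinLoss_nonneg hR hR'
  have k2 := steinLoss_nonneg hS hS'
  have m1 : 0 ≤ (Nst : ℝ) * Np * (weight ρst Nst * steinLoss R R') := by positivity
  have m2 : 0 ≤ (Nst : ℝ) * Np * (weight ρp Np * steinLoss S S') := by positivity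
  refine ⟨by linarith, fun _ => ?_⟩
  have e1 : steinLoss R R' = 1 / (Nst * Np * weight ρst Nst) *
    (Nst * Np * (weight ρst Nst * steinLoss R R')) := by field_simp
  have e2 : steinLoss S S' = 1 / (Nst * Np * weight ρp Np) *
    (Nst * Np * (weight ρp Np * steinLoss S S')) := by field_simp
  rw [e1, e2, add_mul]
  gcongr <;> linarith

end Step

/-! ### Solutions minimize the cost, uniquely up to scale -/

section Uniqueness

variable {L Nst Np : ℕ}

theorem logGap_eq_zero {x : ℝ} (hx : 0 < x) (h : logGap x = 0) : x = 1 := by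
  by_contra hne
  have h1 : x⁻¹ ≠ 1 := fun h2 => hne (inv_eq_one.1 h2)
  have h2 := Real.log_lt_sub_one_of_pos (inv_pos.2 hx) h1
  rw [Real.log_inv] at h2
  unfold logGap at h
  linarith

theorem posDef_coords_pos {n : Type*} [Fintype n] [DecidableEq n] {P : Matrix n n ℂ}
    (hP : IsUnit P) {d : n → ℝ} (h : (P * rdiag d * Pᴴ).PosDef) (i : n) : 0 < d i := by
  have h1 : (rdiag d).PosDef := (Matrix.IsUnit.posDef_star_right_conjugate_iff hP).1 h
  have := Matrix.posDef_diagonal_iff.1 h1 i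
  exact_mod_cast this

/-- The defect in Jensen's inequality for the logarithm. -/
theorem log_sum_eq_add_defect {ι κ : Type*} [Fintype ι] [Fintype κ] {w t : ι → κ → ℝ}
    (hw1 : ∑ i, ∑ j, w i j = 1) (ht : ∀ i j, 0 < t i j) {T : ℝ} (hT : T = ∑ i, ∑ j, w i j * t i j)
    (hT0 : 0 < T) :
    Real.log T = ∑ i, ∑ j, w i j * Real.log (t i j) +
      ∑ i, ∑ j, w i j * (t i j / T - 1 - Real.log (t i j / T)) := by
  have h1 : ∀ i j, w i j * (t i j / T - 1 - Real.log (t i j / T)) =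
      w i j * t i j / T - w i j - w i j * Real.log (t i j) + w i j * Real.log T := by
    intro i j
    rw [Real.log_div (ht i j).ne' hT0.ne']; ring
  simp only [h1, Finset.sum_add_distrib, Finset.sum_sub_distrib, ← Finset.sum_div,
    ← Finset.sum_mul, hw1, ← hT]
  rw [div_self hT0.ne']; ring

theorem sum_sum_mul_add {ι κ : Type*} [Fintype ι] [Fintype κ] (w : ι → κ → ℝ) (a : ι → ℝ)
    (b : κ → ℝ) : ∑ i, ∑ j, w i j * (a i + b j) =
      ∑ i, (∑ j, w i j) * a i + ∑ j, (∑ i, w i j) * b j := by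
  simp only [mul_add, Finset.sum_add_distrib, Finset.sum_mul]
  congr 1
  exact Finset.sum_comm

/-- The cost relative to a solution, in coordinates that diagonalize both pairs. -/
theorem cost_eq_of_solution (hNst : 0 < Nst) (hNp : 0 < Np)
    {y : Fin L → Fin Nst × Fin Np → ℂ} (hy : ∀ l, y l ≠ 0) {ρst ρp : ℝ} (hρst : ρst < 1)
    (hρp : ρp < 1) {P : Matrix (Fin Nst) (Fin Nst) ℂ} {Q : Matrix (Fin Np) (Fin Np) ℂ}
    (hP : IsUnit P) (hQ : IsUnit Q) (hsol : IsSolution y ρst ρp (P * Pᴴ) (Q * Qᴴ))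
    {d : Fin Nst → ℝ} {e : Fin Np → ℝ} (hd : ∀ i, 0 < d i) (he : ∀ j, 0 < e j) :
    cost y ρst ρp (P * rdiag d * Pᴴ) (Q * rdiag e * Qᴴ) = cost y ρst ρp (P * Pᴴ) (Q * Qᴴ) +
      Nst * Np * (weight ρst Nst * ∑ i, ρst * invGram P i * logGap (d i)
        + weight ρp Np * ∑ j, ρp * invGram Q j * logGap (e j)
        + (∑ l, ∑ i, ∑ j, mass P Q (y l) i j *
          ((d i)⁻¹ * (e j)⁻¹ / (∑ i, ∑ j, mass P Q (y l) i j * ((d i)⁻¹ * (e j)⁻¹)) - 1 -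
            Real.log ((d i)⁻¹ * (e j)⁻¹ /
              (∑ i, ∑ j, mass P Q (y l) i j * ((d i)⁻¹ * (e j)⁻¹))))) / L) := by
  rw [cost_congr_eq hNst hNp hP hQ hy hρst hρp hd he]
  congr 2
  -- At a solution the update equations hold with d = e = 1. They cancel the terms linear in log d
  -- and log e and leave `logGap` penalties and Jensen defects, all nonnegative.
  have hdi : ∀ i, (1 : ℝ) = (1 - ρst) * Nst * (∑ j, avgMass y P Q i j) + ρst * invGram P i :=
    fun i => update_diag_eq (d := fun _ => 1) hP (by
      rw [rdiag_one, Matrix.mul_one]; exact hsol.2.2.1.symm) i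
  have hej : ∀ j, (1 : ℝ) = (1 - ρp) * Np * (∑ i, avgMass y P Q i j) + ρp * invGram Q j := by
    intro j
    have := update_diag_eq (y := swapData y) (ρ := ρp) (Q := P) (d := fun _ => 1) hQ (by
      rw [rdiag_one, Matrix.mul_one, ← updateP_eq_updateSt]; exact hsol.2.2.2.symm) j
    simpa only [avgMass_swapData] using this
  have hw1 := weight_mul hρst hNst
  have hw2 := weight_mul hρp hNp
  have hl : ∀ l, Real.log (∑ i, ∑ j, mass P Q (y l) i j * ((d i)⁻¹ * (e j)⁻¹)) = _ := fun l =>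
    log_sum_eq_add_defect (w := mass P Q (y l)) (t := fun i j => (d i)⁻¹ * (e j)⁻¹)
    (sum_mass hP hQ (hy l)) (fun i j => mul_pos (inv_pos.2 (hd i)) (inv_pos.2 (he j))) rfl
    (sum_mass_mul_pos hP hQ (hy l) fun i j => mul_pos (inv_pos.2 (hd i)) (inv_pos.2 (he j)))
  rw [Finset.sum_congr rfl fun l _ => hl l, Finset.sum_add_distrib (s := Finset.univ (α := Fin L)),
    add_div, ← add_assoc]
  congr 1
  rw [← sum_avgMass_mul y fun i j => Real.log ((d i)⁻¹ * (e j)⁻¹)]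
  have hlog : ∀ i j, Real.log ((d i)⁻¹ * (e j)⁻¹) = -Real.log (d i) + -Real.log (e j) := by
    intro i j
    rw [Real.log_mul (inv_pos.2 (hd i)).ne' (inv_pos.2 (he j)).ne', Real.log_inv, Real.log_inv]
  simp only [hlog]
  rw [sum_sum_mul_add]
  have k1 : weight ρst Nst * ∑ i, (Real.log (d i) + ρst * invGram P i * ((d i)⁻¹ - 1)) +
      ∑ i, (∑ j, avgMass y P Q i j) * -Real.log (d i) =
      weight ρst Nst * ∑ i, ρst * invGram P i * logGap (d i) := by
    rw [Finset.mul_sum, Finset.mul_sum, ← Finset.sum_add_distrib]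
    refine Finset.sum_congr rfl fun i _ => ?_
    unfold logGap
    have := hdi i
    linear_combination (-(∑ j, avgMass y P Q i j) * Real.log (d i)) * hw1.symm +
      (weight ρst Nst * Real.log (d i)) * this
  have k2 : weight ρp Np * ∑ j, (Real.log (e j) + ρp * invGram Q j * ((e j)⁻¹ - 1)) +
      ∑ j, (∑ i, avgMass y P Q i j) * -Real.log (e j) =
      weight ρp Np * ∑ j, ρp * invGram Q j * logGap (e j) := by
    rw [Finset.mul_sum, Finset.mul_sum, ← Finset.sum_add_distrib]
    refine Finset.sum_congr rfl fun j _ => ?_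
    unfold logGap
    have := hej j
    linear_combination (-(∑ i, avgMass y P Q i j) * Real.log (e j)) * hw2.symm +
      (weight ρp Np * Real.log (e j)) * this
  linarith

theorem sum_mass_defect_nonneg {P : Matrix (Fin Nst) (Fin Nst) ℂ} {Q : Matrix (Fin Np) (Fin Np) ℂ}
    (y : Fin Nst × Fin Np → ℂ) {t : Fin Nst → Fin Np → ℝ} (ht : ∀ i j, 0 < t i j) (i : Fin Nst)
    (j : Fin Np) : 0 ≤ mass P Q y i j * (t i j - 1 - Real.log (t i j)) :=
  mul_nonneg (mass_nonneg y i j) (psi_nonneg (ht i j))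

/-- A solution minimizes the cost, and a second minimizer differs from it at most by scalings. -/
theorem solution_minimizes (hL : 0 < L) (hNst : 0 < Nst) (hNp : 0 < Np)
    {y : Fin L → Fin Nst × Fin Np → ℂ} {ρst ρp : ℝ} (hρst : ρst ∈ Set.Ico (0 : ℝ) 1)
    (hρp : ρp ∈ Set.Ico (0 : ℝ) 1) (h : ExistenceCondition y ρst ρp)
    {R R' : Matrix (Fin Nst) (Fin Nst) ℂ} {S S' : Matrix (Fin Np) (Fin Np) ℂ}
    (hsol : IsSolution y ρst ρp R S) (hR' : R'.PosDef) (hS' : S'.PosDef) :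
    cost y ρst ρp R S ≤ cost y ρst ρp R' S' ∧ (cost y ρst ρp R' S' ≤ cost y ρst ρp R S →
      ∃ c c' : ℝ, (0 < ρst → c = 1) ∧ (0 < ρp → c' = 1) ∧ 0 < c ∧ 0 < c' ∧ R' = c • R ∧
        S' = c' • S) := by
  obtain ⟨P, hP, d, hRP, hRP'⟩ := exists_simultaneous_diagonalization hsol.1 hR'.1
  obtain ⟨Q, hQ, e, hSQ, hSQ'⟩ := exists_simultaneous_diagonalization hsol.2.1 hS'.1
  subst hRP hRP' hSQ hSQ'
  have hd := posDef_coords_pos hP hR'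
  have he := posDef_coords_pos hQ hS'
  have hy := fun l => h.ne_zero hNp l
  have hcost := cost_eq_of_solution hNst hNp hy hρst.2 hρp.2 hP hQ hsol hd he
  set T : Fin L → ℝ := fun l => ∑ i, ∑ j, mass P Q (y l) i j * ((d i)⁻¹ * (e j)⁻¹) with hTdef
  have hT : ∀ l, 0 < T l := fun l => sum_mass_mul_pos hP hQ (hy l) fun i j =>
    mul_pos (inv_pos.2 (hd i)) (inv_pos.2 (he j))
  have hα := weight_pos hρst.2 hNst
  have hβ := weight_pos hρp.2 hNp
  have hLr : (0 : ℝ) < L := by exact_mod_cast hL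
  have hN : (0 : ℝ) < Nst * Np := by
    have : (0 : ℝ) < Nst := by exact_mod_cast hNst
    have : (0 : ℝ) < Np := by exact_mod_cast hNp
    positivity
  have p1 : ∀ i ∈ Finset.univ, 0 ≤ ρst * invGram P i * logGap (d i) := fun i _ =>
    mul_nonneg (mul_nonneg hρst.1 (invGram_pos hP i).le) (logGap_nonneg (hd i))
  have p2 : ∀ j ∈ Finset.univ, 0 ≤ ρp * invGram Q j * logGap (e j) := fun j _ =>
    mul_nonneg (mul_nonneg hρp.1 (invGram_pos hQ j).le) (logGap_nonneg (he j))
  have p3 : ∀ l i j, 0 ≤ mass P Q (y l) i j *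
      ((d i)⁻¹ * (e j)⁻¹ / T l - 1 - Real.log ((d i)⁻¹ * (e j)⁻¹ / T l)) := fun l i j =>
    sum_mass_defect_nonneg (y l) (t := fun i j => (d i)⁻¹ * (e j)⁻¹ / T l)
      (fun i j => div_pos (mul_pos (inv_pos.2 (hd i)) (inv_pos.2 (he j))) (hT l)) i j
  have q1 := mul_nonneg hα.le (Finset.sum_nonneg p1)
  have q2 := mul_nonneg hβ.le (Finset.sum_nonneg p2)
  have q3' : ∀ l ∈ Finset.univ, 0 ≤ ∑ i, ∑ j, mass P Q (y l) i j *
      ((d i)⁻¹ * (e j)⁻¹ / T l - 1 - Real.log ((d i)⁻¹ * (e j)⁻¹ / T l)) := fun l _ =>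
    Finset.sum_nonneg fun i _ => Finset.sum_nonneg fun j _ => p3 l i j
  have q3 := div_nonneg (Finset.sum_nonneg q3') hLr.le
  refine ⟨?_, fun hle => ?_⟩
  · rw [hcost]
    exact le_add_of_nonneg_right (mul_nonneg hN.le (add_nonneg (add_nonneg q1 q2) q3))
  · have hzero : weight ρst Nst * ∑ i, ρst * invGram P i * logGap (d i)
        + weight ρp Np * ∑ j, ρp * invGram Q j * logGap (e j)
        + (∑ l, ∑ i, ∑ j, mass P Q (y l) i j *
      ((d i)⁻¹ * (e j)⁻¹ / T l - 1 - Real.log ((d i)⁻¹ * (e j)⁻¹ / T l))) / L ≤ 0 := by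
      by_contra hcon
      push Not at hcon
      have := mul_pos hN hcon
      linarith
    have z1 : ∑ i, ρst * invGram P i * logGap (d i) = 0 :=
      (mul_eq_zero.1 (le_antisymm (by linarith) q1)).resolve_left hα.ne'
    have z2 : ∑ j, ρp * invGram Q j * logGap (e j) = 0 :=
      (mul_eq_zero.1 (le_antisymm (by linarith) q2)).resolve_left hβ.ne'
    have z3 := (div_eq_zero_iff.1 (le_antisymm (by linarith) q3)).resolve_right hLr.ne'
    have hd1 : 0 < ρst → ∀ i, d i = 1 := fun hρ i => by
      have h1 := (Finset.sum_eq_zero_iff_of_nonneg p1).1 z1 i (Finset.mem_univ i)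
      exact logGap_eq_zero (hd i) ((mul_eq_zero.1 h1).resolve_left
        (mul_pos hρ (invGram_pos hP i)).ne')
    have he1 : 0 < ρp → ∀ j, e j = 1 := fun hρ j => by
      have h1 := (Finset.sum_eq_zero_iff_of_nonneg p2).1 z2 j (Finset.mem_univ j)
      exact logGap_eq_zero (he j) ((mul_eq_zero.1 h1).resolve_left
        (mul_pos hρ (invGram_pos hQ j)).ne')
    have htT : ∀ l i j, coords P Q (y l) j i ≠ 0 → (d i)⁻¹ * (e j)⁻¹ = T l := by
      intro l i j hne
      have h1 := (Finset.sum_eq_zero_iff_of_nonneg q3').1 z3 l (Finset.mem_univ l)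
      have h2 := (Finset.sum_eq_zero_iff_of_nonneg
        (fun i _ => Finset.sum_nonneg fun j _ => p3 l i j)).1 h1 i (Finset.mem_univ i)
      have h3 := (Finset.sum_eq_zero_iff_of_nonneg (fun j _ => p3 l i j)).1 h2 j
        (Finset.mem_univ j)
      have h4 := (mul_eq_zero.1 h3).resolve_left (mass_pos hP hQ (hy l) hne).ne'
      have h5 : 0 < (d i)⁻¹ * (e j)⁻¹ / T l :=
        div_pos (mul_pos (inv_pos.2 (hd i)) (inv_pos.2 (he j))) (hT l)
      have h6 : (d i)⁻¹ * (e j)⁻¹ / T l = 1 := by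
        by_contra hne1
        have := Real.log_lt_sub_one_of_pos h5 hne1
        linarith
      rwa [div_eq_one_iff_eq (hT l).ne'] at h6
    have : Nonempty (Fin Nst) := ⟨⟨0, hNst⟩⟩
    have : Nonempty (Fin Np) := ⟨⟨0, hNp⟩⟩
    obtain ⟨i₀, hi₀⟩ := Finite.exists_min fun i => Real.log (d i)
    obtain ⟨j₀, hj₀⟩ := Finite.exists_min fun j => Real.log (e j)
    -- Vanishing defects make 1/(d i * e j) constant on the support of each sample. With the
    -- exponents log d, log e the recession inequality then holds with equality, which forces both
    -- to be constant.
    have hrec := recession_inequality hL hNst hNp hρst.2 hρp.2 h hP hQ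
      (a := fun i => Real.log (d i)) (b := fun j => Real.log (e j)) hi₀ ⟨i₀, rfl⟩ hj₀ ⟨j₀, rfl⟩
      (m := fun l => -Real.log (T l)) (by
        intro l i j hne
        rw [← htT l i j hne, Real.log_mul (inv_pos.2 (hd i)).ne' (inv_pos.2 (he j)).ne',
          Real.log_inv, Real.log_inv]
        linarith)
    have hsum : (∑ l, -Real.log (T l)) / L = weight ρst Nst * ∑ i, Real.log (d i) +
        weight ρp Np * ∑ j, Real.log (e j) := by
      have h1 := cost_congr_eq hNst hNp hP hQ hy hρst.2 hρp.2 hd he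
      rw [hcost, z1, z2, z3] at h1
      have h2 : ∑ i, (Real.log (d i) + ρst * invGram P i * ((d i)⁻¹ - 1)) =
          ∑ i, Real.log (d i) := Finset.sum_congr rfl fun i _ => by
        rcases hρst.1.eq_or_lt with h0 | h0
        · rw [← h0]; ring
        · rw [hd1 h0 i]; simp
      have h3 : ∑ j, (Real.log (e j) + ρp * invGram Q j * ((e j)⁻¹ - 1)) =
          ∑ j, Real.log (e j) := Finset.sum_congr rfl fun j _ => by
        rcases hρp.1.eq_or_lt with h0 | h0
        · rw [← h0]; ring
        · rw [he1 h0 j]; simp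
      rw [h2, h3] at h1
      simp only [mul_zero, zero_div, add_zero] at h1
      have h4 := (mul_eq_zero.1 (left_eq_add.1 h1)).resolve_left hN.ne'
      rw [Finset.sum_neg_distrib, neg_div]
      linarith
    have w1 : (weight ρst Nst * Nst - 1) * Real.log (d i₀) = 0 := by
      rw [weight_mul_card_sub_one hρst.2 hNst]
      rcases hρst.1.eq_or_lt with h0 | h0
      · rw [← h0]; simp
      · rw [hd1 h0 i₀]; simp
    have w2 : (weight ρp Np * Np - 1) * Real.log (e j₀) = 0 := by
      rw [weight_mul_card_sub_one hρp.2 hNp]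
      rcases hρp.1.eq_or_lt with h0 | h0
      · rw [← h0]; simp
      · rw [he1 h0 j₀]; simp
    rw [w1, w2, hsum] at hrec
    have hconst : ¬ ((∃ i, Real.log (d i) ≠ Real.log (d i₀)) ∨
        ∃ j, Real.log (e j) ≠ Real.log (e j₀)) := fun hx => by
      have := hrec.2 hx
      linarith
    push Not at hconst
    have hdc : d = fun _ => d i₀ := funext fun i => Real.log_injOn_pos (hd i) (hd i₀) (hconst.1 i)
    have hec : e = fun _ => e j₀ := funext fun j => Real.log_injOn_pos (he j) (he j₀) (hconst.2 j)
    refine ⟨d i₀, e j₀, fun hρ => hd1 hρ i₀, fun hρ => he1 hρ j₀, hd i₀, he j₀, ?_, ?_⟩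
    · have : rdiag (fun _ : Fin Nst => d i₀) = d i₀ • (1 : Matrix (Fin Nst) (Fin Nst) ℂ) := by
        rw [← rdiag_one, rdiag, rdiag, ← Matrix.diagonal_smul]
        congr 1; ext i; simp
      rw [hdc, this, Matrix.mul_smul, Matrix.mul_one, Matrix.smul_mul]
    · have : rdiag (fun _ : Fin Np => e j₀) = e j₀ • (1 : Matrix (Fin Np) (Fin Np) ℂ) := by
        rw [← rdiag_one, rdiag, rdiag, ← Matrix.diagonal_smul]
        congr 1; ext i; simp
      rw [hec, this, Matrix.mul_smul, Matrix.mul_one, Matrix.smul_mul]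

end Uniqueness

/-! ### Continuity at positive definite matrices -/

section Continuity

variable {n : Type*} [Fintype n] [DecidableEq n]

theorem det_re_pos {A : Matrix n n ℂ} (hA : A.PosDef) : 0 < A.det.re :=
  (Complex.pos_iff.1 hA.det_pos).1

theorem continuousAt_inv_of_posDef {A : Matrix n n ℂ} (hA : A.PosDef) :
    ContinuousAt (fun M : Matrix n n ℂ => M⁻¹) A := by
  apply continuousAt_matrix_inv
  rw [Ring.inverse_eq_inv']
  exact continuousAt_inv₀ ((Matrix.isUnit_iff_isUnit_det A).1 hA.isUnit).ne_zero

theorem continuousAt_log_det {A : Matrix n n ℂ} (hA : A.PosDef) :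
    ContinuousAt (fun M : Matrix n n ℂ => Real.log M.det.re) A := by
  have h : Continuous fun M : Matrix n n ℂ => M.det.re :=
    Complex.continuous_re.comp (Continuous.matrix_det continuous_id)
  exact h.continuousAt.log (det_re_pos hA).ne'

theorem continuousAt_steinLoss {A B : Matrix n n ℂ} (hA : A.PosDef) (hB : B.PosDef) :
    ContinuousAt (fun p : Matrix n n ℂ × Matrix n n ℂ => steinLoss p.1 p.2) (A, B) := by
  unfold steinLoss
  have h1 : ContinuousAt (fun p : Matrix n n ℂ × Matrix n n ℂ => (p.1)⁻¹) (A, B) :=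
    ContinuousAt.comp (f := Prod.fst) (continuousAt_inv_of_posDef hA) continuousAt_fst
  have h2 : ContinuousAt (fun p : Matrix n n ℂ × Matrix n n ℂ => Real.log p.2.det.re) (A, B) :=
    ContinuousAt.comp (f := Prod.snd) (continuousAt_log_det hB) continuousAt_snd
  have h3 : ContinuousAt (fun p : Matrix n n ℂ × Matrix n n ℂ => Real.log p.1.det.re) (A, B) :=
    ContinuousAt.comp (f := Prod.fst) (continuousAt_log_det hA) continuousAt_fst
  have h5 : ContinuousAt (fun p : Matrix n n ℂ × Matrix n n ℂ => (p.1)⁻¹ * p.2) (A, B) :=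
    h1.mul continuousAt_snd
  have h4 : ContinuousAt (fun p : Matrix n n ℂ × Matrix n n ℂ => ((p.1)⁻¹ * p.2).trace.re) (A, B) :=
    (Complex.continuous_re.comp (Continuous.matrix_trace continuous_id)).continuousAt.comp h5
  exact (h4.sub continuousAt_const).sub (h2.sub h3)

variable {L Nst Np : ℕ}

theorem continuousAt_quadForm (y : Fin Nst × Fin Np → ℂ) {R : Matrix (Fin Nst) (Fin Nst) ℂ}
    {S : Matrix (Fin Np) (Fin Np) ℂ} (hR : R.PosDef) (hS : S.PosDef) :
    ContinuousAt (fun p : Matrix (Fin Nst) (Fin Nst) ℂ × Matrix (Fin Np) (Fin Np) ℂ =>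
      quadForm y p.1 p.2) (R, S) := by
  have h1 : ContinuousAt (fun p : Matrix (Fin Nst) (Fin Nst) ℂ × Matrix (Fin Np) (Fin Np) ℂ =>
      (p.1)⁻¹) (R, S) :=
    ContinuousAt.comp (f := Prod.fst) (continuousAt_inv_of_posDef hR) continuousAt_fst
  have h2 : ContinuousAt (fun p : Matrix (Fin Nst) (Fin Nst) ℂ × Matrix (Fin Np) (Fin Np) ℂ =>
      (p.2)⁻¹) (R, S) :=
    ContinuousAt.comp (f := Prod.snd) (continuousAt_inv_of_posDef hS) continuousAt_snd
  have hf : Continuous fun q : Matrix (Fin Nst) (Fin Nst) ℂ × Matrix (Fin Np) (Fin Np) ℂ =>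
      ((unvec y)ᴴ * (q.2 * unvec y * q.1ᵀ)).trace.re :=
    Complex.continuous_re.comp (continuous_const.matrix_mul ((continuous_snd.matrix_mul
      continuous_const).matrix_mul continuous_fst.matrix_transpose)).matrix_trace
  have h3 := (hf.tendsto (R⁻¹, S⁻¹)).comp (h1.prodMk_nhds h2)
  have h4 : ((fun q : Matrix (Fin Nst) (Fin Nst) ℂ × Matrix (Fin Np) (Fin Np) ℂ =>
      ((unvec y)ᴴ * (q.2 * unvec y * q.1ᵀ)).trace.re) ∘ fun p : Matrix (Fin Nst) (Fin Nst) ℂ × Matrix (Fin Np) (Fin Np) ℂ =>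
        ((p.1)⁻¹, (p.2)⁻¹)) = fun p => quadForm y p.1 p.2 := funext fun p => (quadForm_eq_trace y p.1 p.2).symm
  rw [h4] at h3
  unfold ContinuousAt
  change Filter.Tendsto _ _ (𝓝 (quadForm y R S))
  rwa [quadForm_eq_trace]

theorem quadForm_pos {y : Fin Nst × Fin Np → ℂ} (hy : y ≠ 0) {R : Matrix (Fin Nst) (Fin Nst) ℂ}
    {S : Matrix (Fin Np) (Fin Np) ℂ} (hR : R.PosDef) (hS : S.PosDef) : 0 < quadForm y R S := by
  obtain ⟨P, hP, rfl⟩ := posDef_eq_mul_conjTranspose hR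
  obtain ⟨Q, hQ, rfl⟩ := posDef_eq_mul_conjTranspose hS
  rw [quadForm_self]
  exact totalMass_pos hP hQ hy

theorem continuousAt_cost {y : Fin L → Fin Nst × Fin Np → ℂ} (hy : ∀ l, y l ≠ 0) (ρst ρp : ℝ)
    {R : Matrix (Fin Nst) (Fin Nst) ℂ} {S : Matrix (Fin Np) (Fin Np) ℂ} (hR : R.PosDef)
    (hS : S.PosDef) :
    ContinuousAt (fun p : Matrix (Fin Nst) (Fin Nst) ℂ × Matrix (Fin Np) (Fin Np) ℂ =>
      cost y ρst ρp p.1 p.2) (R, S) := by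
  unfold cost
  have h1 : ContinuousAt (fun p : Matrix (Fin Nst) (Fin Nst) ℂ × Matrix (Fin Np) (Fin Np) ℂ =>
      ((p.1)⁻¹).trace.re) (R, S) :=
    ContinuousAt.comp (f := Prod.fst)
      ((Complex.continuous_re.comp (Continuous.matrix_trace continuous_id)).continuousAt.comp
        (continuousAt_inv_of_posDef hR)) continuousAt_fst
  have h2 : ContinuousAt (fun p : Matrix (Fin Nst) (Fin Nst) ℂ × Matrix (Fin Np) (Fin Np) ℂ =>
      ((p.2)⁻¹).trace.re) (R, S) :=
    ContinuousAt.comp (f := Prod.snd)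
      ((Complex.continuous_re.comp (Continuous.matrix_trace continuous_id)).continuousAt.comp
        (continuousAt_inv_of_posDef hS)) continuousAt_snd
  have h3 : ContinuousAt (fun p : Matrix (Fin Nst) (Fin Nst) ℂ × Matrix (Fin Np) (Fin Np) ℂ =>
      Real.log p.1.det.re) (R, S) :=
    ContinuousAt.comp (f := Prod.fst) (continuousAt_log_det hR) continuousAt_fst
  have h4 : ContinuousAt (fun p : Matrix (Fin Nst) (Fin Nst) ℂ × Matrix (Fin Np) (Fin Np) ℂ =>
      Real.log p.2.det.re) (R, S) :=
    ContinuousAt.comp (f := Prod.snd) (continuousAt_log_det hS) continuousAt_snd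
  have h5 : ContinuousAt (fun p : Matrix (Fin Nst) (Fin Nst) ℂ × Matrix (Fin Np) (Fin Np) ℂ =>
      ∑ l, Real.log (quadForm (y l) p.1 p.2)) (R, S) :=
    tendsto_finsetSum _ fun l _ =>
      (continuousAt_quadForm (y l) hR hS).log (quadForm_pos (hy l) hR hS).ne'
  exact ((((continuousAt_const.mul h3).add (continuousAt_const.mul h4)).add
    (continuousAt_const.mul h5)).add (continuousAt_const.mul h1)).add (continuousAt_const.mul h2)

theorem continuousAt_updateSt {y : Fin L → Fin Nst × Fin Np → ℂ} (hy : ∀ l, y l ≠ 0) (ρ : ℝ)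
    {R : Matrix (Fin Nst) (Fin Nst) ℂ} {S : Matrix (Fin Np) (Fin Np) ℂ} (hR : R.PosDef)
    (hS : S.PosDef) :
    ContinuousAt (fun p : Matrix (Fin Nst) (Fin Nst) ℂ × Matrix (Fin Np) (Fin Np) ℂ =>
      updateSt y ρ p.1 p.2) (R, S) := by
  unfold updateSt Cst
  have h2 : ContinuousAt (fun p : Matrix (Fin Nst) (Fin Nst) ℂ × Matrix (Fin Np) (Fin Np) ℂ =>
      (p.2)⁻¹) (R, S) :=
    ContinuousAt.comp (f := Prod.snd) (continuousAt_inv_of_posDef hS) continuousAt_snd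
  have h5 : ContinuousAt (fun p : Matrix (Fin Nst) (Fin Nst) ℂ × Matrix (Fin Np) (Fin Np) ℂ =>
      ∑ l, (quadForm (y l) p.1 p.2)⁻¹ • ((unvec (y l))ᴴ * (p.2)⁻¹ * unvec (y l))ᵀ) (R, S) := by
    refine tendsto_finsetSum _ fun l _ => ?_
    refine ContinuousAt.smul
      ((continuousAt_quadForm (y l) hR hS).inv₀ (quadForm_pos (hy l) hR hS).ne') ?_
    have hc : Continuous fun q : Matrix (Fin Np) (Fin Np) ℂ =>
      ((unvec (y l))ᴴ * q * unvec (y l))ᵀ := by fun_prop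
    exact hc.continuousAt.comp h2
  exact ((h5.const_smul ((Nst : ℝ) / (L : ℝ))).const_smul (1 - ρ)).add continuousAt_const

theorem continuousAt_updateP {y : Fin L → Fin Nst × Fin Np → ℂ} (hy : ∀ l, y l ≠ 0) (ρ : ℝ)
    {R : Matrix (Fin Nst) (Fin Nst) ℂ} {S : Matrix (Fin Np) (Fin Np) ℂ} (hR : R.PosDef)
    (hS : S.PosDef) :
    ContinuousAt (fun p : Matrix (Fin Nst) (Fin Nst) ℂ × Matrix (Fin Np) (Fin Np) ℂ =>
      updateP y ρ p.1 p.2) (R, S) := by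
  simp only [updateP_eq_updateSt]
  have hy' : ∀ l, swapData y l ≠ 0 := fun l h => hy l (by
    ext ⟨i, j⟩; exact congrFun h (j, i))
  have := continuousAt_updateSt hy' ρ hS hR
  exact ContinuousAt.comp (f := Prod.swap) (x := (R, S)) this continuous_swap.continuousAt

end Continuity

/-! ### Compact sets of positive definite matrices -/

section Compactness

variable {n : Type*} [Fintype n] [DecidableEq n]

theorem isCompact_unitary : IsCompact {U : Matrix n n ℂ | U ∈ Matrix.unitaryGroup n ℂ} := by
  have hK : IsCompact (Set.pi Set.univ fun _ : n => Set.pi Set.univ fun _ : n =>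
      Metric.closedBall (0 : ℂ) 1) :=
    isCompact_univ_pi fun _ => isCompact_univ_pi fun _ => isCompact_closedBall _ _
  refine IsCompact.of_isClosed_subset (s := Set.pi Set.univ fun _ : n => Set.pi Set.univ
    fun _ : n => Metric.closedBall (0 : ℂ) 1) hK ?_ ?_
  · have : {U : Matrix n n ℂ | U ∈ Matrix.unitaryGroup n ℂ} = {U | U * Uᴴ = 1} := by
      ext U; exact Matrix.mem_unitaryGroup_iff
    rw [this]
    exact isClosed_eq (by fun_prop) continuous_const
  · intro U hU i _ j _
    rw [mem_closedBall_zero_iff]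
    exact entry_norm_bound_of_unitary hU i j

/-- The matrix `P diag(exp a) Pᴴ`. -/
noncomputable def expCongr (P : Matrix n n ℂ) (a : n → ℝ) : Matrix n n ℂ :=
  P * rdiag (fun i => Real.exp (a i)) * Pᴴ

theorem continuous_expCongr : Continuous fun p : Matrix n n ℂ × (n → ℝ) => expCongr p.1 p.2 := by
  unfold expCongr rdiag
  fun_prop

theorem posDef_expCongr {P : Matrix n n ℂ} (hP : IsUnit P) (a : n → ℝ) : (expCongr P a).PosDef :=
  posDef_congr hP fun _ => Real.exp_pos _

/-- Positive definite matrices whose eigenvalues have logarithms in `[-B, B]`. -/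
def boundedPosDef (n : Type*) [Fintype n] [DecidableEq n] (B : ℝ) : Set (Matrix n n ℂ) :=
  (fun p : Matrix n n ℂ × (n → ℝ) => expCongr p.1 p.2) ''
    ({U | U ∈ Matrix.unitaryGroup n ℂ} ×ˢ Set.pi Set.univ fun _ => Set.Icc (-B) B)

theorem isCompact_boundedPosDef (B : ℝ) : IsCompact (boundedPosDef n B) :=
  (isCompact_unitary.prod (isCompact_univ_pi fun _ => isCompact_Icc)).image continuous_expCongr

theorem posDef_of_mem_boundedPosDef {B : ℝ} {A : Matrix n n ℂ} (h : A ∈ boundedPosDef n B) :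
    A.PosDef := by
  obtain ⟨⟨U, a⟩, ⟨hU, -⟩, rfl⟩ := h
  exact posDef_expCongr (isUnit_of_mem_unitary hU) a

theorem smul_mem_boundedPosDef {B s : ℝ} {A : Matrix n n ℂ} (h : A ∈ boundedPosDef n B)
    {B' : ℝ} (hs : |s| ≤ B') : Real.exp s • A ∈ boundedPosDef n (B + B') := by
  obtain ⟨⟨U, a⟩, ⟨hU, ha⟩, rfl⟩ := h
  refine ⟨⟨U, fun i => a i + s⟩, ⟨hU, fun i _ => ?_⟩, ?_⟩
  · have h1 := ha i (Set.mem_univ i)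
    have h2 := abs_le.1 hs
    exact ⟨by linarith [h1.1], by linarith [h1.2]⟩
  · have : rdiag (fun i => Real.exp (a i + s)) = Real.exp s • rdiag fun i => Real.exp (a i) := by
      unfold rdiag
      rw [← Matrix.diagonal_smul]
      congr 1; ext i
      simp [Real.exp_add, mul_comm]
    simp only [expCongr, this, Matrix.mul_smul, Matrix.smul_mul]

end Compactness

/-! ### Growth of the cost along rays of exponents -/

section Rays

/-- Jensen's inequality for the concave power s ↦ s^τ. -/
theorem log_sum_exp_mul_le {ι : Type*} [Fintype ι] {m : ι → ℝ} (hm : ∀ i, 0 ≤ m i)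
    (hsum : ∑ i, m i = 1) (c : ι → ℝ) {τ : ℝ} (h0 : 0 ≤ τ) (h1 : τ ≤ 1) :
    Real.log (∑ i, m i * Real.exp (τ * c i)) ≤ τ * Real.log (∑ i, m i * Real.exp (c i)) := by
  have hpos : ∀ f : ι → ℝ, 0 < ∑ i, m i * Real.exp (f i) := by
    intro f
    have hnn : ∀ i ∈ Finset.univ, 0 ≤ m i * Real.exp (f i) := fun i _ =>
      mul_nonneg (hm i) (Real.exp_pos _).le
    refine lt_of_le_of_ne (Finset.sum_nonneg hnn) fun h => ?_
    have h2 := (Finset.sum_eq_zero_iff_of_nonneg hnn).1 h.symm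
    have h3 : ∑ i, m i = 0 := Finset.sum_eq_zero fun i hi =>
      (mul_eq_zero.1 (h2 i hi)).resolve_right (Real.exp_pos _).ne'
    linarith
  have h2 := (Real.concaveOn_rpow h0 h1).le_map_sum (t := Finset.univ) (w := m)
    (p := fun i => Real.exp (c i)) (fun i _ => hm i) hsum (fun i _ => (Real.exp_pos _).le)
  simp only [smul_eq_mul] at h2
  rw [← Real.log_rpow (hpos c)]
  refine Real.log_le_log (hpos _) (le_trans (le_of_eq ?_) h2)
  refine Finset.sum_congr rfl fun i _ => ?_
  rw [← Real.exp_mul, mul_comm τ]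

theorem exp_mul_sub_one_le (c : ℝ) {τ : ℝ} (h0 : 0 ≤ τ) (h1 : τ ≤ 1) :
    Real.exp (τ * c) - 1 ≤ τ * (Real.exp c - 1) := by
  have := convexOn_exp.2 (Set.mem_univ 0) (Set.mem_univ c) (sub_nonneg.2 h1) h0 (by ring)
  simp only [smul_eq_mul, mul_zero, zero_add, Real.exp_zero, mul_one] at this
  linarith

theorem exists_lt_add_exp {E K c s : ℝ} (hc : 0 < c) (hs : 0 < s) :
    ∃ t : ℝ, 0 < t ∧ K < t * E + c * Real.exp (t * s) := by
  set D := 2 * (|E| + |K| + 1) / (c * s ^ 2) with hD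
  have hcs : 0 < c * s ^ 2 := by positivity
  have hD0 : 0 < D := by positivity
  refine ⟨max 1 D, lt_of_lt_of_le one_pos (le_max_left _ _), ?_⟩
  set t := max 1 D
  have ht1 : 1 ≤ t := le_max_left _ _
  have htD : D ≤ t := le_max_right _ _
  have hts : 0 ≤ t * s := by positivity
  have h1 := Real.quadratic_le_exp_of_nonneg hts
  have h2 : 2 * (|E| + |K| + 1) ≤ t * (c * s ^ 2) := by
    rw [← div_le_iff₀ hcs]; exact htD
  have h3 : t * (2 * (|E| + |K| + 1)) ≤ t * (t * (c * s ^ 2)) :=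
    mul_le_mul_of_nonneg_left h2 (by linarith)
  have h4 : c * ((t * s) ^ 2 / 2) ≤ c * Real.exp (t * s) :=
    mul_le_mul_of_nonneg_left (by linarith) hc.le
  have h5 : -(t * |E|) ≤ t * E := by nlinarith [neg_abs_le E]
  have h6 : |K| ≤ t * |K| := by nlinarith [abs_nonneg K]
  have h7 := le_abs_self K
  nlinarith

theorem exists_lt_mul {E : ℝ} (K : ℝ) (hE : 0 < E) : ∃ t : ℝ, 0 < t ∧ K < t * E := by
  refine ⟨(|K| + 1) / E, by positivity, ?_⟩
  rw [div_mul_cancel₀ _ hE.ne']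
  linarith [le_abs_self K]

variable {L Nst Np : ℕ}

/-- The normalized increase of the cost from `(P Pᴴ, Q Qᴴ)` to `(expCongr P a, expCongr Q b)`. -/
noncomputable def energy (y : Fin L → Fin Nst × Fin Np → ℂ) (ρst ρp : ℝ)
    (P : Matrix (Fin Nst) (Fin Nst) ℂ) (Q : Matrix (Fin Np) (Fin Np) ℂ) (a : Fin Nst → ℝ)
    (b : Fin Np → ℝ) : ℝ :=
  weight ρst Nst * ∑ i, (a i + ρst * invGram P i * (Real.exp (-a i) - 1))
    + weight ρp Np * ∑ j, (b j + ρp * invGram Q j * (Real.exp (-b j) - 1))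
    + (∑ l, Real.log (∑ p : Fin Nst × Fin Np,
        mass P Q (y l) p.1 p.2 * Real.exp (-(a p.1 + b p.2)))) / L

variable {y : Fin L → Fin Nst × Fin Np → ℂ} {ρst ρp : ℝ} {P : Matrix (Fin Nst) (Fin Nst) ℂ}
  {Q : Matrix (Fin Np) (Fin Np) ℂ}

theorem cost_expCongr (hNst : 0 < Nst) (hNp : 0 < Np) (hP : IsUnit P) (hQ : IsUnit Q)
    (hy : ∀ l, y l ≠ 0) (hρst : ρst < 1) (hρp : ρp < 1) (a : Fin Nst → ℝ) (b : Fin Np → ℝ) :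
    cost y ρst ρp (expCongr P a) (expCongr Q b) =
      cost y ρst ρp (P * Pᴴ) (Q * Qᴴ) + Nst * Np * energy y ρst ρp P Q a b := by
  rw [expCongr, expCongr, cost_congr_eq hNst hNp hP hQ hy hρst hρp (fun i => Real.exp_pos _)
    fun j => Real.exp_pos _]
  simp only [energy, Real.log_exp, ← Real.exp_neg, ← Real.exp_add, Fintype.sum_prod_type, neg_add]

/-- The consequence of geodesic convexity that is needed: the energy vanishes at the origin and lies
below its chords from there, so a positive value on a ray forces at least linear growth further out.
-/
theorem energy_mul_le (hP : IsUnit P) (hQ : IsUnit Q) (hNst : 0 < Nst) (hNp : 0 < Np)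
    (hy : ∀ l, y l ≠ 0) (hρst : ρst ∈ Set.Ico (0 : ℝ) 1) (hρp : ρp ∈ Set.Ico (0 : ℝ) 1)
    (a : Fin Nst → ℝ) (b : Fin Np → ℝ) {τ : ℝ} (h0 : 0 ≤ τ) (h1 : τ ≤ 1) :
    energy y ρst ρp P Q (τ • a) (τ • b) ≤ τ * energy y ρst ρp P Q a b := by
  have key : ∀ {N : ℕ} {ρ : ℝ} (T : Matrix (Fin N) (Fin N) ℂ) (c : Fin N → ℝ),
      ρ ∈ Set.Ico (0 : ℝ) 1 → 0 < N → IsUnit T →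
      weight ρ N * ∑ i, ((τ • c) i + ρ * invGram T i * (Real.exp (-(τ • c) i) - 1)) ≤
        τ * (weight ρ N * ∑ i, (c i + ρ * invGram T i * (Real.exp (-c i) - 1))) := by
    intro N ρ T c hρ hN hT
    rw [mul_left_comm, Finset.mul_sum _ _ τ]
    refine mul_le_mul_of_nonneg_left (Finset.sum_le_sum fun i _ => ?_) (weight_pos hρ.2 hN).le
    have h2 := exp_mul_sub_one_le (-c i) h0 h1
    have h3 : 0 ≤ ρ * invGram T i := mul_nonneg hρ.1 (invGram_pos hT i).le
    have h4 := mul_le_mul_of_nonneg_left h2 h3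
    simp only [Pi.smul_apply, smul_eq_mul, mul_neg] at h4 ⊢
    linarith
  have k1 := key P a hρst hNst hP
  have k2 := key Q b hρp hNp hQ
  have k3 : (∑ l, Real.log (∑ p : Fin Nst × Fin Np,
        mass P Q (y l) p.1 p.2 * Real.exp (-((τ • a) p.1 + (τ • b) p.2)))) / L ≤
      τ * ((∑ l, Real.log (∑ p : Fin Nst × Fin Np,
        mass P Q (y l) p.1 p.2 * Real.exp (-(a p.1 + b p.2)))) / L) := by
    rw [← mul_div_assoc, Finset.mul_sum]
    refine div_le_div_of_nonneg_right (Finset.sum_le_sum fun l _ => ?_) (Nat.cast_nonneg _)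
    have h2 := log_sum_exp_mul_le (m := fun p : Fin Nst × Fin Np => mass P Q (y l) p.1 p.2)
      (fun p => mass_nonneg _ _ _) (by rw [Fintype.sum_prod_type]; exact sum_mass hP hQ (hy l))
      (fun p => -(a p.1 + b p.2)) h0 h1
    simpa only [Pi.smul_apply, smul_eq_mul, mul_neg, mul_add] using h2
  unfold energy
  linarith

/-- A lower bound of the energy along a ray. -/
theorem exists_energy_ge (hP : IsUnit P) (hQ : IsUnit Q) (hy : ∀ l, y l ≠ 0) (ρst ρp : ℝ) (a : Fin Nst → ℝ) (b : Fin Np → ℝ) :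
    ∃ (m : Fin L → ℝ) (K : ℝ), (∀ l i j, coords P Q (y l) j i ≠ 0 → m l ≤ a i + b j) ∧
      ∀ t : ℝ, t * (weight ρst Nst * ∑ i, a i + weight ρp Np * ∑ j, b j - (∑ l, m l) / L)
        + weight ρst Nst * ∑ i, ρst * invGram P i * Real.exp (t * -a i)
        + weight ρp Np * ∑ j, ρp * invGram Q j * Real.exp (t * -b j) - K ≤
        energy y ρst ρp P Q (t • a) (t • b) := by
  -- For each sample only the term of slowest decay in its support is kept, the one with the
  -- smallest exponent a + b.
  have hex : ∀ l, ∃ p : Fin Nst × Fin Np, coords P Q (y l) p.2 p.1 ≠ 0 ∧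
      ∀ q : Fin Nst × Fin Np, coords P Q (y l) q.2 q.1 ≠ 0 → a p.1 + b p.2 ≤ a q.1 + b q.2 := by
    intro l
    have hne : (Finset.univ.filter fun p : Fin Nst × Fin Np =>
        coords P Q (y l) p.2 p.1 ≠ 0).Nonempty := by
      by_contra hcon
      rw [Finset.not_nonempty_iff_eq_empty, Finset.filter_eq_empty_iff] at hcon
      apply coords_ne_zero hP hQ (hy l)
      ext j i
      exact not_not.1 (hcon (x := (i, j)) (Finset.mem_univ _))
    obtain ⟨p, hp, hmin⟩ := Finset.exists_min_image _ (fun p => a p.1 + b p.2) hne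
    exact ⟨p, (Finset.mem_filter.1 hp).2, fun q hq =>
      hmin q (Finset.mem_filter.2 ⟨Finset.mem_univ _, hq⟩)⟩
  choose p hp hmin using hex
  refine ⟨fun l => a (p l).1 + b (p l).2, weight ρst Nst * ∑ i, ρst * invGram P i
    + weight ρp Np * ∑ j, ρp * invGram Q j
    - (∑ l, Real.log (mass P Q (y l) (p l).1 (p l).2)) / L,
    fun l i j h => hmin l (i, j) h, fun t => ?_⟩
  have h1 : (∑ l, (Real.log (mass P Q (y l) (p l).1 (p l).2) -
      t * (a (p l).1 + b (p l).2))) / L ≤ (∑ l, Real.log (∑ q : Fin Nst × Fin Np,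
        mass P Q (y l) q.1 q.2 * Real.exp (-((t • a) q.1 + (t • b) q.2)))) / L := by
    refine div_le_div_of_nonneg_right (Finset.sum_le_sum fun l _ => ?_) (Nat.cast_nonneg _)
    have hm := mass_pos hP hQ (hy l) (hp l)
    rw [sub_eq_add_neg, ← Real.log_exp (-(t * (a (p l).1 + b (p l).2))),
      ← Real.log_mul hm.ne' (Real.exp_pos _).ne']
    refine Real.log_le_log (mul_pos hm (Real.exp_pos _)) ?_
    have h2 := Finset.single_le_sum (f := fun q : Fin Nst × Fin Np =>
      mass P Q (y l) q.1 q.2 * Real.exp (-((t • a) q.1 + (t • b) q.2)))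
      (fun q _ => mul_nonneg (mass_nonneg _ _ _) (Real.exp_pos _).le) (Finset.mem_univ (p l))
    refine le_trans (le_of_eq ?_) h2
    simp only [Pi.smul_apply, smul_eq_mul, mul_add]
  rw [Finset.sum_sub_distrib, ← Finset.mul_sum, sub_div] at h1
  have h3 : ∀ {N : ℕ} (c k : Fin N → ℝ) (ρ : ℝ),
      ∑ i, ((t • c) i + ρ * k i * (Real.exp (-(t • c) i) - 1)) =
      t * ∑ i, c i + ∑ i, ρ * k i * Real.exp (t * -c i) - ∑ i, ρ * k i := by
    intro N c k ρ
    rw [Finset.mul_sum, ← Finset.sum_add_distrib, ← Finset.sum_sub_distrib]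
    refine Finset.sum_congr rfl fun i _ => ?_
    simp only [Pi.smul_apply, smul_eq_mul, mul_neg]
    ring
  unfold energy
  rw [h3 a (invGram P) ρst, h3 b (invGram Q) ρp]
  have h4 : t * (∑ l, (a (p l).1 + b (p l).2)) / L = t * ((∑ l, (a (p l).1 + b (p l).2)) / L) :=
    mul_div_assoc _ _ _
  rw [h4] at h1
  linarith

/-- The energy exceeds `1` along every admissible ray. -/
theorem exists_one_lt_energy (hL : 0 < L) (hNst : 0 < Nst) (hNp : 0 < Np)
    (hρst : ρst ∈ Set.Ico (0 : ℝ) 1) (hρp : ρp ∈ Set.Ico (0 : ℝ) 1)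
    (h : ExistenceCondition y ρst ρp) (hP : IsUnit P) (hQ : IsUnit Q) {a : Fin Nst → ℝ}
    {b : Fin Np → ℝ} (hab : a ≠ 0 ∨ b ≠ 0) (ha : ρst = 0 → ∑ i, a i = 0)
    (hb : ρp = 0 → ∑ j, b j = 0) :
    ∃ t : ℝ, 0 < t ∧ 1 < energy y ρst ρp P Q (t • a) (t • b) := by
  have : Nonempty (Fin Nst) := ⟨⟨0, hNst⟩⟩
  have : Nonempty (Fin Np) := ⟨⟨0, hNp⟩⟩
  obtain ⟨m, K, hm, hE⟩ := exists_energy_ge hP hQ (h.ne_zero hNp) ρst ρp a b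
  set E := weight ρst Nst * ∑ i, a i + weight ρp Np * ∑ j, b j - (∑ l, m l) / L with hEdef
  have hw := weight_pos hρst.2 hNst
  have hw' := weight_pos hρp.2 hNp
  have hnn : ∀ {N : ℕ} (T : Matrix (Fin N) (Fin N) ℂ) (c : Fin N → ℝ) {ρ : ℝ}, 0 ≤ ρ → IsUnit T →
      ∀ i, 0 ≤ ρ * invGram T i * Real.exp (c i) := fun T c ρ hρ hT i =>
    mul_nonneg (mul_nonneg hρ (invGram_pos hT i).le) (Real.exp_pos _).le
  have hs1 : ∀ t : ℝ, 0 ≤ weight ρst Nst * ∑ i, ρst * invGram P i * Real.exp (t * -a i) :=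
    fun t => mul_nonneg hw.le (Finset.sum_nonneg fun i _ =>
      hnn P (fun i => t * -a i) hρst.1 hP i)
  have hs2 : ∀ t : ℝ, 0 ≤ weight ρp Np * ∑ j, ρp * invGram Q j * Real.exp (t * -b j) :=
    fun t => mul_nonneg hw'.le (Finset.sum_nonneg fun i _ =>
      hnn Q (fun i => t * -b i) hρp.1 hQ i)
  -- A negative exponent of a penalized factor makes the trace penalty grow exponentially, whatever
  -- the linear part is.
  by_cases hA : 0 < ρst ∧ ∃ i, a i < 0
  · obtain ⟨hρ, i, hi⟩ := hA
    obtain ⟨t, ht, hlt⟩ := exists_lt_add_exp (E := E) (K := K + 1)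
      (mul_pos hw (mul_pos hρ (invGram_pos hP i))) (neg_pos.2 hi)
    refine ⟨t, ht, ?_⟩
    have h1 := Finset.single_le_sum (f := fun i => ρst * invGram P i * Real.exp (t * -a i))
      (fun i _ => hnn P (fun i => t * -a i) hρst.1 hP i) (Finset.mem_univ i)
    have h2 := mul_le_mul_of_nonneg_left h1 hw.le
    have h3 := hE t
    have h4 := hs2 t
    linarith
  by_cases hB : 0 < ρp ∧ ∃ j, b j < 0
  · obtain ⟨hρ, j, hj⟩ := hB
    obtain ⟨t, ht, hlt⟩ := exists_lt_add_exp (E := E) (K := K + 1)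
      (mul_pos hw' (mul_pos hρ (invGram_pos hQ j))) (neg_pos.2 hj)
    refine ⟨t, ht, ?_⟩
    have h1 := Finset.single_le_sum (f := fun i => ρp * invGram Q i * Real.exp (t * -b i))
      (fun i _ => hnn Q (fun i => t * -b i) hρp.1 hQ i) (Finset.mem_univ j)
    have h2 := mul_le_mul_of_nonneg_left h1 hw'.le
    have h3 := hE t
    have h4 := hs1 t
    linarith
  -- In the remaining case the linear part has positive slope. The recession inequality is strict
  -- unless a and b are constant; a nonzero constant is impossible for an unpenalized factor, whose
  -- exponents sum to 0, and contributes ρ/(1-ρ) times a positive number for a penalized one.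
  have hEpos : 0 < E := by
    obtain ⟨ia, hia⟩ := Finite.exists_min a
    obtain ⟨jb, hjb⟩ := Finite.exists_min b
    have hrec := recession_inequality hL hNst hNp hρst.2 hρp.2 h hP hQ hia ⟨ia, rfl⟩ hjb
      ⟨jb, rfl⟩ hm
    rw [weight_mul_card_sub_one hρst.2 hNst, weight_mul_card_sub_one hρp.2 hNp] at hrec
    have key : ∀ {N : ℕ} {ρ : ℝ} {c : Fin N → ℝ} {i : Fin N}, ρ ∈ Set.Ico (0 : ℝ) 1 →
        ¬ (0 < ρ ∧ ∃ i, c i < 0) → (ρ = 0 → ∑ i, c i = 0) → 0 ≤ ρ / (1 - ρ) * c i ∧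
        ((∀ k, c k = c i) → c ≠ 0 → 0 < ρ / (1 - ρ) * c i) := by
      intro N ρ c i hρ h1 h2
      have h1ρ : 0 < 1 - ρ := by linarith [hρ.2]
      rcases hρ.1.eq_or_lt with h0 | h0
      · subst h0
        refine ⟨by simp, fun h3 h4 => (h4 ?_).elim⟩
        have h5 := h2 rfl
        simp only [h3, Finset.sum_const, Finset.card_univ, Fintype.card_fin, nsmul_eq_mul] at h5
        have hN : (N : ℝ) ≠ 0 := by
          exact_mod_cast (lt_of_le_of_lt (Nat.zero_le _) i.2).ne'
        have h6 := (mul_eq_zero.1 h5).resolve_left hN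
        ext k; rw [h3 k, h6]; rfl
      · have h3 : 0 ≤ c i := by
          by_contra h4; exact h1 ⟨h0, i, not_le.1 h4⟩
        refine ⟨by positivity, fun h4 h5 => mul_pos (div_pos h0 h1ρ) (lt_of_le_of_ne h3 ?_)⟩
        intro h6
        apply h5
        ext k; rw [h4 k, ← h6]; rfl
    have ka := key (i := ia) hρst hA ha
    have kb := key (i := jb) hρp hB hb
    by_cases hc : (∃ i, a i ≠ a ia) ∨ ∃ j, b j ≠ b jb
    · have := hrec.2 hc
      linarith [ka.1, kb.1]
    · push Not at hc
      have h0 := hrec.1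
      rcases hab with h1 | h1
      · have := ka.2 hc.1 h1
        linarith [kb.1]
      · have := kb.2 hc.2 h1
        linarith [ka.1]
  obtain ⟨t, ht, hlt⟩ := exists_lt_mul (K + 1) hEpos
  refine ⟨t, ht, ?_⟩
  have h3 := hE t
  have h4 := hs1 t
  have h5 := hs2 t
  linarith

end Rays

/-! ### Coercivity modulo the scale of unpenalized factors -/

section Coercivity

variable {L Nst Np : ℕ} {y : Fin L → Fin Nst × Fin Np → ℂ} {ρst ρp : ℝ}

theorem mul_conjTranspose_of_mem_unitary {n : Type*} [Fintype n] [DecidableEq n] {U : Matrix n n ℂ}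
    (hU : U ∈ Matrix.unitaryGroup n ℂ) : U * Uᴴ = 1 :=
  Matrix.mem_unitaryGroup_iff.1 hU

theorem log_det_expCongr {n : Type*} [Fintype n] [DecidableEq n] {U : Matrix n n ℂ}
    (hU : U ∈ Matrix.unitaryGroup n ℂ) (a : n → ℝ) :
    Real.log (expCongr U a).det.re = ∑ i, a i := by
  have hU' := isUnit_of_mem_unitary hU
  have h1 := log_det_congr hU' (d := fun i => Real.exp (a i)) (fun i => Real.exp_pos _)
  have h2 := log_det_congr hU' (d := fun _ => 1) (fun _ => one_pos)
  rw [rdiag_one, Matrix.mul_one, mul_conjTranspose_of_mem_unitary hU] at h2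
  simp only [Matrix.det_one, Complex.one_re, Real.log_one, Finset.sum_const_zero, add_zero] at h2
  rw [expCongr, h1, ← h2]
  simp

theorem continuous_expCongr_comp {n Z : Type*} [Fintype n] [DecidableEq n] [TopologicalSpace Z]
    {f : Z → Matrix n n ℂ} {g : Z → n → ℝ} (hf : Continuous f) (hg : Continuous g) :
    Continuous fun z => expCongr (f z) (g z) :=
  Continuous.comp (g := fun p : Matrix n n ℂ × (n → ℝ) => expCongr p.1 p.2)
    (f := fun z => (f z, g z)) continuous_expCongr (hf.prodMk hg)

theorem continuousAt_cost_expCongr (hy : ∀ l, y l ≠ 0) (ρst ρp : ℝ)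
    {P : Matrix (Fin Nst) (Fin Nst) ℂ} {Q : Matrix (Fin Np) (Fin Np) ℂ} (hP : IsUnit P)
    (hQ : IsUnit Q) (t : ℝ) (a : Fin Nst → ℝ) (b : Fin Np → ℝ) :
    ContinuousAt (fun z : Matrix (Fin Nst) (Fin Nst) ℂ × Matrix (Fin Np) (Fin Np) ℂ ×
      (Fin Nst → ℝ) × (Fin Np → ℝ) =>
        cost y ρst ρp (expCongr z.1 (t • z.2.2.1)) (expCongr z.2.1 (t • z.2.2.2))) (P, Q, a, b) := by
  have h3 := continuous_expCongr_comp (Z := Matrix (Fin Nst) (Fin Nst) ℂ × Matrix (Fin Np) (Fin Np) ℂ ×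
      (Fin Nst → ℝ) × (Fin Np → ℝ)) (f := fun z => z.1) (g := fun z => t • z.2.2.1) continuous_fst
    ((continuous_fst.comp (continuous_snd.comp continuous_snd)).const_smul t)
  have h4 := continuous_expCongr_comp (Z := Matrix (Fin Nst) (Fin Nst) ℂ × Matrix (Fin Np) (Fin Np) ℂ ×
      (Fin Nst → ℝ) × (Fin Np → ℝ)) (f := fun z => z.2.1) (g := fun z => t • z.2.2.2)
    (continuous_fst.comp continuous_snd)
    ((continuous_snd.comp (continuous_snd.comp continuous_snd)).const_smul t)
  have h5 := continuousAt_cost hy ρst ρp (posDef_expCongr hP (t • a)) (posDef_expCongr hQ (t • b))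
  exact ContinuousAt.comp (f := fun z : Matrix (Fin Nst) (Fin Nst) ℂ × Matrix (Fin Np) (Fin Np) ℂ ×
      (Fin Nst → ℝ) × (Fin Np → ℝ) => (expCongr z.1 (t • z.2.2.1), expCongr z.2.1 (t • z.2.2.2)))
    (g := fun p => cost y ρst ρp p.1 p.2) (x := (P, Q, a, b)) h5 (h3.prodMk h4).continuousAt

/-- The energy grows at least linearly, uniformly in the eigenbases. -/
theorem exists_norm_le_energy (hL : 0 < L) (hNst : 0 < Nst) (hNp : 0 < Np)
    (hρst : ρst ∈ Set.Ico (0 : ℝ) 1) (hρp : ρp ∈ Set.Ico (0 : ℝ) 1)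
    (h : ExistenceCondition y ρst ρp) :
    ∃ T : ℝ, 0 < T ∧ ∀ U ∈ Matrix.unitaryGroup (Fin Nst) ℂ, ∀ V ∈ Matrix.unitaryGroup (Fin Np) ℂ,
      ∀ x : (Fin Nst → ℝ) × (Fin Np → ℝ), (ρst = 0 → ∑ i, x.1 i = 0) →
        (ρp = 0 → ∑ j, x.2 j = 0) → T ≤ ‖x‖ → ‖x‖ ≤ T * energy y ρst ρp U V x.1 x.2 := by
  have hy := h.ne_zero hNp
  have hN : (0 : ℝ) < Nst * Np := by
    have : (0 : ℝ) < Nst := by exact_mod_cast hNst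
    have : (0 : ℝ) < Np := by exact_mod_cast hNp
    positivity
  set C : Set ((Fin Nst → ℝ) × (Fin Np → ℝ)) := {x | (ρst = 0 → ∑ i, x.1 i = 0) ∧ (ρp = 0 → ∑ j, x.2 j = 0)} with hCdef
  have hC : IsClosed C := by
    have h1 : IsClosed {x : (Fin Nst → ℝ) × (Fin Np → ℝ) | ρst = 0 → ∑ i, x.1 i = 0} := by
      by_cases h0 : ρst = 0
      · simp only [h0, forall_const]
        exact isClosed_eq (by fun_prop) continuous_const
      · simp [h0]
    have h2 : IsClosed {x : (Fin Nst → ℝ) × (Fin Np → ℝ) | ρp = 0 → ∑ j, x.2 j = 0} := by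
      by_cases h0 : ρp = 0
      · simp only [h0, forall_const]
        exact isClosed_eq (by fun_prop) continuous_const
      · simp [h0]
    exact h1.inter h2
  set K : Set (Matrix (Fin Nst) (Fin Nst) ℂ × Matrix (Fin Np) (Fin Np) ℂ ×
      (Fin Nst → ℝ) × (Fin Np → ℝ)) :=
    {U | U ∈ Matrix.unitaryGroup (Fin Nst) ℂ} ×ˢ ({V | V ∈ Matrix.unitaryGroup (Fin Np) ℂ} ×ˢ
      (Metric.sphere (0 : (Fin Nst → ℝ) × (Fin Np → ℝ)) 1 ∩ C)) with hKdef
  have hK : IsCompact K :=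
    isCompact_unitary.prod (isCompact_unitary.prod ((isCompact_sphere _ _).inter_right hC))
  have hcost : ∀ z ∈ K, ∀ t : ℝ,
      cost y ρst ρp (expCongr z.1 (t • z.2.2.1)) (expCongr z.2.1 (t • z.2.2.2)) =
      cost y ρst ρp 1 1 + Nst * Np * energy y ρst ρp z.1 z.2.1 (t • z.2.2.1) (t • z.2.2.2) := by
    rintro ⟨U, V, a, b⟩ ⟨hU, hV, -⟩ t
    rw [cost_expCongr hNst hNp (isUnit_of_mem_unitary hU) (isUnit_of_mem_unitary hV) hy hρst.2
      hρp.2, mul_conjTranspose_of_mem_unitary hU, mul_conjTranspose_of_mem_unitary hV]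
  have main : ∃ T : ℝ, 0 < T ∧ ∀ z ∈ K, ∀ t : ℝ, T ≤ t →
      t ≤ T * energy y ρst ρp z.1 z.2.1 (t • z.2.2.1) (t • z.2.2.2) := by
    refine hK.induction_on (p := fun s => ∃ T : ℝ, 0 < T ∧ ∀ z ∈ s, ∀ t : ℝ, T ≤ t →
      t ≤ T * energy y ρst ρp z.1 z.2.1 (t • z.2.2.1) (t • z.2.2.2)) ?_ ?_ ?_ ?_
    · exact ⟨1, one_pos, fun z hz => hz.elim⟩
    · rintro s s' hss ⟨T, hT, hs⟩
      exact ⟨T, hT, fun z hz => hs z (hss hz)⟩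
    · rintro s s' ⟨T, hT, hs⟩ ⟨T', hT', hs'⟩
      -- Constants can be enlarged: for t ≥ B > 0 the bound forces a positive energy. Hence
      -- compactness reduces the claim to neighbourhoods of single points.
      have key : ∀ {A B t e : ℝ}, 0 < A → A ≤ B → B ≤ t → t ≤ A * e → t ≤ B * e := by
        intro A B t e hA hAB hBt hte
        have he : 0 < e := by
          by_contra hcon
          nlinarith
        nlinarith
      refine ⟨max T T', lt_max_of_lt_left hT, ?_⟩
      rintro z (hz | hz) t ht
      · exact key hT (le_max_left _ _) ht (hs z hz t (le_trans (le_max_left _ _) ht))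
      · exact key hT' (le_max_right _ _) ht (hs' z hz t (le_trans (le_max_right _ _) ht))
    · rintro z₀ hz₀
      obtain ⟨U₀, V₀, a₀, b₀⟩ := z₀
      have hz₀' := hz₀
      obtain ⟨hU₀, hV₀, hn, hca, hcb⟩ := hz₀
      have hne : a₀ ≠ 0 ∨ b₀ ≠ 0 := by
        by_contra hcon
        push Not at hcon
        rw [hcon.1, hcon.2] at hn
        simp at hn
      obtain ⟨t₀, ht₀, hlt⟩ := exists_one_lt_energy hL hNst hNp hρst hρp h
        (isUnit_of_mem_unitary hU₀) (isUnit_of_mem_unitary hV₀) hne hca hcb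
      -- The energy differs from the cost by an affine change that is the same on all of K, so the
      -- condition that it exceeds 1 at t₀ is open there.
      have hc := continuousAt_cost_expCongr hy ρst ρp (isUnit_of_mem_unitary hU₀)
        (isUnit_of_mem_unitary hV₀) t₀ a₀ b₀
      have h1 := hcost _ hz₀' t₀
      have h2 : cost y ρst ρp 1 1 + Nst * Np <
          cost y ρst ρp (expCongr U₀ (t₀ • a₀)) (expCongr V₀ (t₀ • b₀)) := by
        rw [h1]
        nlinarith
      have h3 := hc.eventually (lt_mem_nhds h2)
      refine ⟨_, inter_mem_nhdsWithin K h3, t₀, ht₀, ?_⟩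
      rintro z ⟨hzK, hz⟩ t ht
      have ht0 : 0 < t := lt_of_lt_of_le ht₀ ht
      have h4 := hcost z hzK t₀
      have h5 : 1 < energy y ρst ρp z.1 z.2.1 (t₀ • z.2.2.1) (t₀ • z.2.2.2) := by
        have h6 : cost y ρst ρp 1 1 + Nst * Np <
          cost y ρst ρp (expCongr z.1 (t₀ • z.2.2.1)) (expCongr z.2.1 (t₀ • z.2.2.2)) := hz
        rw [h4] at h6
        by_contra hcon
        have := mul_le_mul_of_nonneg_left (not_lt.1 hcon) hN.le
        linarith
      -- From t₀ the bound passes to every t ≥ t₀: 1 < energy at t₀ ≤ (t₀/t) · energy at t.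
      have h7 := energy_mul_le (isUnit_of_mem_unitary hzK.1) (isUnit_of_mem_unitary hzK.2.1) hNst
        hNp hy hρst hρp (t • z.2.2.1) (t • z.2.2.2) (τ := t₀ / t) (by positivity)
        ((div_le_one ht0).2 ht)
      rw [smul_smul, smul_smul, div_mul_cancel₀ _ ht0.ne', div_mul_eq_mul_div,
        le_div_iff₀ ht0] at h7
      nlinarith
  obtain ⟨T, hT, hmain⟩ := main
  refine ⟨T, hT, fun U hU V hV x hx1 hx2 hTx => ?_⟩
  have hx0 : 0 < ‖x‖ := lt_of_lt_of_le hT hTx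
  have h1 := hmain (U, V, ‖x‖⁻¹ • x) ⟨hU, hV, by
      simp [norm_smul, hx0.ne'], fun h0 => by
      simp only [Prod.smul_fst, Pi.smul_apply, smul_eq_mul, ← Finset.mul_sum, hx1 h0, mul_zero],
      fun h0 => by
      simp only [Prod.smul_snd, Pi.smul_apply, smul_eq_mul, ← Finset.mul_sum, hx2 h0, mul_zero]⟩
      ‖x‖ hTx
  simpa only [Prod.smul_fst, Prod.smul_snd, smul_smul, mul_inv_cancel₀ hx0.ne', one_smul] using h1

/-- Sublevel sets of the cost are bounded once the scale of the unpenalized factors is fixed. -/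
theorem exists_boundedPosDef_of_log_det_eq_zero (hL : 0 < L) (hNst : 0 < Nst) (hNp : 0 < Np)
    (hρst : ρst ∈ Set.Ico (0 : ℝ) 1) (hρp : ρp ∈ Set.Ico (0 : ℝ) 1)
    (h : ExistenceCondition y ρst ρp) (C : ℝ) :
    ∃ B : ℝ, ∀ (R : Matrix (Fin Nst) (Fin Nst) ℂ) (S : Matrix (Fin Np) (Fin Np) ℂ), R.PosDef →
      S.PosDef → (ρst = 0 → Real.log R.det.re = 0) → (ρp = 0 → Real.log S.det.re = 0) →
      cost y ρst ρp R S ≤ C → R ∈ boundedPosDef (Fin Nst) B ∧ S ∈ boundedPosDef (Fin Np) B := by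
  obtain ⟨T, hT, hmain⟩ := exists_norm_le_energy hL hNst hNp hρst hρp h
  have hN : (0 : ℝ) < Nst * Np := by
    have : (0 : ℝ) < Nst := by exact_mod_cast hNst
    have : (0 : ℝ) < Np := by exact_mod_cast hNp
    positivity
  have hspec : ∀ {N : ℕ} {A : Matrix (Fin N) (Fin N) ℂ}, A.PosDef →
      ∃ U ∈ Matrix.unitaryGroup (Fin N) ℂ, ∃ a : Fin N → ℝ, A = expCongr U a := by
    intro N A hA
    obtain ⟨U, hU, d, hd, rfl⟩ := posDef_spectral hA
    refine ⟨U, hU, fun i => Real.log (d i), ?_⟩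
    simp only [expCongr, Real.exp_log (hd _)]
  refine ⟨max T (T * ((C - cost y ρst ρp 1 1) / (Nst * Np))), fun R S hR hS hR0 hS0 hcost => ?_⟩
  obtain ⟨U, hU, a, rfl⟩ := hspec hR
  obtain ⟨V, hV, b, rfl⟩ := hspec hS
  rw [log_det_expCongr hU] at hR0
  rw [log_det_expCongr hV] at hS0
  rw [cost_expCongr hNst hNp (isUnit_of_mem_unitary hU) (isUnit_of_mem_unitary hV)
    (h.ne_zero hNp) hρst.2 hρp.2, mul_conjTranspose_of_mem_unitary hU,
    mul_conjTranspose_of_mem_unitary hV] at hcost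
  have he : energy y ρst ρp U V a b ≤ (C - cost y ρst ρp 1 1) / (Nst * Np) := by
    rw [le_div_iff₀ hN]; linarith
  have hn : ‖(a, b)‖ ≤ max T (T * ((C - cost y ρst ρp 1 1) / (Nst * Np))) := by
    rcases le_total T ‖(a, b)‖ with h1 | h1
    · exact le_trans (le_trans (hmain U hU V hV (a, b) hR0 hS0 h1)
        (mul_le_mul_of_nonneg_left he hT.le)) (le_max_right _ _)
    · exact le_trans h1 (le_max_left _ _)
  refine ⟨⟨(U, a), ⟨hU, fun i _ => ?_⟩, rfl⟩, ⟨(V, b), ⟨hV, fun j _ => ?_⟩, rfl⟩⟩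
  · exact abs_le.1 (le_trans (le_trans (norm_le_pi_norm a i) (norm_fst_le (a, b))) hn)
  · exact abs_le.1 (le_trans (le_trans (norm_le_pi_norm b j) (norm_snd_le (a, b))) hn)

theorem log_det_exp_smul {N : ℕ} {A : Matrix (Fin N) (Fin N) ℂ} (hA : A.PosDef) (s : ℝ) :
    Real.log (Real.exp s • A).det.re = N * s + Real.log A.det.re := by
  have h1 : (Real.exp s • A).det = ((Real.exp s ^ N : ℝ) : ℂ) * A.det := by
    have : Real.exp s • A = ((Real.exp s : ℝ) : ℂ) • A := by ext i j; simp
    rw [this, Matrix.det_smul, Fintype.card_fin, Complex.ofReal_pow]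
  rw [h1, Complex.re_ofReal_mul, Real.log_mul (by positivity) (det_re_pos hA).ne', Real.log_pow,
    Real.log_exp]

/-- Without shrinkage the weight times Nst is 1, so the log-determinant gains exactly what the
quadratic forms lose. -/
theorem cost_exp_smul_left (hL : 0 < L) (hNst : 0 < Nst) (hNp : 0 < Np) (hy : ∀ l, y l ≠ 0)
    (hρp : ρp < 1) {R : Matrix (Fin Nst) (Fin Nst) ℂ} {S : Matrix (Fin Np) (Fin Np) ℂ}
    (hR : R.PosDef) (hS : S.PosDef) (s : ℝ) :
    cost y 0 ρp (Real.exp s • R) S = cost y 0 ρp R S := by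
  obtain ⟨P, hP, rfl⟩ := posDef_eq_mul_conjTranspose hR
  obtain ⟨Q, hQ, rfl⟩ := posDef_eq_mul_conjTranspose hS
  have h1 := cost_congr_eq hNst hNp hP hQ hy (zero_lt_one (α := ℝ)) hρp
    (d := fun _ => Real.exp s) (e := fun _ => 1) (fun _ => Real.exp_pos _) (fun _ => one_pos)
  have h2 : P * rdiag (fun _ => Real.exp s) * Pᴴ = Real.exp s • (P * Pᴴ) := by
    have : rdiag (fun _ : Fin Nst => Real.exp s) = Real.exp s • 1 := by
      ext i j; simp [rdiag, Matrix.diagonal_apply, Matrix.one_apply]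
    rw [this, Matrix.mul_smul, Matrix.smul_mul, Matrix.mul_one]
  rw [h2, rdiag_one, Matrix.mul_one] at h1
  rw [h1]
  have h3 : ∀ l, Real.log (∑ i, ∑ j, mass P Q (y l) i j * ((Real.exp s)⁻¹ * 1)) = -s := by
    intro l
    simp only [← Finset.sum_mul, sum_mass hP hQ (hy l)]
    rw [mul_one, one_mul, Real.log_inv, Real.log_exp]
  have hw := weight_mul (zero_lt_one (α := ℝ)) hNst
  have hLr : (L : ℝ) ≠ 0 := by exact_mod_cast hL.ne'
  simp only [inv_one, h3]
  simp only [Real.log_exp, Real.log_one, zero_mul, add_zero, Finset.sum_const,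
    Finset.card_univ, Fintype.card_fin, nsmul_eq_mul, sub_self, mul_zero]
  have h4 : (L : ℝ) * -s / L = -s := by field_simp
  rw [h4, ← mul_assoc (weight 0 Nst)]
  rw [sub_zero, one_mul] at hw
  rw [hw]; ring

theorem cost_exp_smul_right (hL : 0 < L) (hNst : 0 < Nst) (hNp : 0 < Np) (hy : ∀ l, y l ≠ 0)
    (hρst : ρst < 1) {R : Matrix (Fin Nst) (Fin Nst) ℂ} {S : Matrix (Fin Np) (Fin Np) ℂ}
    (hR : R.PosDef) (hS : S.PosDef) (s : ℝ) :
    cost y ρst 0 R (Real.exp s • S) = cost y ρst 0 R S := by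
  rw [← cost_swapData y, ← cost_swapData y]
  refine cost_exp_smul_left hL hNp hNst (fun l h0 => hy l ?_) hρst hS hR s
  ext ⟨i, j⟩
  exact congrFun h0 (j, i)

theorem posDef_exp_smul {n : Type*} [Fintype n] [DecidableEq n] {A : Matrix n n ℂ} (hA : A.PosDef)
    (s : ℝ) : (Real.exp s • A).PosDef :=
  hA.smul (Real.exp_pos s)

/-- Every pair is a rescaling of one with normalized unpenalized factors and the same cost. -/
theorem exists_normalization (hL : 0 < L) (hNst : 0 < Nst) (hNp : 0 < Np) (hy : ∀ l, y l ≠ 0)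
    (hρst : ρst < 1) (hρp : ρp < 1) {R : Matrix (Fin Nst) (Fin Nst) ℂ}
    {S : Matrix (Fin Np) (Fin Np) ℂ} (hR : R.PosDef) (hS : S.PosDef) :
    ∃ s t : ℝ, (ρst = 0 → Nst * s = Real.log R.det.re) ∧ (ρst ≠ 0 → s = 0) ∧
      (ρp = 0 → Np * t = Real.log S.det.re) ∧ (ρp ≠ 0 → t = 0) ∧
      (ρst = 0 → Real.log (Real.exp (-s) • R).det.re = 0) ∧
      (ρp = 0 → Real.log (Real.exp (-t) • S).det.re = 0) ∧
      cost y ρst ρp (Real.exp (-s) • R) (Real.exp (-t) • S) = cost y ρst ρp R S := by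
  have hNr : (Nst : ℝ) ≠ 0 := by exact_mod_cast hNst.ne'
  have hMr : (Np : ℝ) ≠ 0 := by exact_mod_cast hNp.ne'
  have hs : ∃ s : ℝ, (ρst = 0 → Nst * s = Real.log R.det.re) ∧ (ρst ≠ 0 → s = 0) := by
    by_cases h0 : ρst = 0
    · exact ⟨Real.log R.det.re / Nst, fun _ => by field_simp, fun h => (h h0).elim⟩
    · exact ⟨0, fun h => (h0 h).elim, fun _ => rfl⟩
  have ht : ∃ t : ℝ, (ρp = 0 → Np * t = Real.log S.det.re) ∧ (ρp ≠ 0 → t = 0) := by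
    by_cases h0 : ρp = 0
    · exact ⟨Real.log S.det.re / Np, fun _ => by field_simp, fun h => (h h0).elim⟩
    · exact ⟨0, fun h => (h0 h).elim, fun _ => rfl⟩
  obtain ⟨s, hs1, hs2⟩ := hs
  obtain ⟨t, ht1, ht2⟩ := ht
  refine ⟨s, t, hs1, hs2, ht1, ht2, fun h0 => ?_, fun h0 => ?_, ?_⟩
  · rw [log_det_exp_smul hR, ← hs1 h0]; ring
  · rw [log_det_exp_smul hS, ← ht1 h0]; ring
  · have h1 : cost y ρst ρp (Real.exp (-s) • R) (Real.exp (-t) • S) =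
        cost y ρst ρp R (Real.exp (-t) • S) := by
      by_cases h0 : ρst = 0
      · subst h0
        exact cost_exp_smul_left hL hNst hNp hy hρp hR (posDef_exp_smul hS _) _
      · rw [hs2 h0, neg_zero, Real.exp_zero, one_smul]
    rw [h1]
    by_cases h0 : ρp = 0
    · subst h0
      exact cost_exp_smul_right hL hNst hNp hy hρst hR hS _
    · rw [ht2 h0, neg_zero, Real.exp_zero, one_smul]

/-- A bounded log-determinant means that a pair is normalized by a bounded scaling, which enlarges
the bound on the logarithmic eigenvalues by at most |D|. -/
theorem exists_boundedPosDef (hL : 0 < L) (hNst : 0 < Nst) (hNp : 0 < Np)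
    (hρst : ρst ∈ Set.Ico (0 : ℝ) 1) (hρp : ρp ∈ Set.Ico (0 : ℝ) 1)
    (h : ExistenceCondition y ρst ρp) (C D : ℝ) :
    ∃ B : ℝ, ∀ (R : Matrix (Fin Nst) (Fin Nst) ℂ) (S : Matrix (Fin Np) (Fin Np) ℂ), R.PosDef →
      S.PosDef → (ρst = 0 → |Real.log R.det.re| ≤ D) → (ρp = 0 → |Real.log S.det.re| ≤ D) →
      cost y ρst ρp R S ≤ C → R ∈ boundedPosDef (Fin Nst) B ∧ S ∈ boundedPosDef (Fin Np) B := by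
  obtain ⟨B, hB⟩ := exists_boundedPosDef_of_log_det_eq_zero hL hNst hNp hρst hρp h C
  refine ⟨B + |D|, fun R S hR hS hR0 hS0 hcost => ?_⟩
  obtain ⟨s, t, hs1, hs2, ht1, ht2, hs, ht, hc⟩ :=
    exists_normalization hL hNst hNp (h.ne_zero hNp) hρst.2 hρp.2 hR hS
  obtain ⟨h1, h2⟩ := hB _ _ (posDef_exp_smul hR (-s)) (posDef_exp_smul hS (-t)) hs ht
    (hc.trans_le hcost)
  have key : ∀ {N : ℕ} {ρ u d : ℝ}, 0 < N → (ρ = 0 → N * u = d) → (ρ ≠ 0 → u = 0) →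
      (ρ = 0 → |d| ≤ D) → |u| ≤ |D| := by
    intro N ρ u d hN h1 h2 h3
    by_cases h0 : ρ = 0
    · have h4 := h3 h0
      rw [← h1 h0, abs_mul, Nat.abs_cast] at h4
      have h5 : (1 : ℝ) ≤ N := by exact_mod_cast hN
      have h6 : 1 * |u| ≤ N * |u| := mul_le_mul_of_nonneg_right h5 (abs_nonneg u)
      linarith [le_abs_self D]
    · rw [h2 h0, abs_zero]; exact abs_nonneg D
  have hcancel : ∀ {N : ℕ} (A : Matrix (Fin N) (Fin N) ℂ) (u : ℝ),
      Real.exp u • Real.exp (-u) • A = A := by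
    intro N A u
    rw [smul_smul, ← Real.exp_add, add_neg_cancel, Real.exp_zero, one_smul]
  have h3 := smul_mem_boundedPosDef h1 (key hNst hs1 hs2 hR0)
  have h4 := smul_mem_boundedPosDef h2 (key hNp ht1 ht2 hS0)
  rw [hcancel] at h3 h4
  exact ⟨h3, h4⟩

/-- Normalized pairs with cost at most 0 lie in a compact set, where continuity gives a lower bound;
the level 0 is arbitrary. -/
theorem exists_cost_ge (hL : 0 < L) (hNst : 0 < Nst) (hNp : 0 < Np)
    (hρst : ρst ∈ Set.Ico (0 : ℝ) 1) (hρp : ρp ∈ Set.Ico (0 : ℝ) 1)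
    (h : ExistenceCondition y ρst ρp) :
    ∃ m : ℝ, ∀ (R : Matrix (Fin Nst) (Fin Nst) ℂ) (S : Matrix (Fin Np) (Fin Np) ℂ), R.PosDef →
      S.PosDef → m ≤ cost y ρst ρp R S := by
  obtain ⟨B, hB⟩ := exists_boundedPosDef_of_log_det_eq_zero hL hNst hNp hρst hρp h 0
  have hK := (isCompact_boundedPosDef (n := Fin Nst) B).prod
    (isCompact_boundedPosDef (n := Fin Np) B)
  have hcont : ContinuousOn (fun p : Matrix (Fin Nst) (Fin Nst) ℂ × Matrix (Fin Np) (Fin Np) ℂ =>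
      cost y ρst ρp p.1 p.2) (boundedPosDef (Fin Nst) B ×ˢ boundedPosDef (Fin Np) B) := by
    rintro ⟨R, S⟩ ⟨hR, hS⟩
    exact (continuousAt_cost (h.ne_zero hNp) ρst ρp (posDef_of_mem_boundedPosDef hR)
      (posDef_of_mem_boundedPosDef hS)).continuousWithinAt
  obtain ⟨m, hm⟩ := hK.bddBelow_image hcont
  refine ⟨min m 0, fun R S hR hS => ?_⟩
  obtain ⟨s, t, -, -, -, -, hs, ht, hc⟩ :=
    exists_normalization hL hNst hNp (h.ne_zero hNp) hρst.2 hρp.2 hR hS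
  rw [← hc]
  rcases le_total (cost y ρst ρp (Real.exp (-s) • R) (Real.exp (-t) • S)) 0 with h0 | h0
  · exact le_trans (min_le_left _ _) (hm ⟨(_, _), hB _ _ (posDef_exp_smul hR _)
      (posDef_exp_smul hS _) hs ht h0, rfl⟩)
  · exact le_trans (min_le_right _ _) h0

end Coercivity

/-! ### Convergence of the iterates -/

section Convergence

variable {L Nst Np : ℕ} {y : Fin L → Fin Nst × Fin Np → ℂ} {ρst ρp : ℝ}

theorem eq_of_steinLoss_eq_zero {n : Type*} [Fintype n] [DecidableEq n] {A B : Matrix n n ℂ}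
    (hA : A.PosDef) (hB : B.PosDef) (h : steinLoss A B = 0) : A = B := by
  obtain ⟨P, hP, d, rfl, rfl⟩ := exists_simultaneous_diagonalization hA hB.1
  have hd := posDef_coords_pos hP hB
  rw [steinLoss_congr hP hd, Finset.sum_eq_zero_iff_of_nonneg fun i _ =>
    logGap_nonneg (inv_pos.2 (hd i))] at h
  have h1 : d = fun _ => 1 := funext fun i =>
    inv_eq_one.1 (logGap_eq_zero (inv_pos.2 (hd i)) (h i (Finset.mem_univ i)))
  rw [h1, rdiag_one, Matrix.mul_one]

/-- Without shrinkage the update preserves the trace, so that its Stein loss is the decrease of the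
log-determinant. -/
theorem steinLoss_updateSt_zero (hL : 0 < L) (hNst : 0 < Nst) (hNp : 0 < Np)
    (h : ExistenceCondition y 0 ρp) {R : Matrix (Fin Nst) (Fin Nst) ℂ}
    {S : Matrix (Fin Np) (Fin Np) ℂ} (hR : R.PosDef) (hS : S.PosDef) :
    steinLoss R (updateSt y 0 R S) =
      Real.log R.det.re - Real.log (updateSt y 0 R S).det.re := by
  obtain ⟨P, hP, d, hd, rfl, hu, hQ⟩ := exists_update_coords hL hNst hNp
    (Set.left_mem_Ico.2 zero_lt_one) h hR hS
  obtain ⟨Q, hQu, hQS⟩ := posDef_eq_mul_conjTranspose hS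
  have hsum : ∑ i, d i = Nst := by
    have h1 := hQ Q hQS
    simp only [sub_zero, one_mul, zero_mul, add_zero] at h1
    simp only [h1, ← Finset.mul_sum, sum_avgMass hL hP hQu (h.ne_zero hNp), mul_one]
  have h1 := log_det_congr hP hd
  have h2 := log_det_congr hP (d := fun _ => 1) (fun _ => one_pos)
  rw [rdiag_one, Matrix.mul_one] at h2
  rw [hu, steinLoss_congr hP hd, h1, h2]
  simp only [logGap, Real.log_inv, inv_inv, Finset.sum_sub_distrib, Finset.sum_add_distrib, hsum,
    Finset.sum_neg_distrib, Finset.sum_const, Finset.card_univ, Fintype.card_fin, nsmul_eq_mul,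
    Real.log_one]
  ring

theorem steinLoss_updateP_zero (hL : 0 < L) (hNst : 0 < Nst) (hNp : 0 < Np)
    (h : ExistenceCondition y ρst 0) {R : Matrix (Fin Nst) (Fin Nst) ℂ}
    {S : Matrix (Fin Np) (Fin Np) ℂ} (hR : R.PosDef) (hS : S.PosDef) :
    steinLoss S (updateP y 0 R S) =
      Real.log S.det.re - Real.log (updateP y 0 R S).det.re := by
  rw [updateP_eq_updateSt]
  exact steinLoss_updateSt_zero hL hNp hNst h.swap hS hR

theorem exists_tendsto_of_antitone {f : ℕ → ℝ} (hf : Antitone f) {m : ℝ} (hm : ∀ k, m ≤ f k) :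
    ∃ l, Filter.Tendsto f Filter.atTop (𝓝 l) :=
  ⟨_, tendsto_atTop_ciInf hf ⟨m, by rintro _ ⟨k, rfl⟩; exact hm k⟩⟩

/-- From k₀ on, x - C·c is nondecreasing, so the lower bound of c yields one for x. -/
theorem exists_tendsto_of_sub_le {c x : ℕ → ℝ} {C m : ℝ} (hC : 0 ≤ C) (hm : ∀ k, m ≤ c k)
    (hx : Antitone x) {k₀ : ℕ} (h : ∀ k ≥ k₀, x k - x (k + 1) ≤ C * (c k - c (k + 1))) :
    ∃ l, Filter.Tendsto x Filter.atTop (𝓝 l) := by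
  have h1 : ∀ j, x k₀ - C * c k₀ ≤ x (k₀ + j) - C * c (k₀ + j) := by
    intro j
    induction j with
    | zero => simp
    | succ j ih =>
      have := h (k₀ + j) (Nat.le_add_right _ _)
      rw [← add_assoc]
      linarith
  refine exists_tendsto_of_antitone hx (m := x k₀ - C * c k₀ + C * m) fun k => ?_
  have h2 := h1 k
  have h3 := hx (Nat.le_add_left k k₀)
  have h4 := mul_le_mul_of_nonneg_left (hm (k₀ + k)) hC
  linarith

theorem exists_abs_le_of_tendsto {x : ℕ → ℝ} {l : ℝ} (h : Filter.Tendsto x Filter.atTop (𝓝 l)) :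
    ∃ D, ∀ k, |x k| ≤ D := by
  obtain ⟨D, hD⟩ := (Metric.isBounded_range_of_tendsto x h).exists_norm_le
  exact ⟨D, fun k => hD _ ⟨k, rfl⟩⟩

/-- A sequence of updates in which the second factor is updated with the value `T k` of the first
one, which is the old or the new value. -/
structure IsUpdateSequence (y : Fin L → Fin Nst × Fin Np → ℂ) (ρst ρp : ℝ)
    (R T : ℕ → Matrix (Fin Nst) (Fin Nst) ℂ) (S : ℕ → Matrix (Fin Np) (Fin Np) ℂ) : Prop where
  posDef : ∀ k, (R k).PosDef ∧ (S k).PosDef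
  succ_left : ∀ k, R (k + 1) = updateSt y ρst (R k) (S k)
  succ_right : ∀ k, S (k + 1) = updateP y ρp (T k) (S k)
  eq_or_eq : T = R ∨ T = fun k => R (k + 1)
  decrease : ∃ δ > 0, ∃ C, 0 ≤ C ∧
    ∀ k, DecreaseControls y ρst ρp δ C (R k) (R (k + 1)) (S k) (S (k + 1))

variable {R T : ℕ → Matrix (Fin Nst) (Fin Nst) ℂ} {S : ℕ → Matrix (Fin Np) (Fin Np) ℂ}

theorem IsUpdateSequence.posDef_right (hs : IsUpdateSequence y ρst ρp R T S) (k : ℕ) :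
    (T k).PosDef := by
  rcases hs.eq_or_eq with h | h
  · rw [h]; exact (hs.posDef k).1
  · rw [h]; exact (hs.posDef (k + 1)).1

theorem IsUpdateSequence.antitone_cost (hs : IsUpdateSequence y ρst ρp R T S) :
    Antitone fun k => cost y ρst ρp (R k) (S k) := by
  obtain ⟨δ, hδ, C, hC, h⟩ := hs.decrease
  exact antitone_nat_of_succ_le fun k => (h k).1

/-- Along the sequence the cost converges, the Stein losses of the steps are summable in the sense
that they are eventually controlled by the decrease of the cost, and the log-determinants of the
unpenalized factors converge. -/
theorem IsUpdateSequence.exists_limits (hL : 0 < L) (hNst : 0 < Nst) (hNp : 0 < Np)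
    (hρst : ρst ∈ Set.Ico (0 : ℝ) 1) (hρp : ρp ∈ Set.Ico (0 : ℝ) 1)
    (h : ExistenceCondition y ρst ρp) (hs : IsUpdateSequence y ρst ρp R T S) :
    (∃ l, Filter.Tendsto (fun k => cost y ρst ρp (R k) (S k)) Filter.atTop (𝓝 l)) ∧
    Filter.Tendsto (fun k => steinLoss (R k) (R (k + 1))) Filter.atTop (𝓝 0) ∧
    Filter.Tendsto (fun k => steinLoss (S k) (S (k + 1))) Filter.atTop (𝓝 0) ∧
    (ρst = 0 → ∃ l, Filter.Tendsto (fun k => Real.log (R k).det.re) Filter.atTop (𝓝 l)) ∧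
    (ρp = 0 → ∃ l, Filter.Tendsto (fun k => Real.log (S k).det.re) Filter.atTop (𝓝 l)) := by
  obtain ⟨m, hm⟩ := exists_cost_ge hL hNst hNp hρst hρp h
  have hm' : ∀ k, m ≤ cost y ρst ρp (R k) (S k) := fun k =>
    hm _ _ (hs.posDef k).1 (hs.posDef k).2
  obtain ⟨l, hl⟩ := exists_tendsto_of_antitone hs.antitone_cost hm'
  obtain ⟨δ, hδ, C, hC, hdec⟩ := hs.decrease
  have hdrop : Filter.Tendsto (fun k => cost y ρst ρp (R k) (S k) -
      cost y ρst ρp (R (k + 1)) (S (k + 1))) Filter.atTop (𝓝 0) := by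
    have := hl.sub ((Filter.tendsto_add_atTop_iff_nat 1).2 hl)
    simpa using this
  -- The Stein losses are controlled only when the cost drops by at most δ, which holds from some
  -- index on.
  obtain ⟨k₀, hk₀⟩ := Filter.eventually_atTop.1 (hdrop.eventually (gt_mem_nhds hδ))
  have hR0 : ∀ k, 0 ≤ steinLoss (R k) (R (k + 1)) := fun k =>
    steinLoss_nonneg (hs.posDef k).1 (hs.posDef (k + 1)).1
  have hS0 : ∀ k, 0 ≤ steinLoss (S k) (S (k + 1)) := fun k =>
    steinLoss_nonneg (hs.posDef k).2 (hs.posDef (k + 1)).2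
  have hbound : ∀ k ≥ k₀, steinLoss (R k) (R (k + 1)) + steinLoss (S k) (S (k + 1)) ≤
      C * (cost y ρst ρp (R k) (S k) - cost y ρst ρp (R (k + 1)) (S (k + 1))) := fun k hk =>
    (hdec k).2 (hk₀ k hk).le
  have hCdrop : Filter.Tendsto (fun k => C * (cost y ρst ρp (R k) (S k) -
      cost y ρst ρp (R (k + 1)) (S (k + 1)))) Filter.atTop (𝓝 0) := by
    simpa using hdrop.const_mul C
  refine ⟨⟨l, hl⟩, ?_, ?_, ?_, ?_⟩
  · refine tendsto_of_tendsto_of_tendsto_of_le_of_le' tendsto_const_nhds hCdrop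
      (Filter.Eventually.of_forall hR0) (Filter.eventually_atTop.2 ⟨k₀, fun k hk => ?_⟩)
    linarith [hbound k hk, hS0 k]
  · refine tendsto_of_tendsto_of_tendsto_of_le_of_le' tendsto_const_nhds hCdrop
      (Filter.Eventually.of_forall hS0) (Filter.eventually_atTop.2 ⟨k₀, fun k hk => ?_⟩)
    linarith [hbound k hk, hR0 k]
  -- The cost does not see the scale of an unpenalized factor. Its log-determinant decreases by the
  -- Stein loss, whose sum is controlled by the total decrease of the cost.
  · rintro rfl
    have hst : ∀ k, steinLoss (R k) (R (k + 1)) =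
        Real.log (R k).det.re - Real.log (R (k + 1)).det.re := fun k => by
      rw [hs.succ_left k]
      exact steinLoss_updateSt_zero hL hNst hNp h (hs.posDef k).1 (hs.posDef k).2
    refine exists_tendsto_of_sub_le (c := fun k => cost y 0 ρp (R k) (S k)) hC hm'
      (antitone_nat_of_succ_le fun k => ?_) (k₀ := k₀) fun k hk => ?_
    · linarith [hst k, hR0 k]
    · linarith [hst k, hbound k hk, hS0 k]
  · rintro rfl
    have hst : ∀ k, steinLoss (S k) (S (k + 1)) =
        Real.log (S k).det.re - Real.log (S (k + 1)).det.re := fun k => by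
      rw [hs.succ_right k]
      exact steinLoss_updateP_zero hL hNst hNp h (hs.posDef_right k) (hs.posDef k).2
    refine exists_tendsto_of_sub_le (c := fun k => cost y ρst 0 (R k) (S k)) hC hm'
      (antitone_nat_of_succ_le fun k => ?_) (k₀ := k₀) fun k hk => ?_
    · linarith [hst k, hS0 k]
    · linarith [hst k, hbound k hk, hR0 k]

/-- Positive definite limits along finer filters solve the fixed-point equations. -/
theorem IsUpdateSequence.isSolution_of_tendsto (hL : 0 < L) (hNst : 0 < Nst) (hNp : 0 < Np)
    (hρst : ρst ∈ Set.Ico (0 : ℝ) 1) (hρp : ρp ∈ Set.Ico (0 : ℝ) 1)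
    (h : ExistenceCondition y ρst ρp) (hs : IsUpdateSequence y ρst ρp R T S) {F : Filter ℕ}
    [F.NeBot] (hF : F ≤ Filter.atTop) {A : Matrix (Fin Nst) (Fin Nst) ℂ}
    {B : Matrix (Fin Np) (Fin Np) ℂ} (hA : A.PosDef) (hB : B.PosDef)
    (hRA : Filter.Tendsto R F (𝓝 A)) (hSB : Filter.Tendsto S F (𝓝 B)) :
    IsSolution y ρst ρp A B := by
  have hy := h.ne_zero hNp
  obtain ⟨-, hlR, hlS, -, -⟩ := hs.exists_limits hL hNst hNp hρst hρp h
  have hR' : Filter.Tendsto (fun k => R (k + 1)) F (𝓝 (updateSt y ρst A B)) := by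
    simp only [hs.succ_left]
    have := (continuousAt_updateSt hy ρst hA hB).tendsto.comp (hRA.prodMk_nhds hSB)
    exact this
  have hA' := updateSt_posDef hL hNst hNp hρst h hA hB
  -- By continuity the Stein loss between A and its update is the limit of the losses between
  -- consecutive iterates, which is 0.
  have h1 : A = updateSt y ρst A B := by
    have := (continuousAt_steinLoss hA hA').tendsto.comp (hRA.prodMk_nhds hR')
    exact eq_of_steinLoss_eq_zero hA hA' (tendsto_nhds_unique this (hlR.mono_left hF))
  rw [← h1] at hR'
  -- Old and new first factors have the same limit along F, so both update schemes lead to the same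
  -- second fixed-point equation.
  have hT : Filter.Tendsto T F (𝓝 A) := by
    rcases hs.eq_or_eq with h2 | h2
    · rw [h2]; exact hRA
    · rw [h2]; exact hR'
  have hS' : Filter.Tendsto (fun k => S (k + 1)) F (𝓝 (updateP y ρp A B)) := by
    simp only [hs.succ_right]
    have := (continuousAt_updateP hy ρp hA hB).tendsto.comp (hT.prodMk_nhds hSB)
    exact this
  have hB' := updateP_posDef hL hNst hNp hρp h hA hB
  have h2 : B = updateP y ρp A B := by
    have := (continuousAt_steinLoss hB hB').tendsto.comp (hSB.prodMk_nhds hS')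
    exact eq_of_steinLoss_eq_zero hB hB' (tendsto_nhds_unique this (hlS.mono_left hF))
  exact ⟨hA, hB, h1, h2⟩

theorem eq_one_of_log_det_smul_eq {N : ℕ} (hN : 0 < N) {A : Matrix (Fin N) (Fin N) ℂ}
    (hA : A.PosDef) {c : ℝ} (hc : 0 < c) (h : Real.log (c • A).det.re = Real.log A.det.re) :
    c = 1 := by
  rw [← Real.exp_log hc, log_det_exp_smul hA] at h
  have hNr : (N : ℝ) ≠ 0 := by exact_mod_cast hN.ne'
  have h1 : (N : ℝ) * Real.log c = 0 := by linarith
  exact Real.eq_one_of_pos_of_log_eq_zero hc ((mul_eq_zero.1 h1).resolve_left hNr)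

/-- The iterates stay in a compact set and their cluster points are solutions of equal cost. Two of
them differ by scalings, which are trivial for penalized factors and, for unpenalized ones, excluded
by the common limit of the log-determinants. A sequence in a compact set with one cluster point
converges. -/
theorem IsUpdateSequence.exists_tendsto (hL : 0 < L) (hNst : 0 < Nst) (hNp : 0 < Np)
    (hρst : ρst ∈ Set.Ico (0 : ℝ) 1) (hρp : ρp ∈ Set.Ico (0 : ℝ) 1)
    (h : ExistenceCondition y ρst ρp) (hs : IsUpdateSequence y ρst ρp R T S) :
    ∃ A B, IsSolution y ρst ρp A B ∧ Filter.Tendsto R Filter.atTop (𝓝 A) ∧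
      Filter.Tendsto S Filter.atTop (𝓝 B) := by
  have hy := h.ne_zero hNp
  obtain ⟨⟨l, hl⟩, -, -, hlR, hlS⟩ := hs.exists_limits hL hNst hNp hρst hρp h
  have hD : ∃ D, (ρst = 0 → ∀ k, |Real.log (R k).det.re| ≤ D) ∧
      (ρp = 0 → ∀ k, |Real.log (S k).det.re| ≤ D) := by
    have key : ∀ {ρ : ℝ} {x : ℕ → ℝ}, (ρ = 0 → ∃ l, Filter.Tendsto x Filter.atTop (𝓝 l)) →
        ∃ D, ρ = 0 → ∀ k, |x k| ≤ D := by
      intro ρ x hx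
      by_cases h0 : ρ = 0
      · obtain ⟨l, hl⟩ := hx h0
        obtain ⟨D, hD⟩ := exists_abs_le_of_tendsto hl
        exact ⟨D, fun _ => hD⟩
      · exact ⟨0, fun h => (h0 h).elim⟩
    obtain ⟨D, hD⟩ := key hlR
    obtain ⟨D', hD'⟩ := key hlS
    exact ⟨max D D', fun h0 k => le_trans (hD h0 k) (le_max_left _ _),
      fun h0 k => le_trans (hD' h0 k) (le_max_right _ _)⟩
  obtain ⟨D, hDR, hDS⟩ := hD
  obtain ⟨B, hB⟩ := exists_boundedPosDef hL hNst hNp hρst hρp h (cost y ρst ρp (R 0) (S 0)) D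
  have hK := (isCompact_boundedPosDef (n := Fin Nst) B).prod
    (isCompact_boundedPosDef (n := Fin Np) B)
  have hmem : ∀ k, (R k, S k) ∈ boundedPosDef (Fin Nst) B ×ˢ boundedPosDef (Fin Np) B := fun k =>
    hB _ _ (hs.posDef k).1 (hs.posDef k).2 (fun h0 => hDR h0 k) (fun h0 => hDS h0 k)
      (hs.antitone_cost (Nat.zero_le k))
  have hcl : ∀ z ∈ boundedPosDef (Fin Nst) B ×ˢ boundedPosDef (Fin Np) B,
      MapClusterPt z Filter.atTop (fun k => (R k, S k)) → IsSolution y ρst ρp z.1 z.2 ∧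
        cost y ρst ρp z.1 z.2 = l ∧
        (∀ r, ρst = 0 → Filter.Tendsto (fun k => Real.log (R k).det.re) Filter.atTop (𝓝 r) →
          Real.log z.1.det.re = r) ∧
        (∀ r, ρp = 0 → Filter.Tendsto (fun k => Real.log (S k).det.re) Filter.atTop (𝓝 r) →
          Real.log z.2.det.re = r) := by
    rintro ⟨X, Y⟩ ⟨hX, hY⟩ hz
    have hX := posDef_of_mem_boundedPosDef hX
    have hY := posDef_of_mem_boundedPosDef hY
    -- Ultrafilters take the place of convergent subsequences.
    obtain ⟨U, hU, hUz⟩ := mapClusterPt_iff_ultrafilter.1 hz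
    have hUX : Filter.Tendsto R U (𝓝 X) := (continuous_fst.tendsto (X, Y)).comp hUz
    have hUY : Filter.Tendsto S U (𝓝 Y) := (continuous_snd.tendsto (X, Y)).comp hUz
    refine ⟨hs.isSolution_of_tendsto hL hNst hNp hρst hρp h hU hX hY hUX hUY, ?_, ?_, ?_⟩
    · exact tendsto_nhds_unique ((continuousAt_cost hy ρst ρp hX hY).tendsto.comp hUz)
        (hl.mono_left hU)
    · intro r _ hr
      exact tendsto_nhds_unique ((continuousAt_log_det hX).tendsto.comp hUX) (hr.mono_left hU)
    · intro r _ hr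
      exact tendsto_nhds_unique ((continuousAt_log_det hY).tendsto.comp hUY) (hr.mono_left hU)
  obtain ⟨z, hz, hzc⟩ := hK.exists_mapClusterPt (f := Filter.atTop) (u := fun k => (R k, S k))
    (Filter.tendsto_principal.2 (Filter.Eventually.of_forall hmem))
  obtain ⟨hsol, hcz, hRz, hSz⟩ := hcl z hz hzc
  have huniq : Filter.Tendsto (fun k => (R k, S k)) Filter.atTop (𝓝 z) := by
    refine hK.tendsto_nhds_of_unique_mapClusterPt (Filter.Eventually.of_forall hmem)
      fun w hw hwc => ?_
    obtain ⟨hsol', hcw, hRw, hSw⟩ := hcl w hw hwc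
    obtain ⟨c, c', hc1, hc1', hc, hc', hwR, hwS⟩ := (solution_minimizes hL hNst hNp hρst hρp h hsol
      hsol'.1 hsol'.2.1).2 (hcw.trans hcz.symm).le
    have hc : c = 1 := by
      rcases hρst.1.eq_or_lt with h0 | h0
      · obtain ⟨r, hr⟩ := hlR h0.symm
        refine eq_one_of_log_det_smul_eq hNst hsol.1 hc ?_
        rw [← hwR, hRw r h0.symm hr, hRz r h0.symm hr]
      · exact hc1 h0
    have hc' : c' = 1 := by
      rcases hρp.1.eq_or_lt with h0 | h0
      · obtain ⟨r, hr⟩ := hlS h0.symm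
        refine eq_one_of_log_det_smul_eq hNp hsol.2.1 hc' ?_
        rw [← hwS, hSw r h0.symm hr, hSz r h0.symm hr]
      · exact hc1' h0
    rw [hc, one_smul] at hwR
    rw [hc', one_smul] at hwS
    exact Prod.ext hwR hwS
  exact ⟨z.1, z.2, hsol, (continuous_fst.tendsto z).comp huniq,
    (continuous_snd.tendsto z).comp huniq⟩

end Convergence

end RSKE

theorem proposition2 {L Nst Np : ℕ} (hL : 0 < L) (hNst : 0 < Nst) (hNp : 0 < Np)
    (y : Fin L → Fin Nst × Fin Np → ℂ) (ρst ρp : ℝ)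
    (hρst : ρst ∈ Set.Ico (0 : ℝ) 1) (hρp : ρp ∈ Set.Ico (0 : ℝ) 1)
    (hcond : RSKE.ExistenceCondition y ρst ρp)
    (Rst : ℕ → Matrix (Fin Nst) (Fin Nst) ℂ) (Rp : ℕ → Matrix (Fin Np) (Fin Np) ℂ)
    (hRst : (Rst 0).PosDef) (hRp : (Rp 0).PosDef)
    (hiter : RSKE.IsSimultaneousIteration y ρst ρp Rst Rp ∨
      RSKE.IsAlternatingIteration y ρst ρp Rst Rp) :
    (∀ k, (Rst k).PosDef ∧ (Rp k).PosDef) ∧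
    Antitone (fun k => RSKE.cost y ρst ρp (Rst k) (Rp k)) ∧
    ∃ (RstInf : Matrix (Fin Nst) (Fin Nst) ℂ) (RpInf : Matrix (Fin Np) (Fin Np) ℂ),
      RSKE.IsSolution y ρst ρp RstInf RpInf ∧
      Filter.Tendsto Rst Filter.atTop (𝓝 RstInf) ∧
      Filter.Tendsto Rp Filter.atTop (𝓝 RpInf) := by
  have hpos : ∀ k, (Rst k).PosDef ∧ (Rp k).PosDef := by
    intro k
    induction k with
    | zero => exact ⟨hRst, hRp⟩
    | succ k ih =>
      have h1 := RSKE.updateSt_posDef hL hNst hNp hρst hcond ih.1 ih.2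
      rcases hiter with h | h
      · rw [(h k).1, (h k).2]
        exact ⟨h1, RSKE.updateP_posDef hL hNst hNp hρp hcond ih.1 ih.2⟩
      · rw [(h k).2, (h k).1]
        exact ⟨h1, RSKE.updateP_posDef hL hNst hNp hρp hcond h1 ih.2⟩
  have hseq : ∃ T, RSKE.IsUpdateSequence y ρst ρp Rst T Rp := by
    rcases hiter with h | h
    · refine ⟨Rst, hpos, fun k => (h k).1, fun k => (h k).2, Or.inl rfl, ?_⟩
      obtain ⟨δ, hδ, C, hC, hdec⟩ := RSKE.decrease_simultaneous hL hNst hNp hρst hρp hcond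
      refine ⟨δ, hδ, C, hC, fun k => ?_⟩
      rw [(h k).1, (h k).2]
      exact hdec _ _ (hpos k).1 (hpos k).2
    · refine ⟨fun k => Rst (k + 1), hpos, fun k => (h k).1, fun k => (h k).2, Or.inr rfl, ?_⟩
      obtain ⟨δ, hδ, C, hC, hdec⟩ := RSKE.decrease_alternating hL hNst hNp hρst hρp hcond
      refine ⟨δ, hδ, C, hC, fun k => ?_⟩
      rw [(h k).2, (h k).1]
      exact hdec _ _ (hpos k).1 (hpos k).2
  obtain ⟨T, hT⟩ := hseq
  exact ⟨hpos, hT.antitone_cost, hT.exists_tendsto hL hNst hNp hρst hρp hcond⟩
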